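/- **Notation.** For $0<\varepsilon<1$ let $f_\varepsilon:[0,\infty)\to[0,1]$ be the continuous function that is $0$ on $[0,\varepsilon/2]$, linear on $[\varepsilon/2,\varepsilon]$ and $1$ on $[\varepsilon,\infty)$. For positive elements $a,b$ of a C*-algebra $B$ write $a\lesssim b$ if there are $x_n\in B$ with $x_n^*bx_n\to a$ in norm. $T(B)$ is the set of tracial states of $B$, $\overline{T(B)}^{w}$ its weak*-closure in the dual of $B$, and $d_\tau(a)=\lim_{\varepsilon\to0}\tau(f_\varepsilon(a))$; a trace $\tau$ on $B$ is extended to $M_n(B)$ by $\tau((a_{ij}))=\sum_i\tau(a_{ii})$. Let $\mathcal C_0$ be the class of C*-algebras $\{(f,g)\in C([0,1],F_2)\oplus F_1: f(0)=\varphi_0(g),\ f(1)=\varphi_1(g)\}$, where $F_1,F_2$ are finite dimensional C*-algebras and $\varphi_0,\varphi_1:F_1\to F_2$ are (not necessarily unital) $*$-homomorphisms, which satisfy $K_1(C)=\{0\}$, $K_0(C)_+=\{0\}$ and $0\notin\overline{T(C)}^{w}$. Let $\mathcal C_0'$ be the class of C*-algebras isomorphic to full hereditary C*-subalgebras of algebras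 in $\mathcal C_0$. A non-unital simple C*-algebra $A$ belongs to $\mathcal D$ if it has a strictly positive element $a$ with $\|a\|=1$ and there is $0<\mathfrak f_a<1$ such that for every $\varepsilon>0$, every finite $\mathcal F\subset A$ and every $b\in A_+\setminus\{0\}$ there are a nonzero C*-subalgebra $D\subset A$ with $D\in\mathcal C_0'$ and completely positive contractive linear maps $\varphi:A\to A$, $\psi:A\to D$ with $\varphi(A)\perp D$ such that $\|\varphi(xy)-\varphi(x)\varphi(y)\|<\varepsilon$ and $\|\psi(xy)-\psi(x)\psi(y)\|<\varepsilon$ for $x,y\in\mathcal F$; $\|x-(\varphi(x)+\psi(x))\|<\varepsilon$ for $x\in\mathcal F\cup\{a\}$; $\varphi(a)\lesssim b$; and $t(f_{1/4}(\psi(a)))\ge\mathfrak f_a$ for all $t\in T(D)$. **Theorem.** Let $A$ be a separable simple C*-algebra in $\mathcal D$. (1) If $a,b\in A$ satisfy $0\le a\le1$, $0\le b\le 1$ and $d_\tau(a)<d_\tau(b)$ for all $\tau\in\overline{T(A)}^{w}$, then $a\lesssim b$. (2) Consequently $A$ has (strong) strict comparison for positive elements: $T(A)\neq\emptyset$, $0\notin\overline{T(A)}^{w}$,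 and for every $n$ and all positive $a,b\in M_n(A)$ with $d_\tau(a)<d_\tau(b)$ for all $\tau\in\overline{T(A)}^{w}$, one has $a\lesssim b$ in $M_n(A)$. -/

import Mathlib

open scoped ENNReal ComplexOrder CStarAlgebra

noncomputable section

/-! ### Cut-down functions, Cuntz subequivalence, strictly positive elements -/

/-- The continuous function `f_ε : ℝ → ℝ` which is `0` on `(-∞, ε/2]`, linear on `[ε/2, ε]` and
`1` on `[ε, ∞)` (for `ε > 0`). -/
def cutFn (ε t : ℝ) : ℝ := max 0 (min 1 ((t - ε / 2) / (ε / 2)))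

/-- Cuntz subequivalence `a ≲ b`: there are `xₙ` in the algebra with `xₙ* b xₙ → a` in norm. -/
def CuntzLE {B : Type*} [NonUnitalCStarAlgebra B] (a b : B) : Prop :=
  ∃ x : ℕ → B, Filter.Tendsto (fun n => star (x n) * b * x n) Filter.atTop (nhds a)

/-- A positive element `a` is strictly positive if `aBa` is norm dense in `B`. -/
def IsStrictlyPosElt {B : Type*} [NonUnitalCStarAlgebra B] [PartialOrder B] [StarOrderedRing B]
    (a : B) : Prop :=
  0 ≤ a ∧ Dense (Set.range fun x : B => a * x * a)

/-- A C*-algebra is simple if it is nonzero and has no closed two-sided ideals other than `0` and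
itself. -/
def IsSimpleCStar (B : Type*) [NonUnitalCStarAlgebra B] : Prop :=
  Nontrivial B ∧ ∀ I : TwoSidedIdeal B, IsClosed (I : Set B) → I = ⊥ ∨ I = ⊤

/-- A C*-algebra is non-unital if it has no multiplicative identity. -/
def IsNonUnital (B : Type*) [NonUnitalCStarAlgebra B] : Prop :=
  ¬ ∃ e : B, ∀ x : B, e * x = x ∧ x * e = x

/-! ### Tracial states and dimension functions -/

/-- `T(B)`: the tracial states of `B`, i.e. positive linear functionals of norm one with
`τ(xy) = τ(yx)`, as a subset of the dual space with its weak*-topology. -/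
def tracialStates (B : Type*) [NonUnitalCStarAlgebra B] : Set (WeakDual ℂ B) :=
  {τ | (∀ x : B, 0 ≤ τ (star x * x)) ∧ (∀ x y : B, τ (x * y) = τ (y * x)) ∧
    ‖WeakDual.toStrongDual τ‖ = 1}

/-- `d_τ(a) = lim_{ε → 0} τ(f_ε(a))` for a positive trace `τ` on `B` and `a ≥ 0`. Since `τ(f_ε(a))`
increases as `ε` decreases to `0`, the limit is the supremum over `0 < ε < 1`. -/
def dimFn {B : Type*} [NonUnitalCStarAlgebra B] (τ : B → ℂ) (a : B) : ℝ≥0∞ :=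
  ⨆ ε ∈ Set.Ioo (0 : ℝ) 1, ENNReal.ofReal (τ (cfcₙ (cutFn ε) a)).re

/-- The canonical extension `τ ⊗ Tr` of a trace `τ` on `B` to the matrix algebra `M_n(B)`. -/
def matTrace {B : Type*} (τ : B → ℂ) (n : ℕ) (x : CStarMatrix (Fin n) (Fin n) B) : ℂ :=
  ∑ i, τ (x i i)

/-! ### The conditions on `K₀` and `K₁`

For a C*-algebra `B`, the group `K₁(B)` is the group of stable homotopy classes of unitary matrices
over the (forced) unitization of `B`, and `K₀(B)` is a subgroup of the Grothendieck group of the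
Murray-von Neumann classes of projection matrices over the unitization of `B`. -/

/-- Murray-von Neumann equivalence of projections, possibly of different matrix sizes. -/
def MvNEquiv {R m n : Type*} [Ring R] [StarRing R] [Fintype m] [Fintype n]
    (p : Matrix m m R) (q : Matrix n n R) : Prop :=
  ∃ v : Matrix n m R, v.conjTranspose * v = p ∧ v * v.conjTranspose = q

/-- Equality of the classes of two projections over a unital ring in `K₀`, i.e. stable equivalence
`p ⊕ 1_k ∼ q ⊕ 1_k` for some `k`. -/
def SameK0Class {R m n : Type*} [Ring R] [StarRing R] [Fintype m] [Fintype n]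
    (p : Matrix m m R) (q : Matrix n n R) : Prop :=
  ∃ k : ℕ, MvNEquiv (Matrix.fromBlocks p 0 0 (1 : Matrix (Fin k) (Fin k) R))
    (Matrix.fromBlocks q 0 0 (1 : Matrix (Fin k) (Fin k) R))

/-- Two unitary matrices of the same size over a unital topological *-ring have the same class in
`K₁`: `u ⊕ 1_k` and `w ⊕ 1_k` are joined by a path of unitaries for some `k`. -/
def SameK1Class {R : Type*} [Ring R] [StarRing R] [TopologicalSpace R] {n : ℕ}
    (u w : Matrix (Fin n) (Fin n) R) : Prop :=
  ∃ k : ℕ, JoinedIn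
    (unitary (Matrix (Fin n ⊕ Fin k) (Fin n ⊕ Fin k) R) :
      Set (Matrix (Fin n ⊕ Fin k) (Fin n ⊕ Fin k) R))
    (Matrix.fromBlocks u 0 0 1) (Matrix.fromBlocks w 0 0 1)

/-- `K₀(B)₊ = {0}`, where `K₀(B)₊` is the set of classes of projections in the algebras
`M_n(B)`. -/
def K0PosTrivial (B : Type*) [NonUnitalCStarAlgebra B] : Prop :=
  ∀ (n : ℕ) (p : Matrix (Fin n) (Fin n) B), IsStarProjection p →
    SameK0Class (p.map (Unitization.inr : B → Unitization ℂ B))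
      (0 : Matrix (Fin n) (Fin n) (Unitization ℂ B))

/-- `K₁(B) = {0}`. -/
def K1Trivial (B : Type*) [NonUnitalCStarAlgebra B] : Prop :=
  ∀ (n : ℕ) (u : Matrix (Fin n) (Fin n) (Unitization ℂ B)),
    u ∈ unitary (Matrix (Fin n) (Fin n) (Unitization ℂ B)) → SameK1Class u 1

/-! ### One-dimensional non-commutative complexes -/

section Blocks

variable {F₁ F₂ : Type*} [CStarAlgebra F₁] [CStarAlgebra F₂]

/-- The mapping torus
`A(F₁, F₂, φ₀, φ₁) = {(f, g) ∈ C([0,1], F₂) ⊕ F₁ : f(0) = φ₀(g), f(1) = φ₁(g)}`. -/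
def mappingTorus (φ₀ φ₁ : F₁ →⋆ₙₐ[ℂ] F₂) :
    NonUnitalStarSubalgebra ℂ (C(unitInterval, F₂) × F₁) where
  carrier := {x | x.1 0 = φ₀ x.2 ∧ x.1 1 = φ₁ x.2}
  add_mem' := by
    rintro x y ⟨hx, hx'⟩ ⟨hy, hy'⟩
    simp [hx, hx', hy, hy']
  zero_mem' := by simp
  mul_mem' := by
    rintro x y ⟨hx, hx'⟩ ⟨hy, hy'⟩
    simp [hx, hx', hy, hy']
  smul_mem' := by
    rintro c x ⟨hx, hx'⟩
    simp [hx, hx']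
  star_mem' := by
    rintro x ⟨hx, hx'⟩
    simp [hx, hx', map_star]

instance mappingTorus_isClosed (φ₀ φ₁ : F₁ →⋆ₙₐ[ℂ] F₂) :
    IsClosed (mappingTorus φ₀ φ₁ : Set (C(unitInterval, F₂) × F₁)) := by
  have h₀ : Continuous φ₀ := map_continuous φ₀
  have h₁ : Continuous φ₁ := map_continuous φ₁
  refine IsClosed.inter (isClosed_eq ?_ ?_) (isClosed_eq ?_ ?_)
  · exact (continuous_eval_const _).comp continuous_fst
  · exact h₀.comp continuous_snd
  · exact (continuous_eval_const _).comp continuous_fst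
  · exact h₁.comp continuous_snd

end Blocks

/-- The three conditions which cut out the class `𝒞₀` among the mapping tori: `K₁(B) = {0}`,
`K₀(B)₊ = {0}`, and `0` is not in the weak*-closure of `T(B)`. -/
def C0Conditions (B : Type*) [NonUnitalCStarAlgebra B] : Prop :=
  K1Trivial B ∧ K0PosTrivial B ∧ (0 : WeakDual ℂ B) ∉ closure (tracialStates B)

/-- A C*-subalgebra `H` of `B` is hereditary if `0 ≤ x ≤ y` and `y ∈ H` imply `x ∈ H`. (The
positive elements of a C*-algebra are the elements `z* z`.) -/
def IsHereditary {B : Type*} [NonUnitalCStarAlgebra B] (H : NonUnitalStarSubalgebra ℂ B) : Prop :=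
  ∀ x y : B, (∃ z, x = star z * z) → (∃ z, y - x = star z * z) → y ∈ H → x ∈ H

/-- A subset of `B` is full if it is not contained in a proper closed two-sided ideal. -/
def IsFullSet {B : Type*} [NonUnitalCStarAlgebra B] (S : Set B) : Prop :=
  ∀ I : TwoSidedIdeal B, IsClosed (I : Set B) → S ⊆ (I : Set B) → I = ⊤

/-- The class `𝒞₀'`: C*-algebras (isomorphic to) full hereditary C*-subalgebras of C*-algebras in
`𝒞₀`, where `𝒞₀` consists of the mapping tori of pairs of homomorphisms between finite dimensional
C*-algebras which satisfy `C0Conditions`. -/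
def InC0Prime (D : Type*) [NonUnitalCStarAlgebra D] : Prop :=
  ∃ (F₁ F₂ : Type) (_ : CStarAlgebra F₁) (_ : CStarAlgebra F₂)
    (_ : FiniteDimensional ℂ F₁) (_ : FiniteDimensional ℂ F₂) (φ₀ φ₁ : F₁ →⋆ₙₐ[ℂ] F₂),
    C0Conditions (mappingTorus φ₀ φ₁) ∧
    ∃ H : NonUnitalStarSubalgebra ℂ (mappingTorus φ₀ φ₁),
      IsClosed (H : Set (mappingTorus φ₀ φ₁)) ∧ IsHereditary (B := mappingTorus φ₀ φ₁) H ∧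
      IsFullSet (B := mappingTorus φ₀ φ₁) (H : Set (mappingTorus φ₀ φ₁)) ∧ Nonempty (D ≃⋆ₐ[ℂ] H)

/-! ### The class `𝒟` and strict comparison -/

section ClassD

variable (A : Type*) [NonUnitalCStarAlgebra A] [PartialOrder A] [StarOrderedRing A]

/-- The class `𝒟`. A map into a C*-subalgebra `D` is a map into `A` with values in `D`;
`diag(φ(x), ψ(x))` stands for `φ(x) + ψ(x)`, where the image of `φ` is orthogonal to `D`. -/
def InClassD : Prop :=
  IsNonUnital A ∧ IsSimpleCStar A ∧
  ∃ a : A, IsStrictlyPosElt a ∧ ‖a‖ = 1 ∧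
  ∃ 𝔣 : ℝ, 0 < 𝔣 ∧ 𝔣 < 1 ∧
  ∀ ε : ℝ, 0 < ε → ∀ F : Finset A, ∀ b : A, 0 ≤ b → b ≠ 0 →
  ∃ (φ ψ : A →CP A) (D : NonUnitalStarSubalgebra ℂ A) (_ : IsClosed (D : Set A))
    (hψD : ∀ x, ψ x ∈ D),
    (∀ x, ‖φ x‖ ≤ ‖x‖) ∧ (∀ x, ‖ψ x‖ ≤ ‖x‖) ∧
    (∀ x ∈ F, ∀ y ∈ F, ‖φ (x * y) - φ x * φ y‖ < ε) ∧
    (∀ x ∈ F, ∀ y ∈ F, ‖ψ (x * y) - ψ x * ψ y‖ < ε) ∧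
    (∀ x, ∀ d ∈ D, φ x * d = 0 ∧ d * φ x = 0) ∧
    (∀ x ∈ (F : Set A) ∪ {a}, ‖x - (φ x + ψ x)‖ < ε) ∧
    D ≠ ⊥ ∧ InC0Prime D ∧
    CuntzLE (φ a) b ∧
    ∀ t ∈ tracialStates D, 𝔣 ≤ (t (cfcₙ (cutFn (1 / 4)) (⟨ψ a, hψD a⟩ : D))).re

/-- Strict comparison for positive elements with respect to the weak*-closure of `T(A)` (strong
strict comparison): `T(A)` is non-empty, its weak*-closure does not contain `0`, and for all `n`
and all positive `a, b ∈ M_n(A)`, if `d_τ(a) < d_τ(b)` for all `τ` in the weak*-closure of `T(A)`,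
then `a ≲ b`. -/
def HasStrongStrictComparison : Prop :=
  (tracialStates A).Nonempty ∧ (0 : WeakDual ℂ A) ∉ closure (tracialStates A) ∧
  ∀ (n : ℕ) (a b : CStarMatrix (Fin n) (Fin n) A), 0 ≤ a → 0 ≤ b →
    (∀ τ ∈ closure (tracialStates A), dimFn (matTrace τ n) a < dimFn (matTrace τ n) b) →
    CuntzLE a b

end ClassD

end

/-! Fix `ε`. Since the weak*-closure of T(A) is compact, the pointwise inequality d_τ(a) < d_τ(b)
yields a single δ > 0 with τ(f_ε(a)) + δ ≤ τ(f_δ(b)) for all tracial states (`exists_trace_add_le`).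
It then suffices to find X with ‖X*bX − a‖ < 10ε (`exists_norm_conj_sub_lt_of_trace_add_le`).

Membership in 𝒟 splits the identity approximately into φ + ψ, where ψ takes values in some D in 𝒞₀'
and φ(a₀) is as small as desired. The two parts of a are dominated by orthogonal parts of b. A
simple non-unital algebra with a tracial state is not elementary, so under every nonzero positive
element lie arbitrarily many orthogonal copies of some nonzero c (`exists_conj_eq_ite`). A piece of
b of trace at most δ/8 can therefore be reserved to absorb φ(a), and the complementary corner b'
still exceeds a in trace.

For the ψ part, tracial states of the algebras D pulled back along ψ have as limits positive
multiples of tracial states of A (`exists_limit_trace`); the constant 𝔣_a keeps the limits nonzero.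
Hence the strict inequality on T(A) passes to T(D) far along the net (`eventually_trace_le`).

It remains to compare inside D, a hereditary subalgebra of a mapping torus. In a finite dimensional
algebra traces decide comparison of projections (`exists_partialIsometry_of_trace_le`), hence
approximate comparison of positive elements (`exists_norm_conj_sub_le`). The fibrewise solutions of
x*bx ≈ a must be joined into a continuous one with boundary values given by a solution in F₁. No
obstruction arises, because the approximate solutions in one fibre are path connected up to a small
loss (`joinedIn_approx_solutions`): on the complex line through two of them only finitely many
points are degenerate, and these can be avoided.

A limit trace also shows that T(A) is nonempty, and the uniform bound τ(f_{1/4}(a₀)) ≥ f₀/32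
(`le_trace_cutFn`) keeps 0 out of the closure. Statement (1) is the case n = 1 of (2). -/

open Filter Topology

/-! ### Functional calculus tools -/

/-- To prove a property of all continuous functions vanishing at `0` it is enough to prove it for
monomials, sums, and uniform limits on an interval. -/
theorem continuous_zero_induction {P : (ℝ → ℝ) → Prop} (M : ℝ)
    (hadd : ∀ f g, Continuous f → f 0 = 0 → Continuous g → g 0 = 0 → P f → P g →
      P (fun t => f t + g t))
    (hmono : ∀ (c : ℝ) (k : ℕ), P (fun t => c * t ^ (k + 1)))
    (hlim : ∀ g, Continuous g → g 0 = 0 → (∀ ε > 0, ∃ p, Continuous p ∧ p 0 = 0 ∧ P p ∧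
      ∀ t ∈ Set.Icc (-M) M, |p t - g t| ≤ ε) → P g)
    {g : ℝ → ℝ} (hg : Continuous g) (hg0 : g 0 = 0) : P g := by
  have key : ∀ q : Polynomial ℝ, P (fun t => t * q.eval t) := by
    intro q
    induction q using Polynomial.induction_on' with
    | add p q hp hq =>
      have := hadd _ _ (by fun_prop) (by simp) (by fun_prop) (by simp) hp hq
      simpa [mul_add] using this
    | monomial n a =>
      have := hmono a n
      have e : (fun t : ℝ => t * (Polynomial.monomial n a).eval t)
          = fun t => a * t ^ (n + 1) := by
        ext t; simp [Polynomial.eval_monomial]; ring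
      rw [e]; exact this
  refine hlim g hg hg0 fun ε hε => ?_
  -- The interval is symmetric around `0` whatever the sign of `M`: since `g 0 = 0`, the constant
  -- term of `p` is itself below `ε / 2` and may be dropped.
  obtain ⟨p, hp⟩ := exists_polynomial_near_of_continuousOn (-|M|) |M| g hg.continuousOn (ε / 2)
    (by positivity)
  refine ⟨fun t => t * p.divX.eval t, by fun_prop, by simp, key _, fun t ht => ?_⟩
  have h0 := hp 0 (by simp)
  have ht' : t ∈ Set.Icc (-|M|) |M| :=
    ⟨by have := ht.1; have := le_abs_self M; linarith, ht.2.trans (le_abs_self M)⟩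
  have h1 := hp t ht'
  have e : p.eval t = t * p.divX.eval t + p.eval 0 := by
    conv_lhs => rw [← Polynomial.divX_mul_X_add p]
    simp [Polynomial.coeff_zero_eq_eval_zero, mul_comm]
  rw [hg0] at h0
  rw [abs_lt] at h0 h1
  rw [abs_le]
  constructor <;> linarith

section NonUnital

variable {B : Type*} [NonUnitalCStarAlgebra B]

theorem quasispectrum_subset_Icc {x : B} {M : ℝ} (hx : IsSelfAdjoint x) (hM : ‖x‖ ≤ M) :
    quasispectrum ℝ x ⊆ Set.Icc (-M) M := by
  intro t ht
  have := NonUnitalIsometricContinuousFunctionalCalculus.norm_quasispectrum_le (𝕜 := ℝ) x ht hx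
  rw [Real.norm_eq_abs] at this
  exact abs_le.mp (this.trans hM)

theorem norm_cfcₙ_sub_le {x : B} {M ε : ℝ} (hx : IsSelfAdjoint x) (hM : ‖x‖ ≤ M) {f g : ℝ → ℝ}
    (hf : Continuous f) (hf0 : f 0 = 0) (hg : Continuous g) (hg0 : g 0 = 0)
    (h : ∀ t ∈ Set.Icc (-M) M, |f t - g t| ≤ ε) : ‖cfcₙ f x - cfcₙ g x‖ ≤ ε := by
  rw [← cfcₙ_sub f g x hf.continuousOn hf0 hg.continuousOn hg0]
  exact norm_cfcₙ_le fun t ht => h t (quasispectrum_subset_Icc hx hM ht)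

theorem cfcₙ_const_mul_pow_succ {x : B} (hx : IsSelfAdjoint x) (c : ℝ) (k : ℕ) :
    cfcₙ (fun t : ℝ => c * t ^ (k + 1 + 1)) x = cfcₙ (fun t : ℝ => c * t ^ (k + 1)) x * x := by
  conv_rhs => rw [← cfcₙ_id' ℝ x, cfcₙ_id' ℝ x]
  conv_rhs => arg 2; rw [← cfcₙ_id' ℝ x]
  rw [← cfcₙ_mul _ _ x (by fun_prop) (by simp) (by fun_prop) (by simp)]
  congr 1
  ext t; ring

/-- If `y w = w x` with `x, y` self-adjoint then `g(y) w = w g(x)`. -/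
theorem cfcₙ_mul_eq_mul_cfcₙ {x y w : B} (hx : IsSelfAdjoint x) (hy : IsSelfAdjoint y)
    (h : y * w = w * x) {g : ℝ → ℝ} (hg : Continuous g) (hg0 : g 0 = 0) :
    cfcₙ g y * w = w * cfcₙ g x := by
  refine continuous_zero_induction (P := fun g => cfcₙ g y * w = w * cfcₙ g x)
    (max ‖x‖ ‖y‖) ?_ ?_ ?_ hg hg0
  · intro f g hf hf0 hg hg0 h1 h2
    rw [cfcₙ_add f g x hf.continuousOn hf0 hg.continuousOn hg0,
      cfcₙ_add f g y hf.continuousOn hf0 hg.continuousOn hg0, add_mul, mul_add, h1, h2]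
  · intro c k
    induction k with
    | zero =>
      simp only [zero_add, pow_one]
      rw [cfcₙ_const_mul_id c x, cfcₙ_const_mul_id c y, smul_mul_assoc, mul_smul_comm, h]
    | succ k ih =>
      beta_reduce at ih ⊢
      rw [cfcₙ_const_mul_pow_succ hx, cfcₙ_const_mul_pow_succ hy, mul_assoc, h, ← mul_assoc, ih,
        mul_assoc]
  · intro g hg hg0 hap
    rw [← sub_eq_zero, ← norm_le_zero_iff]
    refine le_of_forall_pos_le_add fun ε hε => ?_
    obtain ⟨p, hp, hp0, hP, hpg⟩ := hap (ε / (2 * (‖w‖ + 1))) (by positivity)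
    have e1 := norm_cfcₙ_sub_le hx (le_max_left ‖x‖ ‖y‖) hp hp0 hg hg0 hpg
    have e2 := norm_cfcₙ_sub_le hy (le_max_right ‖x‖ ‖y‖) hp hp0 hg hg0 hpg
    have : cfcₙ g y * w - w * cfcₙ g x
        = w * (cfcₙ p x - cfcₙ g x) - (cfcₙ p y - cfcₙ g y) * w := by
      rw [mul_sub, sub_mul, ← hP]; abel
    rw [this]
    refine (norm_sub_le _ _).trans ?_
    have a1 := norm_mul_le w (cfcₙ p x - cfcₙ g x)
    have a2 := norm_mul_le (cfcₙ p y - cfcₙ g y) w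
    have hw := norm_nonneg w
    have b1 : ‖w‖ * ‖cfcₙ p x - cfcₙ g x‖ ≤ (‖w‖ + 1) * (ε / (2 * (‖w‖ + 1))) := by gcongr; linarith
    have b2 : ‖cfcₙ p y - cfcₙ g y‖ * ‖w‖ ≤ (ε / (2 * (‖w‖ + 1))) * (‖w‖ + 1) := by gcongr; linarith
    have : (‖w‖ + 1) * (ε / (2 * (‖w‖ + 1))) = ε / 2 := by field_simp
    have : (ε / (2 * (‖w‖ + 1))) * (‖w‖ + 1) = ε / 2 := by field_simp
    linarith

theorem cfcₙ_mul_star_self_mul {w : B} {g : ℝ → ℝ} (hg : Continuous g) (hg0 : g 0 = 0) :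
    cfcₙ g (w * star w) * w = w * cfcₙ g (star w * w) :=
  cfcₙ_mul_eq_mul_cfcₙ (.star_mul_self w) (.mul_star_self w) (by rw [mul_assoc]) hg hg0

/-- If `g * f = f` pointwise on `[0, ∞)`, then `g(x) f(x) = f(x)`. -/
theorem cfcₙ_mul_cfcₙ_eq {x : B} {f g k : ℝ → ℝ}
    (hg : Continuous g) (hg0 : g 0 = 0) (hf : Continuous f) (hf0 : f 0 = 0)
    (h : ∀ t ∈ quasispectrum ℝ x, g t * f t = k t) : cfcₙ g x * cfcₙ f x = cfcₙ k x := by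
  rw [← cfcₙ_mul g f x hg.continuousOn hg0 hf.continuousOn hf0]
  exact cfcₙ_congr h

/-- A functional with the trace property takes equal values at `f(w*w)` and `f(ww*)`. -/
theorem trace_cfcₙ_star_mul_self {τ : B → ℂ} (hτ : ∀ x y, τ (x * y) = τ (y * x)) (w : B)
    {g : ℝ → ℝ} (hg : Continuous g) (hg0 : g 0 = 0) :
    τ (cfcₙ (fun t => g t * t) (star w * w)) = τ (cfcₙ (fun t => g t * t) (w * star w)) := by
  have e : ∀ x : B, IsSelfAdjoint x → cfcₙ (fun t => g t * t) x = cfcₙ g x * x := by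
    intro x hx
    rw [cfcₙ_mul g (fun t => t) x hg.continuousOn hg0 (by fun_prop) rfl, cfcₙ_id' ℝ x]
  rw [e _ (.star_mul_self w), e _ (.mul_star_self w), ← mul_assoc, hτ, ← mul_assoc,
    ← cfcₙ_mul_star_self_mul hg hg0, mul_assoc]

end NonUnital

/-! ### Asymptotically multiplicative maps and functional calculus. -/

section Asymptotic

variable {B B' : Type*} [NonUnitalCStarAlgebra B] [NonUnitalCStarAlgebra B']

/-- Uniformly bounded self-adjoint linear maps which are asymptotically multiplicative commute
asymptotically with the functional calculus. -/
theorem tendsto_cfcₙ_sub_map_cfcₙ {ι : Type*} {l : Filter ι} {θ : ι → B →ₗ[ℂ] B'} {K : ℝ}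
    (hK : ∀ i x, ‖θ i x‖ ≤ K * ‖x‖) (hstar : ∀ i x, IsSelfAdjoint x → IsSelfAdjoint (θ i x))
    (hmul : ∀ x y, Tendsto (fun i => θ i (x * y) - θ i x * θ i y) l (𝓝 0))
    {x : B} (hx : IsSelfAdjoint x) {g : ℝ → ℝ} (hg : Continuous g) (hg0 : g 0 = 0) :
    Tendsto (fun i => cfcₙ g (θ i x) - θ i (cfcₙ g x)) l (𝓝 0) := by
  have hK' : ∀ i x, ‖θ i x‖ ≤ |K| * ‖x‖ := fun i x => (hK i x).trans (by
    gcongr; exact le_abs_self K)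
  have hM1 : ‖x‖ ≤ (|K| + 1) * ‖x‖ := by nlinarith [abs_nonneg K, norm_nonneg x]
  have hM2 : ∀ i, ‖θ i x‖ ≤ (|K| + 1) * ‖x‖ := fun i => (hK' i x).trans (by
    gcongr; linarith)
  refine continuous_zero_induction
    (P := fun g => Tendsto (fun i => cfcₙ g (θ i x) - θ i (cfcₙ g x)) l (𝓝 0))
    ((|K| + 1) * ‖x‖) ?_ ?_ ?_ hg hg0
  · intro f g hf hf0 hg hg0 h1 h2
    have := h1.add h2
    rw [add_zero] at this
    refine this.congr fun i => ?_
    rw [cfcₙ_add f g _ hf.continuousOn hf0 hg.continuousOn hg0,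
      cfcₙ_add f g x hf.continuousOn hf0 hg.continuousOn hg0, map_add]
    abel
  · intro c k
    induction k with
    | zero =>
      simp only [zero_add, pow_one]
      refine tendsto_const_nhds.congr fun i => ?_
      have : IsSelfAdjoint (θ i x) := hstar i x hx
      rw [cfcₙ_const_mul_id c x, cfcₙ_const_mul_id c (θ i x)]
      rw [← Complex.coe_smul, ← Complex.coe_smul, map_smul, sub_self]
    | succ k ih =>
      beta_reduce at ih ⊢
      have h1 : Tendsto (fun i => (cfcₙ (fun t : ℝ => c * t ^ (k + 1)) (θ i x)
          - θ i (cfcₙ (fun t : ℝ => c * t ^ (k + 1)) x)) * θ i x) l (𝓝 0) := by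
        refine squeeze_zero_norm (a := fun i => ‖cfcₙ (fun t : ℝ => c * t ^ (k + 1)) (θ i x)
          - θ i (cfcₙ (fun t : ℝ => c * t ^ (k + 1)) x)‖ * ((|K| + 1) * ‖x‖)) (fun i => ?_) ?_
        · exact (norm_mul_le _ _).trans (by gcongr; exact hM2 i)
        · simpa using ih.norm.mul_const _
      have h2 := h1.sub (hmul (cfcₙ (fun t : ℝ => c * t ^ (k + 1)) x) x)
      rw [sub_zero] at h2
      refine h2.congr fun i => ?_
      rw [cfcₙ_const_mul_pow_succ hx, cfcₙ_const_mul_pow_succ (hstar i x hx), sub_mul]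
      abel
  · intro g hg hg0 hap
    rw [Metric.tendsto_nhds]
    intro ε hε
    obtain ⟨p, hp, hp0, hP, hpg⟩ := hap (ε / (2 * (|K| + 1))) (by positivity)
    rw [Metric.tendsto_nhds] at hP
    filter_upwards [hP (ε / 2) (by positivity)] with i hi
    rw [dist_zero_right] at hi ⊢
    have e1 := norm_cfcₙ_sub_le hx hM1 hp hp0 hg hg0 hpg
    have e2 := norm_cfcₙ_sub_le (hstar i x hx) (hM2 i) hp hp0 hg hg0 hpg
    have e3 : ‖θ i (cfcₙ p x - cfcₙ g x)‖ ≤ |K| * (ε / (2 * (|K| + 1))) :=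
      (hK' i _).trans (by gcongr)
    have : cfcₙ g (θ i x) - θ i (cfcₙ g x) = (cfcₙ p (θ i x) - θ i (cfcₙ p x))
        - (cfcₙ p (θ i x) - cfcₙ g (θ i x)) + θ i (cfcₙ p x - cfcₙ g x) := by
      rw [map_sub]; abel
    rw [this]
    have h5 : |K| * (ε / (2 * (|K| + 1))) + ε / (2 * (|K| + 1)) = ε / 2 := by
      field_simp
    have := norm_add_le ((cfcₙ p (θ i x) - θ i (cfcₙ p x))
        - (cfcₙ p (θ i x) - cfcₙ g (θ i x))) (θ i (cfcₙ p x - cfcₙ g x))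
    have := norm_sub_le (cfcₙ p (θ i x) - θ i (cfcₙ p x)) (cfcₙ p (θ i x) - cfcₙ g (θ i x))
    linarith

end Asymptotic

/-! ### The cut-down functions -/

theorem continuous_cutFn (ε : ℝ) : Continuous (cutFn ε) := by
  unfold cutFn; fun_prop

theorem cutFn_nonneg (ε t : ℝ) : 0 ≤ cutFn ε t := le_max_left _ _

theorem cutFn_le_one (ε t : ℝ) : cutFn ε t ≤ 1 := max_le zero_le_one (min_le_left _ _)

theorem cutFn_of_le {ε t : ℝ} (hε : 0 < ε) (h : t ≤ ε / 2) : cutFn ε t = 0 := by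
  unfold cutFn
  rw [max_eq_left]
  exact (min_le_right _ _).trans (div_nonpos_of_nonpos_of_nonneg (by linarith) (by linarith))

theorem cutFn_of_ge {ε t : ℝ} (hε : 0 < ε) (h : ε ≤ t) : cutFn ε t = 1 := by
  unfold cutFn
  rw [min_eq_left, max_eq_right zero_le_one]
  rw [le_div_iff₀ (by linarith)]; linarith

theorem cutFn_zero {ε : ℝ} (hε : 0 < ε) : cutFn ε 0 = 0 := cutFn_of_le hε (by linarith)

theorem cutFn_mono_left {δ ε : ℝ} (hδ : 0 < δ) (h : δ ≤ ε) {t : ℝ} : cutFn ε t ≤ cutFn δ t := by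
  rcases le_total t (ε / 2) with ht | ht
  · rw [cutFn_of_le (hδ.trans_le h) ht]; exact cutFn_nonneg _ _
  rcases le_total δ t with ht' | ht'
  · rw [cutFn_of_ge hδ ht']; exact cutFn_le_one _ _
  unfold cutFn
  refine max_le_max le_rfl (min_le_min le_rfl ?_)
  rw [div_le_div_iff₀ (by linarith) (by linarith)]
  nlinarith

theorem cutFn_mul_cutFn {δ ε : ℝ} (hδ : 0 < δ) (h : δ ≤ ε / 2) (t : ℝ) :
    cutFn δ t * cutFn ε t = cutFn ε t := by
  rcases le_total t (ε / 2) with ht | ht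
  · rw [cutFn_of_le (by linarith) ht, mul_zero]
  · rw [cutFn_of_ge hδ (h.trans ht), one_mul]

/-- The quotient is continuous, its denominator being at least `ε / 2`. Thus f_ε(x) is a multiple of
x inside the algebra, which is how trace identities and local units are carried over to cut-downs.
-/
theorem cutFn_eq_mul_self {ε : ℝ} (hε : 0 < ε) (t : ℝ) :
    cutFn ε t = cutFn ε t / max t (ε / 2) * t := by
  rcases le_total t (ε / 2) with ht | ht
  · rw [cutFn_of_le hε ht]; simp
  · rw [max_eq_left ht, div_mul_cancel₀]; linarith

theorem trace_cutFn_star_mul_self {B : Type*} [NonUnitalCStarAlgebra B] {τ : B → ℂ}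
    (hτ : ∀ x y, τ (x * y) = τ (y * x)) (w : B) {ε : ℝ} (hε : 0 < ε) :
    τ (cfcₙ (cutFn ε) (star w * w)) = τ (cfcₙ (cutFn ε) (w * star w)) := by
  have e : cutFn ε = fun t => cutFn ε t / max t (ε / 2) * t := by
    ext t; exact cutFn_eq_mul_self hε t
  rw [e]
  refine trace_cfcₙ_star_mul_self hτ w (g := fun t => cutFn ε t / max t (ε / 2)) ?_ ?_
  · refine (continuous_cutFn ε).div (by fun_prop) fun t => ?_
    have := le_max_right t (ε / 2)
    exact ne_of_gt (by linarith)
  · simp [cutFn_zero hε]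

/-! ### Traces on finite dimensional C*-algebras -/

/-- A positive linear functional with the trace property. -/
def IsPosTrace {F : Type*} [NonUnitalRing F] [StarRing F] [Module ℂ F] (σ : F →ₗ[ℂ] ℂ) : Prop :=
  (∀ x, 0 ≤ σ (star x * x)) ∧ ∀ x y, σ (x * y) = σ (y * x)

theorem IsPosTrace.nonneg {F : Type*} [NonUnitalCStarAlgebra F] [PartialOrder F]
    [StarOrderedRing F] {σ : F →ₗ[ℂ] ℂ} (hσ : IsPosTrace σ) {x : F} (hx : 0 ≤ x) : 0 ≤ σ x := by
  obtain ⟨s, rfl⟩ := CStarAlgebra.nonneg_iff_eq_star_mul_self.mp hx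
  exact hσ.1 s

theorem IsPosTrace.mono {F : Type*} [NonUnitalCStarAlgebra F] [PartialOrder F]
    [StarOrderedRing F] {σ : F →ₗ[ℂ] ℂ} (hσ : IsPosTrace σ) {x y : F} (h : x ≤ y) :
    (σ x).re ≤ (σ y).re := by
  have := hσ.nonneg (sub_nonneg.mpr h)
  rw [map_sub] at this
  have := (Complex.le_def.mp this).1
  simpa using this

section FiniteDim

variable {F : Type*} [CStarAlgebra F]

/-- The trace of the left action on a finite dimensional module. -/
noncomputable def moduleTrace (F M : Type*) [CStarAlgebra F] [AddCommGroup M] [Module F M] [Module ℂ M]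
    [IsScalarTower ℂ F M] : F →ₗ[ℂ] ℂ :=
  (LinearMap.trace ℂ M).comp (Algebra.lsmul ℂ ℂ M : F →ₐ[ℂ] Module.End ℂ M).toLinearMap

theorem moduleTrace_apply {M : Type*} [AddCommGroup M] [Module F M] [Module ℂ M]
    [IsScalarTower ℂ F M] (x : F) :
    moduleTrace F M x = LinearMap.trace ℂ M (Algebra.lsmul ℂ ℂ M x) := rfl

/-- An eigenvalue of the action of x*x lies in the spectrum of x*x, since a unit cannot kill an
eigenvector. So the trace is a sum of nonnegative numbers, and no inner product on the module is
needed. -/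
theorem moduleTrace_isPosTrace {M : Type*} [AddCommGroup M] [Module F M] [Module ℂ M]
    [IsScalarTower ℂ F M] [FiniteDimensional ℂ M] : IsPosTrace (moduleTrace F M) := by
  let _ : PartialOrder F := CStarAlgebra.spectralOrder F
  have : StarOrderedRing F := CStarAlgebra.spectralOrderedRing F
  constructor
  · intro x
    rw [moduleTrace_apply, Module.End.trace_eq_sum_roots_charpoly_of_splits
      (IsAlgClosed.splits _)]
    refine Multiset.sum_nonneg fun μ hμ => ?_
    have h1 := (Module.End.hasEigenvalue_iff_isRoot_charpoly _ μ).mpr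
      (Polynomial.isRoot_of_mem_roots hμ)
    obtain ⟨v, hv⟩ := h1.exists_hasEigenvector
    have hv0 := hv.2
    have hv1 := hv.apply_eq_smul
    refine spectrum_nonneg_of_nonneg (star_mul_self_nonneg x) ?_
    intro hu
    apply hv0
    obtain ⟨u, hu⟩ := hu
    have : (u : F) • v = 0 := by
      rw [hu, sub_smul, algebraMap_smul, sub_eq_zero, ← hv1]; rfl
    have h2 : ((↑u⁻¹ * ↑u : F)) • v = 0 := by rw [mul_smul, this, smul_zero]
    simpa using h2
  · intro x y
    rw [moduleTrace_apply, moduleTrace_apply, map_mul (Algebra.lsmul ℂ ℂ M),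
      map_mul (Algebra.lsmul ℂ ℂ M), LinearMap.trace_mul_comm]

theorem moduleTrace_pos_of_isIdempotentElem {M : Type*} [AddCommGroup M] [Module F M] [Module ℂ M]
    [IsScalarTower ℂ F M] [FiniteDimensional ℂ M] {r : F} (hr : star r * r = r)
    {m : M} (hm : r • m ≠ 0) : 0 < (moduleTrace F M r).re := by
  have h1 := (moduleTrace_isPosTrace (F := F) (M := M)).1 r
  rw [hr] at h1
  have hr' : star r = r := by rw [← hr]; simp
  rw [hr'] at hr
  have h2 : moduleTrace F M r ≠ 0 := by
    intro h
    rw [moduleTrace_apply] at h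
    have hi : IsIdempotentElem (Algebra.lsmul ℂ ℂ M r : Module.End ℂ M) := by
      rw [IsIdempotentElem, ← map_mul, hr]
    have := (LinearMap.IsIdempotentElem.trace_eq_zero_iff hi).mp h
    exact hm (by simpa using LinearMap.congr_fun this m)
  have h3 : 0 < moduleTrace F M r := lt_of_le_of_ne h1 h2.symm
  exact (Complex.lt_def.mp h3).1

variable [FiniteDimensional ℂ F]

theorem finite_spectrum_of_finiteDimensional (x : F) : (spectrum ℂ x).Finite := by
  refine (Module.End.finite_spectrum (Algebra.lmul ℂ F x)).subset fun μ hμ hu => hμ ?_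
  have e : (algebraMap ℂ (Module.End ℂ F) μ - Algebra.lmul ℂ F x)
      = Algebra.lmul ℂ F (algebraMap ℂ F μ - x) := by
    rw [map_sub, AlgHom.commutes]
  replace hu : IsUnit (algebraMap ℂ (Module.End ℂ F) μ - Algebra.lmul ℂ F x) := hu
  rw [e, Module.End.isUnit_iff] at hu
  obtain ⟨y, hy⟩ := hu.2 1
  have hy' : (algebraMap ℂ F μ - x) * y = 1 := hy
  refine ⟨⟨algebraMap ℂ F μ - x, y, hy', ?_⟩, rfl⟩
  apply hu.1
  change (algebraMap ℂ F μ - x) * (y * (algebraMap ℂ F μ - x)) = (algebraMap ℂ F μ - x) * 1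
  rw [← mul_assoc, hy', one_mul, mul_one]

/-- This admits discontinuous functions into the functional calculus, in particular the indicator
functions that give spectral projections. -/
theorem continuousOn_spectrum_of_finiteDimensional (f : ℝ → ℝ) (x : F) :
    ContinuousOn f (spectrum ℝ x) := by
  have : (spectrum ℝ x).Finite := by
    rw [← spectrum.preimage_algebraMap ℂ]
    exact (finite_spectrum_of_finiteDimensional x).preimage
      (FaithfulSMul.algebraMap_injective ℝ ℂ).injOn
  exact this.continuousOn f

theorem isUnit_of_mul_injective {x : F} (h : ∀ y, x * y = 0 → y = 0) : IsUnit x := by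
  have hinj : Function.Injective (Algebra.lmul ℂ F x) := by
    rw [injective_iff_map_eq_zero]; exact h
  obtain ⟨y, hy⟩ := (LinearMap.injective_iff_surjective.mp hinj) 1
  have hy' : x * y = 1 := hy
  refine ⟨⟨x, y, hy', ?_⟩, rfl⟩
  apply hinj
  change x * (y * x) = x * 1
  rw [← mul_assoc, hy', one_mul, mul_one]

/-- The convention `0⁻¹ = 0` makes `(√t)⁻¹` vanish at `0`, so the outcome is the support projection
of x. -/
theorem cfc_inv_sqrt_mul_self_mul [PartialOrder F] [StarOrderedRing F] {x : F} (hx : 0 ≤ x) :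
    cfc (fun t : ℝ => (√t)⁻¹) x * x * cfc (fun t : ℝ => (√t)⁻¹) x
      = cfc (fun t : ℝ => if t = 0 then 0 else 1) x := by
  have hsa : IsSelfAdjoint x := .of_nonneg hx
  have hc := fun f => continuousOn_spectrum_of_finiteDimensional (F := F) f x
  conv_lhs => arg 1; arg 2; rw [← cfc_id' ℝ x]
  rw [← cfc_mul _ _ x (hc _) (hc _), ← cfc_mul _ _ x (hc _) (hc _)]
  refine cfc_congr fun t ht => ?_
  rcases (spectrum_nonneg_of_nonneg hx ht).eq_or_lt with h | h
  · simp [← h]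
  · simp only [if_neg h.ne']
    have : 0 < √t := Real.sqrt_pos.mpr h
    field_simp
    exact (Real.sq_sqrt h.le).symm

/-- Polar decomposition in a finite dimensional C*-algebra. -/
theorem exists_partialIsometry {y : F} (hy : y ≠ 0) :
    ∃ w : F, w ≠ 0 ∧ w * star w * w = w ∧ (∃ u, w = y * u) ∧ ∃ u, star w * w = u * y := by
  set x := star y * y with hx
  have hsa : IsSelfAdjoint x := .star_mul_self y
  have hc := fun f => continuousOn_spectrum_of_finiteDimensional (F := F) f x
  let _ : PartialOrder F := CStarAlgebra.spectralOrder F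
  have : StarOrderedRing F := CStarAlgebra.spectralOrderedRing F
  have hpos : ∀ t ∈ spectrum ℝ x, 0 ≤ t := fun t ht =>
    spectrum_nonneg_of_nonneg (star_mul_self_nonneg y) ht
  set s : ℝ → ℝ := fun t => (√t)⁻¹
  have hs : IsSelfAdjoint (cfc s x) := cfc_predicate _ _
  set χ : ℝ → ℝ := fun t => if t = 0 then 0 else 1
  have e1 : cfc s x * x * cfc s x = cfc χ x :=
    cfc_inv_sqrt_mul_self_mul (star_mul_self_nonneg y)
  have e2 : cfc s x * cfc χ x = cfc s x := by
    rw [← cfc_mul _ _ x (hc _) (hc _)]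
    refine cfc_congr fun t ht => ?_
    by_cases h : t = 0 <;> simp [s, χ, h]
  have e3 : cfc χ x = cfc (fun t : ℝ => t⁻¹) x * x := by
    conv_rhs => arg 2; rw [← cfc_id' ℝ x]
    rw [← cfc_mul _ _ x (hc _) (hc _)]
    refine cfc_congr fun t ht => ?_
    by_cases h : t = 0 <;> simp [χ, h]
  have e4 : x * cfc χ x = x := by
    conv_lhs => arg 1; rw [← cfc_id' ℝ x]
    conv_rhs => rw [← cfc_id' ℝ x]
    rw [← cfc_mul _ _ x (hc _) (hc _)]
    refine cfc_congr fun t ht => ?_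
    by_cases h : t = 0 <;> simp [χ, h]
  have e5 : star (y * cfc s x) * (y * cfc s x) = cfc χ x := by
    rw [star_mul, hs.star_eq, ← e1, hx]; simp only [mul_assoc]
  refine ⟨y * cfc s x, ?_, ?_, ⟨_, rfl⟩, ⟨cfc (fun t : ℝ => t⁻¹) x * star y, ?_⟩⟩
  · intro h
    rw [h, mul_zero] at e5
    rw [← e5, mul_zero] at e4
    exact hy (CStarRing.star_mul_self_eq_zero_iff y |>.mp e4.symm)
  · rw [mul_assoc, e5, mul_assoc, e2]
  · rw [e5, e3, mul_assoc]

/-- Comparison of projections by traces in a finite dimensional C*-algebra. -/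
theorem exists_partialIsometry_of_trace_le {p q : F} (hp : IsStarProjection p)
    (hq : IsStarProjection q) (h : ∀ σ : F →ₗ[ℂ] ℂ, IsPosTrace σ → (σ p).re ≤ (σ q).re) :
    ∃ v : F, star v * v = p ∧ q * v = v := by
  have : ProperSpace F := FiniteDimensional.proper ℂ F
  have hpp : p * p = p := hp.isIdempotentElem
  have hqq : q * q = q := hq.isIdempotentElem
  have hps : star p = p := hp.isSelfAdjoint
  have hqs : star q = q := hq.isSelfAdjoint
  set S : Set F := {v | v * star v * v = v ∧ q * v = v ∧ v * p = v}
  have hSc : IsCompact S := by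
    refine Metric.isCompact_of_isClosed_isBounded ?_ ?_
    · refine (isClosed_eq (by fun_prop) (by fun_prop)).inter
        ((isClosed_eq (by fun_prop) (by fun_prop)).inter (isClosed_eq (by fun_prop) (by fun_prop)))
    · refine (Metric.isBounded_closedBall (x := (0 : F)) (r := 1)).subset fun v hv => ?_
      rw [mem_closedBall_zero_iff]
      have h1 : star (star v * v) * (star v * v) = star v * v := by
        rw [star_mul, star_star, mul_assoc, ← mul_assoc v, hv.1]
      have h2 := CStarRing.norm_star_mul_self (x := star v * v)
      rw [h1, CStarRing.norm_star_mul_self] at h2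
      by_contra hlt
      push Not at hlt
      nlinarith [mul_lt_mul hlt hlt.le one_pos (norm_nonneg v)]
  have hcont : Continuous fun v : F => (moduleTrace F F (star v * v)).re :=
    Complex.continuous_re.comp
      ((LinearMap.continuous_of_finiteDimensional (moduleTrace F F)).comp (by fun_prop))
  -- `v` is a partial isometry from below p into q, of maximal rank as measured by the trace of the
  -- regular representation.
  obtain ⟨v, hv, hmax⟩ := hSc.exists_isMaxOn ⟨0, by simp [S]⟩ hcont.continuousOn
  obtain ⟨hv1, hv2, hv3⟩ := hv
  have hv2' : star v * q = star v := by rw [← hqs, ← star_mul, hv2]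
  have hv3' : p * star v = star v := by rw [← hps, ← star_mul, hv3]
  have hv1' : star v * v * star v = star v := by
    have := congrArg star hv1
    simpa [mul_assoc] using this
  have hvq : star v * (q - v * star v) = 0 := by rw [mul_sub, hv2', ← mul_assoc, hv1', sub_self]
  have hpv : (p - star v * v) * star v = 0 := by rw [sub_mul, hv3', hv1', sub_self]
  -- Otherwise the polar part w of such an element has domain and range orthogonal to those of v,
  -- and v + w contradicts maximality.
  have hzero : ∀ x, (q - v * star v) * x * (p - star v * v) = 0 := by
    intro x
    by_contra hne
    obtain ⟨w, hw0, hw1, ⟨u, hu⟩, ⟨u', hu'⟩⟩ := exists_partialIsometry hne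
    have hqv : q * (v * star v) = v * star v := by rw [← mul_assoc, hv2]
    have hqw : q * w = w := by
      rw [hu]; simp only [← mul_assoc, mul_sub, hqq, hv2]
    have hvw : star v * w = 0 := by
      rw [hu]; simp only [← mul_assoc, hvq, zero_mul]
    have hwp : w * (p - star v * v) = w := by
      have hpi : (p - star v * v) * (p - star v * v) = p - star v * v := by
        rw [mul_sub, ← mul_assoc, hpv, zero_mul, sub_zero, sub_mul, hpp, mul_assoc, hv3]
      calc w * (p - star v * v) = w * (star w * w) * (p - star v * v) := by
            rw [← mul_assoc, hw1]
        _ = w * (star w * w) := by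
            rw [hu']; simp only [mul_assoc, hpi]
        _ = w := by rw [← mul_assoc, hw1]
    have hwv : w * star v = 0 := by
      rw [← hwp, mul_assoc, hpv, mul_zero]
    have hvw' : v * star w = 0 := by
      have := congrArg star hwv; simpa using this
    have hwv' : star w * v = 0 := by
      have := congrArg star hvw; simpa using this
    have hwpp : w * p = w := by
      conv_lhs => rw [← hwp]
      rw [mul_assoc, sub_mul, hpp, mul_assoc, hv3, hwp]
    have hmem : v + w ∈ S := by
      refine ⟨?_, by rw [mul_add, hv2, hqw], by rw [add_mul, hv3, hwpp]⟩
      have : (v + w) * star (v + w) * (v + w) = v * star v * v + v * (star v * w)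
          + (v * star w) * (v + w) + (w * star v) * (v + w) + w * (star w * v)
          + w * star w * w := by
        rw [star_add]; noncomm_ring
      rw [this, hv1, hw1, hvw, hvw', hwv, hwv']
      simp
    have hle : (moduleTrace F F (star (v + w) * (v + w))).re
        ≤ (moduleTrace F F (star v * v)).re := hmax hmem
    have he : star (v + w) * (v + w) = star v * v + star w * w := by
      rw [star_add, add_mul, mul_add, mul_add, hvw, hwv']; simp
    rw [he, map_add, Complex.add_re] at hle
    have hpos := moduleTrace_pos_of_isIdempotentElem (F := F) (M := F) (r := star w * w) (m := 1)
      (by rw [star_mul, star_star, mul_assoc, ← mul_assoc w, hw1])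
      (by simpa using hw0)
    linarith
  refine ⟨v, ?_, hv2⟩
  by_contra hne
  have hne' : p - star v * v ≠ 0 := fun h0 => hne (sub_eq_zero.mp h0).symm
  set p' := p - star v * v with hp'
  -- The left ideal Fp' is the test module. By `hzero`, q − vv* acts on it as zero while p' does
  -- not, so its trace satisfies Tr(q) = Tr(vv*) = Tr(v*v) < Tr(p), against the hypothesis.
  let N : Submodule F F := Submodule.span F {p'}
  have : FiniteDimensional ℂ N :=
    inferInstanceAs (FiniteDimensional ℂ (N.restrictScalars ℂ))
  have hpi : star p' * p' = p' := by
    have : star p' = p' := by rw [hp', star_sub, hps, star_mul, star_star]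
    rw [this, hp', mul_sub, ← mul_assoc, hpv, zero_mul, sub_zero, sub_mul, hpp, mul_assoc, hv3]
  have hps' : star p' = p' := by rw [hp', star_sub, hps, star_mul, star_star]
  have h1 := moduleTrace_pos_of_isIdempotentElem (F := F) (M := N) hpi
    (m := ⟨p', Submodule.mem_span_singleton_self p'⟩) (by
      intro h0
      apply hne'
      have h5 : p' * p' = 0 := congrArg Subtype.val h0
      calc p' = star p' * p' := hpi.symm
        _ = 0 := by rw [hps', h5])
  have h2 : moduleTrace F N (q - v * star v) = 0 := by
    have : (Algebra.lsmul ℂ ℂ N (q - v * star v) : Module.End ℂ N) = 0 := by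
      refine LinearMap.ext fun ⟨y, hy⟩ => ?_
      obtain ⟨z, rfl⟩ := Submodule.mem_span_singleton.mp hy
      have := hzero z
      rw [mul_assoc] at this
      exact Subtype.ext this
    rw [moduleTrace_apply, this, map_zero]
  have h3 := h (moduleTrace F N) moduleTrace_isPosTrace
  have h4 := (moduleTrace_isPosTrace (F := F) (M := N)).2 v (star v)
  rw [map_sub, sub_eq_zero] at h2
  rw [hp', map_sub, Complex.sub_re] at h1
  rw [h2, h4] at h3
  linarith

end FiniteDim

/-! ### Approximate comparison, and homotopy of solutions, over a finite dimensional algebra. -/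

section FiniteDimComparison

variable {F : Type*} [CStarAlgebra F] [PartialOrder F] [StarOrderedRing F]

/-- Trace comparison of positive elements implies approximate Cuntz comparison. -/
theorem exists_norm_conj_sub_le [FiniteDimensional ℂ F] {a b : F} (ha : 0 ≤ a) (hb : 0 ≤ b)
    (hb1 : ‖b‖ ≤ 1) {ε : ℝ} (hε : 0 < ε)
    (h : ∀ σ : F →ₗ[ℂ] ℂ, IsPosTrace σ → (σ (cfcₙ (cutFn ε) a)).re ≤ (σ b).re) :
    ∃ x : F, ‖star x * b * x - a‖ ≤ ε := by
  have hc := fun (f : ℝ → ℝ) (x : F) => continuousOn_spectrum_of_finiteDimensional f x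
  have has : IsSelfAdjoint a := .of_nonneg ha
  have hbs : IsSelfAdjoint b := .of_nonneg hb
  have hproj : ∀ (f : ℝ → ℝ) (x : F), IsSelfAdjoint x → (∀ t, f t * f t = f t) →
      IsStarProjection (cfc f x) := fun f x hx hf =>
    ⟨by rw [IsIdempotentElem, ← cfc_mul _ _ x (hc _ _) (hc _ _)]; simp only [hf],
      cfc_predicate _ _⟩
  set χ : ℝ → ℝ := fun t => if t = 0 then 0 else 1 with hχ
  set κ : ℝ → ℝ := fun t => if ε ≤ t then 1 else 0 with hκ
  have hp := hproj κ a has (fun t => by simp only [hκ]; split_ifs <;> simp)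
  have hq := hproj χ b hbs (fun t => by simp only [hχ]; split_ifs <;> simp)
  -- Here κ(a) ≤ f_ε(a), and b ≤ χ(b) because ‖b‖ ≤ 1; so the hypothesis compares the traces of the
  -- projections κ(a) and χ(b).
  obtain ⟨v, hv1, hv2⟩ := exists_partialIsometry_of_trace_le hp hq (fun σ hσ => by
    refine (hσ.mono ?_).trans ((h σ hσ).trans (hσ.mono ?_))
    · rw [cfcₙ_eq_cfc (continuous_cutFn ε).continuousOn (cutFn_zero hε)]
      refine cfc_mono (fun t _ => ?_) (hc _ _) (hc _ _)
      simp only [hκ]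
      split_ifs with h1
      · rw [cutFn_of_ge hε h1]
      · exact cutFn_nonneg _ _
    · conv_lhs => rw [← cfc_id' ℝ b]
      refine cfc_mono (fun t ht => ?_) (hc _ _) (hc _ _)
      simp only [hχ]
      split_ifs with h1
      · exact h1.le
      · exact (quasispectrum_subset_Icc hbs hb1 (spectrum_subset_quasispectrum ℝ b ht)).2)
  have hβ := cfc_inv_sqrt_mul_self_mul hb
  set β := cfc (fun t : ℝ => (√t)⁻¹) b with hβd
  have hβs : star β = β := (cfc_predicate (p := IsSelfAdjoint) _ b).star_eq
  set s := cfc Real.sqrt a with hs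
  have hss : star s = s := (cfc_predicate (p := IsSelfAdjoint) _ a).star_eq
  -- With x = b^{-1/2} v a^{1/2} one gets x*bx = a^{1/2} κ(a) a^{1/2}, which misses only the part of
  -- a with spectrum below ε.
  refine ⟨β * v * s, ?_⟩
  have e : star (β * v * s) * b * (β * v * s) = s * cfc κ a * s := by
    rw [star_mul, star_mul, hβs, hss]
    calc s * (star v * β) * b * (β * v * s) = s * (star v * ((β * b * β) * v)) * s := by
          simp only [mul_assoc]
      _ = _ := by rw [hβ, hv2, hv1]
  have e2 : s * cfc κ a * s - a = cfc (fun t => √t * κ t * √t - t) a := by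
    rw [cfc_sub _ _ a (hc _ _) (hc _ _), cfc_mul _ _ a (hc _ _) (hc _ _),
      cfc_mul _ _ a (hc _ _) (hc _ _), cfc_id' ℝ a]
  rw [e, e2]
  refine norm_cfc_le hε.le fun t ht => ?_
  have ht0 := spectrum_nonneg_of_nonneg ha ht
  simp only [hκ]
  split_ifs with h1
  · rw [mul_one, Real.mul_self_sqrt ht0, sub_self, norm_zero]; exact hε.le
  · rw [mul_zero, zero_mul, zero_sub, norm_neg, Real.norm_of_nonneg ht0]; linarith

/-- The factor k^{-1/2} normalises ze so that it conjugates b exactly to e; any h under e can then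
be inserted. Adding 1 − e lets inversion in the corner eFe be done in F, and k commutes with e. -/
theorem star_conj_ringInverse_sqrt {b e z h : F} (hb : 0 ≤ b) (he : IsStarProjection e)
    (hk : IsUnit (e * (star z * b * z) * e + (1 - e))) (hh : IsSelfAdjoint h) (heh : e * h = h) :
    star (z * e * (Ring.inverse (CFC.sqrt (e * (star z * b * z) * e + (1 - e)))) * h) * b *
      (z * e * (Ring.inverse (CFC.sqrt (e * (star z * b * z) * e + (1 - e)))) * h) = h * h := by
  have hee : e * e = e := he.isIdempotentElem
  have hes : star e = e := he.isSelfAdjoint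
  have hk0 : 0 ≤ e * (star z * b * z) * e + (1 - e) := by
    refine add_nonneg ?_ he.one_sub.nonneg
    have := star_left_conjugate_nonneg (star_left_conjugate_nonneg hb z) e
    rwa [hes] at this
  set k := e * (star z * b * z) * e + (1 - e) with hkd
  have hs0 : 0 ≤ CFC.sqrt k := CFC.sqrt_nonneg k
  have hsu : IsUnit (CFC.sqrt k) := (CFC.isUnit_sqrt_iff k).mpr hk
  set s := CFC.sqrt k with hs
  have hr1 : (Ring.inverse s) * s = 1 := Ring.inverse_mul_cancel _ hsu
  have hr2 : s * (Ring.inverse s) = 1 := Ring.mul_inverse_cancel _ hsu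
  have hrs : star ((Ring.inverse s)) = (Ring.inverse s) := by
    rw [← Ring.inverse_star, (IsSelfAdjoint.of_nonneg hs0).star_eq]
  set r := (Ring.inverse s) with hr
  have hss : s * s = k := CFC.sqrt_mul_sqrt_self k
  have hek : k * e = e * k := by
    have h1 : k * e = e * (star z * b * z) * (e * e) + (e - e * e) := by rw [hkd]; noncomm_ring
    have h2 : e * k = (e * e) * (star z * b * z) * e + (e - e * e) := by rw [hkd]; noncomm_ring
    rw [h1, h2, hee]
  have hes : s * e = e * s := by
    rw [hs, CFC.sqrt_eq_real_sqrt k]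
    exact cfcₙ_mul_eq_mul_cfcₙ (.of_nonneg hk0) (.of_nonneg hk0) hek Real.continuous_sqrt
      Real.sqrt_zero
  have hre : r * e = e * r := by
    calc r * e = r * e * (s * r) := by rw [hr2, mul_one]
      _ = r * (s * e) * r := by rw [hes]; simp only [mul_assoc]
      _ = e * r := by rw [← mul_assoc, hr1, one_mul]
  have h1 : (1 - e) * (r * h) = 0 := by
    rw [sub_mul, one_mul, ← mul_assoc, ← hre, mul_assoc, heh, sub_self]
  have hm : e * (star z * b * z) * e = k - (1 - e) := by rw [hkd]; abel
  calc _ = h * r * (e * (star z * b * z) * e) * (r * h) := by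
        simp only [star_mul, hh.star_eq, hrs, he.isSelfAdjoint.star_eq, mul_assoc]
    _ = h * (r * s) * (s * r) * h - h * r * ((1 - e) * (r * h)) := by
        rw [hm, ← hss]; noncomm_ring
    _ = h * h := by rw [hr1, hr2, h1]; simp

/-- An approximate solution is automatically nondegenerate on e: compressing the error costs at most
δe, so eme ≥ (η − δ)e. -/
theorem isUnit_compression_add {m a e : F} {η δ : ℝ} (hδη : δ < η)
    (he : IsStarProjection e) (hea : η • e ≤ e * a * e) (ha : IsSelfAdjoint a)
    (hms : IsSelfAdjoint m) (hm : ‖m - a‖ ≤ δ) : IsUnit (e * m * e + (1 - e)) := by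
  have hee : e * e = e := he.isIdempotentElem
  have hes : star e = e := he.isSelfAdjoint
  have h1 : e * (a - m) * e ≤ δ • e := by
    have := CStarAlgebra.star_left_conjugate_le_norm_smul (a := e) (b := a - m) (ha.sub hms)
    rw [hes, hee, norm_sub_rev] at this
    exact this.trans (smul_le_smul_of_nonneg_right hm he.nonneg)
  set c := min (η - δ) 1 with hc
  have hc0 : 0 < c := lt_min (by linarith) one_pos
  refine CStarAlgebra.isUnit_of_le (c • (1 : F)) ?_ (IsStrictlyPositive.smul hc0 (by simp))
  calc c • (1 : F) = c • e + c • (1 - e) := by rw [← smul_add]; simp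
    _ ≤ (η - δ) • e + (1 : ℝ) • (1 - e) := by
        gcongr
        · exact he.nonneg
        · exact min_le_left _ _
        · exact he.one_sub.nonneg
        · exact min_le_right _ _
    _ = η • e - δ • e + (1 - e) := by rw [sub_smul, one_smul]
    _ ≤ e * a * e - e * (a - m) * e + (1 - e) := by gcongr
    _ = e * m * e + (1 - e) := by noncomm_ring

/-- Deforming one approximate solution of `x* b x = a` to a normal form. -/
theorem joinedIn_normalForm {a b e x : F} (ha : 0 ≤ a) (hb : 0 ≤ b) {η δ : ℝ} (hδ : 0 ≤ δ) (he : IsStarProjection e) (hea : ‖a - e * a * e‖ ≤ η)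
    (hcut : ∀ s ∈ Set.Icc (0 : ℝ) 1, ‖((1 - s) • (1 : F) + s • e) * a * ((1 - s) • 1 + s • e) - a‖ ≤ η)
    (hk : IsUnit (e * (star x * b * x) * e + (1 - e))) (hx : ‖star x * b * x - a‖ ≤ δ) :
    JoinedIn {y : F | ‖star y * b * y - a‖ ≤ δ + η} x
      (x * e * (Ring.inverse (CFC.sqrt (e * (star x * b * x) * e + (1 - e)))) * CFC.sqrt (e * a * e)) := by
  have hee : e * e = e := he.isIdempotentElem
  have hes : star e = e := he.isSelfAdjoint
  have hconj : ∀ y : F, 0 ≤ y → 0 ≤ e * y * e := fun y hy => by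
    have := star_left_conjugate_nonneg hy e
    rwa [hes] at this
  set m := star x * b * x with hmd
  have hm0 : 0 ≤ m := star_left_conjugate_nonneg hb x
  have heng : ‖e‖ ≤ 1 := he.norm_le
  -- The first path removes the part of x off e, multiplying by the contractions (1 − s)1 + se.
  have hjoin1 : JoinedIn {y : F | ‖star y * b * y - a‖ ≤ δ + η} x (x * e) := by
    refine JoinedIn.ofLine (f := fun s : ℝ => x * ((1 - s) • (1 : F) + s • e)) ?_ (by simp)
      (by simp) ?_
    · fun_prop
    · rintro _ ⟨s, hs, rfl⟩
      set c := (1 - s) • (1 : F) + s • e with hc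
      have hcs : star c = c := by simp [hc, hes]
      have hcn : ‖c‖ ≤ 1 := by
        calc ‖c‖ ≤ ‖(1 - s) • (1 : F)‖ + ‖s • e‖ := norm_add_le _ _
          _ ≤ (1 - s) * 1 + s * 1 := by
            rw [norm_smul, norm_smul, Real.norm_of_nonneg hs.1,
              Real.norm_of_nonneg (sub_nonneg.mpr hs.2)]
            have := hs.1
            have := sub_nonneg.mpr hs.2
            gcongr
            exact (IsStarProjection.one F).norm_le
          _ = 1 := by ring
      have : star (x * c) * b * (x * c) - a = c * (m - a) * c + (c * a * c - a) := by
        rw [star_mul, hcs, hmd]; noncomm_ring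
      simp only [Set.mem_ofPred_eq]
      rw [this]
      refine (norm_add_le _ _).trans (add_le_add ?_ (hcut s hs))
      calc ‖c * (m - a) * c‖ ≤ ‖c‖ * ‖m - a‖ * ‖c‖ := by
            refine (norm_mul_le _ _).trans ?_
            gcongr; exact norm_mul_le _ _
        _ ≤ 1 * δ * 1 := by gcongr
        _ = δ := by ring
  refine hjoin1.trans ?_
  -- The second path moves the value of y*by along the segment from eme to eae. At s = 0 the
  -- normalised element is xe itself, because k^{-1/2}(eme)^{1/2} acts as e on the corner.
  set g : ℝ → F := fun s => (1 - s) • (e * m * e) + s • (e * a * e) with hg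
  have hg0 : ∀ s ∈ Set.Icc (0 : ℝ) 1, 0 ≤ g s := fun s hs =>
    add_nonneg (smul_nonneg (sub_nonneg.mpr hs.2) (hconj _ hm0)) (smul_nonneg hs.1 (hconj _ ha))
  have heg : ∀ s, e * g s = g s := fun s => by
    simp only [hg, mul_add, mul_smul_comm, ← mul_assoc, hee]
  have heh : ∀ y : F, 0 ≤ y → e * y = y → e * CFC.sqrt y = CFC.sqrt y := by
    intro y hy hey
    have hys : star (CFC.sqrt y) = CFC.sqrt y := (IsSelfAdjoint.of_nonneg (CFC.sqrt_nonneg y)).star_eq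
    have : ((1 - e) * CFC.sqrt y) * star ((1 - e) * CFC.sqrt y) = 0 := by
      rw [star_mul, hys, mul_assoc, ← mul_assoc (CFC.sqrt y), CFC.sqrt_mul_sqrt_self y, ← mul_assoc,
        sub_mul, one_mul, hey, sub_self, zero_mul]
    rw [CStarRing.mul_star_self_eq_zero_iff, sub_mul, one_mul, sub_eq_zero] at this
    exact this.symm
  refine JoinedIn.ofLine
    (f := fun s : ℝ => x * e * (Ring.inverse (CFC.sqrt (e * m * e + (1 - e)))) * CFC.sqrt (g s)) ?_ ?_ ?_ ?_
  · refine continuousOn_const.mul (CFC.continuousOn_sqrt.comp (by fun_prop) fun s hs => hg0 s hs)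
  · have hg00 : g 0 = e * m * e := by simp [hg]
    have hk0 : 0 ≤ e * m * e + (1 - e) := add_nonneg (hconj _ hm0) he.one_sub.nonneg
    have h1 := heh _ (hconj _ hm0) (by simp only [← mul_assoc, hee])
    set h := CFC.sqrt (e * m * e) with hh
    have hhs : star h = h := (IsSelfAdjoint.of_nonneg (CFC.sqrt_nonneg _)).star_eq
    have h1' : h * e = h := by
      have := congrArg star h1
      rwa [star_mul, hes, hhs] at this
    have h2 : CFC.sqrt (e * m * e + (1 - e)) = h + (1 - e) := by
      refine CFC.sqrt_unique ?_ (add_nonneg (CFC.sqrt_nonneg _) he.one_sub.nonneg)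
      have h3 : h * h = e * m * e := CFC.sqrt_mul_sqrt_self _ (hconj _ hm0)
      rw [← h3]
      have : (h + (1 - e)) * (h + (1 - e)) = h * h + (h - h * e) + (h - e * h) + (1 - e - e + e * e) := by
        noncomm_ring
      rw [this, h1, h1', hee]; abel
    have hsu : IsUnit (h + (1 - e)) := by
      rw [← h2]; exact (CFC.isUnit_sqrt_iff _).mpr hk
    have hr1 := Ring.inverse_mul_cancel _ hsu
    have hr2 := Ring.mul_inverse_cancel _ hsu
    simp only [hg00]
    rw [h2, ← hh]
    set r := (Ring.inverse (h + (1 - e)))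
    have h5 : (h + (1 - e)) * e = e * (h + (1 - e)) := by
      rw [add_mul, mul_add, sub_mul, mul_sub, h1, h1', hee]; simp
    have hre : r * e = e * r := by
      calc r * e = r * e * ((h + (1 - e)) * r) := by rw [hr2, mul_one]
        _ = r * ((h + (1 - e)) * e) * r := by rw [h5]; simp only [mul_assoc]
        _ = e * r := by rw [← mul_assoc, hr1, one_mul]
    have h4 : e * r * h = e := by
      calc e * r * h = e * (r * (h + (1 - e))) - (e * r) * (1 - e) := by noncomm_ring
        _ = e - (r * (e * (1 - e))) := by rw [hr1, mul_one, ← hre, mul_assoc]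
        _ = e := by rw [mul_sub, mul_one, hee, sub_self, mul_zero, sub_zero]
    rw [mul_assoc x, mul_assoc x, h4]
  · simp [hg]
  · rintro _ ⟨s, hs, rfl⟩
    simp only [Set.mem_ofPred_eq]
    rw [star_conj_ringInverse_sqrt hb he hk (.of_nonneg (CFC.sqrt_nonneg _))
      (heh _ (hg0 s hs) (heg s)), CFC.sqrt_mul_sqrt_self _ (hg0 s hs)]
    have : g s - a = (1 - s) • (e * (m - a) * e) - (a - e * a * e) := by
      simp only [hg, mul_sub, sub_mul, smul_sub, sub_smul, one_smul]; abel
    rw [this]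
    refine (norm_sub_le _ _).trans (add_le_add ?_ hea)
    rw [norm_smul, Real.norm_of_nonneg (sub_nonneg.mpr hs.2)]
    calc (1 - s) * ‖e * (m - a) * e‖ ≤ 1 * (‖e‖ * ‖m - a‖ * ‖e‖) := by
          gcongr
          · linarith [hs.1]
          · refine (norm_mul_le _ _).trans ?_
            gcongr; exact norm_mul_le _ _
      _ ≤ 1 * (1 * δ * 1) := by gcongr
      _ = δ := by ring

variable [FiniteDimensional ℂ F]

/-- A kernel vector y of the compression of z*bz satisfies b^{1/2}zey = 0 and (1 − e)y = 0, so it is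
also killed by the compression of x*bz. The point is that x*bz is affine in z, which makes
degenerate parameters countable along a line. -/
theorem isUnit_compression_of_isUnit {b e x z : F} (hb : 0 ≤ b) (he : IsStarProjection e)
    (h : IsUnit (e * (star x * b * z) * e + (1 - e))) :
    IsUnit (e * (star z * b * z) * e + (1 - e)) := by
  have hee : e * e = e := he.isIdempotentElem
  have hes : star e = e := he.isSelfAdjoint
  refine isUnit_of_mul_injective fun y hy => ?_
  set s := CFC.sqrt b
  have hss : s * s = b := CFC.sqrt_mul_sqrt_self b
  have hsst : star s = s := (IsSelfAdjoint.of_nonneg (CFC.sqrt_nonneg b)).star_eq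
  have h1 : star (s * z * e * y) * (s * z * e * y) + star ((1 - e) * y) * ((1 - e) * y) = 0 := by
    have : star y * ((e * (star z * b * z) * e + (1 - e)) * y) = 0 := by rw [hy, mul_zero]
    rw [← this, ← hss]
    have h2 : (1 - e) * (1 - e) = 1 - e := he.one_sub.isIdempotentElem
    calc _ = star y * (e * (star z * (s * s) * z) * e) * y
          + star y * ((1 - e) * (1 - e)) * y := by
          simp only [star_mul, star_sub, star_one, hes, hsst, mul_assoc]
      _ = _ := by rw [h2]; noncomm_ring
  have h2 := (add_eq_zero_iff_of_nonneg (star_mul_self_nonneg _) (star_mul_self_nonneg _)).mp h1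
  rw [CStarRing.star_mul_self_eq_zero_iff, CStarRing.star_mul_self_eq_zero_iff] at h2
  have h3 : (e * (star x * b * z) * e + (1 - e)) * y = 0 := by
    calc _ = e * star x * s * (s * z * e * y) + (1 - e) * y := by
          rw [← hss]; noncomm_ring
      _ = 0 := by rw [h2.1, h2.2]; simp
  obtain ⟨u, hu⟩ := h
  rw [← hu] at h3
  simpa using congrArg (fun t => (↑u⁻¹ : F) * t) h3

/-- In a finite dimensional C*-algebra any two approximate solutions of `x* b x = a` can be joined
by a path of approximate solutions. -/
theorem joinedIn_approx_solutions {a b x₀ x₁ : F} (ha : 0 ≤ a) (hb : 0 ≤ b) {η δ : ℝ}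
    (hδ : 0 ≤ δ) (hδη : δ < η) (h₀ : ‖star x₀ * b * x₀ - a‖ ≤ δ)
    (h₁ : ‖star x₁ * b * x₁ - a‖ ≤ δ) :
    JoinedIn {y : F | ‖star y * b * y - a‖ ≤ δ + η} x₀ x₁ := by
  have hη : 0 < η := hδ.trans_lt hδη
  have hc := fun (f : ℝ → ℝ) => continuousOn_spectrum_of_finiteDimensional f a
  have has : IsSelfAdjoint a := .of_nonneg ha
  set κ : ℝ → ℝ := fun t => if η ≤ t then 1 else 0 with hκ
  have hκκ : ∀ t, κ t * κ t = κ t := fun t => by simp only [hκ]; split_ifs <;> simp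
  set e := cfc κ a with hed
  have he : IsStarProjection e :=
    ⟨by rw [IsIdempotentElem, hed, ← cfc_mul _ _ a (hc _) (hc _)]; simp only [hκκ],
      cfc_predicate _ _⟩
  have hee : e * e = e := he.isIdempotentElem
  have hes : star e = e := he.isSelfAdjoint
  have hea : e * a * e = cfc (fun t => κ t * t * κ t) a := by
    rw [cfc_mul _ _ a (hc _) (hc _), cfc_mul _ _ a (hc _) (hc _), cfc_id' ℝ a]
  have hηe : η • e ≤ e * a * e := by
    rw [hea, hed, ← cfc_smul _ _ a (hc _)]
    refine cfc_mono (fun t ht => ?_) (hc _) (hc _)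
    simp only [hκ]
    split_ifs with h <;> simp [h]
  have hnorm : ‖a - e * a * e‖ ≤ η := by
    rw [hea]
    conv_lhs => arg 1; arg 1; rw [← cfc_id' ℝ a]
    rw [← cfc_sub _ _ a (hc _) (hc _)]
    refine norm_cfc_le hη.le fun t ht => ?_
    have ht0 := spectrum_nonneg_of_nonneg ha ht
    simp only [hκ]
    split_ifs with h
    · simpa using hη.le
    · simp only [mul_zero, sub_zero]
      rw [Real.norm_of_nonneg ht0]; linarith
  have hcut : ∀ s ∈ Set.Icc (0 : ℝ) 1,
      ‖((1 - s) • (1 : F) + s • e) * a * ((1 - s) • 1 + s • e) - a‖ ≤ η := by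
    intro s hs
    have e1 : (1 - s) • (1 : F) + s • e = cfc (fun t => (1 - s) + s * κ t) a := by
      rw [cfc_const_add _ _ a (hc _), ← cfc_const_mul _ _ a (hc _), Algebra.algebraMap_eq_smul_one]
    have e2 : ((1 - s) • (1 : F) + s • e) * a * ((1 - s) • 1 + s • e) - a
        = cfc (fun t => ((1 - s) + s * κ t) * t * ((1 - s) + s * κ t) - t) a := by
      rw [cfc_sub _ _ a (hc _) (hc _), cfc_mul _ _ a (hc _) (hc _), cfc_mul _ _ a (hc _) (hc _),
        cfc_id' ℝ a, e1]
    rw [e2]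
    refine norm_cfc_le hη.le fun t ht => ?_
    have ht0 := spectrum_nonneg_of_nonneg ha ht
    simp only [hκ]
    split_ifs with h
    · have : (1 - s + s * 1) * t * (1 - s + s * 1) - t = 0 := by ring
      rw [this, norm_zero]; exact hη.le
    · rw [Real.norm_eq_abs, abs_le]
      have h1 : 0 ≤ (1 - s) ^ 2 := sq_nonneg _
      have h2 : (1 - s) ^ 2 ≤ 1 := by nlinarith [hs.1, hs.2]
      constructor <;> nlinarith
  have hk : ∀ x : F, ‖star x * b * x - a‖ ≤ δ → IsUnit (e * (star x * b * x) * e + (1 - e)) :=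
    fun x hx => isUnit_compression_add hδη he hηe has
      (.of_nonneg (star_left_conjugate_nonneg hb x)) hx
  have hk₀ := hk x₀ h₀
  have hk₁ := hk x₁ h₁
  refine (joinedIn_normalForm ha hb hδ he hnorm hcut hk₀ h₀).trans (JoinedIn.trans ?_
    (joinedIn_normalForm ha hb hδ he hnorm hcut hk₁ h₁).symm)
  -- A complex line is used since removing finitely many points from ℂ, unlike from ℝ, leaves a path
  -- connected set.
  set z : ℂ → F := fun lam => (1 - lam) • x₀ + lam • x₁ with hz
  have hzc : Continuous z := by fun_prop
  set k : ℂ → F := fun lam => e * (star (z lam) * b * z lam) * e + (1 - e) with hkd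
  have hkc : Continuous k := by fun_prop
  -- The compression of x₀*b z(λ), plus 1 − e, factors as k₀(1 + λR) with k₀ invertible; for λ ≠ 0
  -- it is singular only if −λ⁻¹ lies in the finite spectrum of R.
  set R : F := (Ring.inverse (e * (star x₀ * b * x₀) * e + (1 - e))) * (e * (star x₀ * b * (x₁ - x₀)) * e)
  have hbad : ∀ lam : ℂ, lam ∉ (fun μ : ℂ => -μ⁻¹) '' spectrum ℂ R → IsUnit (k lam) := by
    intro lam hlam
    refine isUnit_compression_of_isUnit (x := x₀) hb he ?_
    by_cases h0 : lam = 0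
    · simpa [hz, h0] using hk₀
    have h2 : -lam⁻¹ ∉ spectrum ℂ R := fun h => hlam ⟨_, h, by simp⟩
    rw [spectrum.notMem_iff] at h2
    have h3 : IsUnit ((e * (star x₀ * b * x₀) * e + (1 - e)) *
        ((-lam) • (algebraMap ℂ F (-lam⁻¹) - R))) := by
      rw [Algebra.smul_def]
      exact hk₀.mul (((IsUnit.mk0 (-lam) (neg_ne_zero.mpr h0)).map (algebraMap ℂ F)).mul h2)
    convert h3 using 1
    have h4 : (-lam) • (algebraMap ℂ F (-lam⁻¹) - R) = 1 + lam • R := by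
      rw [smul_sub, Algebra.algebraMap_eq_smul_one, smul_smul, neg_mul_neg, mul_inv_cancel₀ h0,
        one_smul, neg_smul, sub_neg_eq_add]
    have h5 : (e * (star x₀ * b * x₀) * e + (1 - e)) * (1 + lam • R)
        = e * (star x₀ * b * x₀) * e + (1 - e) + lam • (e * (star x₀ * b * (x₁ - x₀)) * e) := by
      rw [mul_add, mul_one, mul_smul_comm, Ring.mul_inverse_cancel_left _ _ hk₀]
    rw [h4, h5]
    simp only [hz]
    simp only [sub_smul, one_smul, mul_add, mul_sub, add_mul, sub_mul, mul_smul_comm,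
      smul_mul_assoc, smul_sub]
    abel
  -- The points 0 and 1 are kept: there k is already invertible by `hk₀` and `hk₁`, even if the
  -- affine criterion fails or `0⁻¹ = 0` puts 0 into the image.
  set bad : Set ℂ := ((fun μ : ℂ => -μ⁻¹) '' spectrum ℂ R) \ {0, 1} with hbadd
  have hpc : IsPathConnected badᶜ :=
    (((finite_spectrum_of_finiteDimensional R).image _).subset
      Set.sdiff_subset).countable.isPathConnected_compl_of_one_lt_rank (by
        rw [Complex.rank_real_complex]; norm_num)
  have hunit : ∀ lam ∈ badᶜ, IsUnit (k lam) := by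
    intro lam hlam
    by_cases h : lam ∈ (fun μ : ℂ => -μ⁻¹) '' spectrum ℂ R
    · have : lam ∈ ({0, 1} : Set ℂ) := by
        by_contra h'; exact hlam ⟨h, h'⟩
      rcases this with h | h
      · simpa [hkd, hz, h] using hk₀
      · rw [Set.mem_singleton_iff] at h
        simpa [hkd, hz, h] using hk₁
    · exact hbad lam h
  have hk0 : ∀ lam, 0 ≤ k lam := fun lam => by
    refine add_nonneg ?_ he.one_sub.nonneg
    have := star_left_conjugate_nonneg (star_left_conjugate_nonneg hb (z lam)) e
    rwa [hes] at this
  set f : ℂ → F := fun lam => z lam * e * (Ring.inverse (CFC.sqrt (k lam))) * CFC.sqrt (e * a * e) with hf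
  have hfc : ContinuousOn f badᶜ := by
    intro lam hlam
    have h1 : ContinuousAt (fun y : F => (Ring.inverse y)) (CFC.sqrt (k lam)) := by
      obtain ⟨u, hu⟩ := (CFC.isUnit_sqrt_iff (k lam) (hk0 lam)).mpr (hunit lam hlam)
      rw [← hu]; exact NormedRing.inverse_continuousAt u
    have h2 : ContinuousWithinAt (fun lam => CFC.sqrt (k lam)) badᶜ lam :=
      (CFC.continuousOn_sqrt.comp (t := {a : F | 0 ≤ a}) hkc.continuousOn
        (fun lam _ => hk0 lam)) lam hlam
    exact ((hzc.continuousWithinAt.mul continuousWithinAt_const).mul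
      (ContinuousAt.comp_continuousWithinAt (g := fun y : F => Ring.inverse y)
        (f := fun lam => CFC.sqrt (k lam)) h1 h2)).mul continuousWithinAt_const
  have hj := (hpc.image' hfc).joinedIn (f 0) ⟨0, by simp [hbadd], rfl⟩ (f 1)
    ⟨1, by simp [hbadd], rfl⟩
  have hf0 : f 0 = x₀ * e * (Ring.inverse (CFC.sqrt (e * (star x₀ * b * x₀) * e + (1 - e))))
      * CFC.sqrt (e * a * e) := by simp [hf, hkd, hz]
  have hf1 : f 1 = x₁ * e * (Ring.inverse (CFC.sqrt (e * (star x₁ * b * x₁) * e + (1 - e))))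
      * CFC.sqrt (e * a * e) := by simp [hf, hkd, hz]
  rw [← hf0, ← hf1]
  refine hj.mono ?_
  rintro _ ⟨lam, hlam, rfl⟩
  have heae0 : 0 ≤ e * a * e := by
    have := star_left_conjugate_nonneg ha e
    rwa [hes] at this
  have heh : e * CFC.sqrt (e * a * e) = CFC.sqrt (e * a * e) := by
    have h1 : CFC.sqrt (e * a * e) = cfc (fun t => κ t * √t) a := by
      refine CFC.sqrt_unique ?_ (cfc_nonneg fun t _ => ?_)
      · rw [hea, ← cfc_mul _ _ a (hc _) (hc _)]
        refine cfc_congr fun t ht => ?_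
        have ht0 := spectrum_nonneg_of_nonneg ha ht
        calc κ t * √t * (κ t * √t) = κ t * (√t * √t) * κ t := by ring
          _ = κ t * t * κ t := by rw [Real.mul_self_sqrt ht0]
      · simp only [hκ]; split_ifs <;> simp
    rw [h1, hed, ← cfc_mul _ _ a (hc _) (hc _)]
    simp only [← mul_assoc, hκκ]
  simp only [Set.mem_ofPred_eq, hf]
  rw [star_conj_ringInverse_sqrt hb he (hunit lam hlam) (.of_nonneg (CFC.sqrt_nonneg _)) heh,
    CFC.sqrt_mul_sqrt_self _ heae0, norm_sub_rev]
  linarith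

end FiniteDimComparison

/-! ### Gluing of paths -/

/-- The path stays at z until just before s', then runs through the whole path from z to y. That
path lies over s' in the open set S', so by the tube lemma it remains admissible over a short
interval before s'. -/
theorem exists_glued_path {X : Type*} [TopologicalSpace X] {S S' : Set (unitInterval × X)} (hS' : IsOpen S')
    (hSS' : S ⊆ S') {s s' : unitInterval} (hss' : s < s') {x : C(unitInterval, X)} {z y : X} (hx : x s = z)
    (hxS : ∀ t ≤ s, (t, x t) ∈ S') (hz : ∀ t ∈ Set.Icc s s', (t, z) ∈ S)
    (hj : JoinedIn {w | (s', w) ∈ S'} z y) :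
    ∃ x' : C(unitInterval, X), x' 0 = x 0 ∧ x' s' = y ∧ ∀ t ≤ s', (t, x' t) ∈ S' := by
  obtain ⟨p, hp⟩ := hj
  have hK : IsCompact (Set.range p) := isCompact_range p.continuous
  have hsub : ({s'} : Set unitInterval) ×ˢ Set.range p ⊆ S' := by
    rintro ⟨t, w⟩ ⟨ht, ⟨u, rfl⟩⟩
    rw [Set.mem_singleton_iff] at ht
    simp only at ht
    subst ht
    exact hp u
  obtain ⟨U, V, hU, -, hsU, hKV, hUV⟩ := generalized_tube_lemma isCompact_singleton hK hS' hsub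
  obtain ⟨κ, hκ, hκU⟩ := Metric.isOpen_iff.mp hU s' (hsU rfl)
  have hss'' : (s : ℝ) < s' := hss'
  set κ' := min (κ / 2) ((s' : ℝ) - s) with hκ'
  have hκ'0 : 0 < κ' := lt_min (by linarith) (by linarith)
  have hκ'1 : κ' ≤ κ / 2 := min_le_left _ _
  have hκ'2 : κ' ≤ (s' : ℝ) - s := min_le_right _ _
  set q : unitInterval → X := fun t => p.extend (((t : ℝ) - (s' - κ')) / κ') with hq
  have hqc : Continuous q := by
    refine p.continuous_extend.comp ?_
    fun_prop
  have hq0 : ∀ t : unitInterval, (t : ℝ) ≤ s' - κ' → q t = z := fun t ht => by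
    rw [hq]; exact p.extend_of_le_zero (div_nonpos_of_nonpos_of_nonneg (by linarith) hκ'0.le)
  refine ⟨⟨fun t => if t ≤ s then x t else q t, ?_⟩, ?_, ?_, ?_⟩
  · refine Continuous.if_le x.continuous hqc continuous_id continuous_const ?_
    rintro t rfl
    rw [hx, hq0 t (by linarith)]
  · simp
  · change (if s' ≤ s then x s' else q s') = y
    rw [if_neg (not_le.mpr hss')]
    simp only [hq]
    rw [p.extend_of_one_le]
    rw [le_div_iff₀ hκ'0]; linarith
  · intro t ht
    change (t, if t ≤ s then x t else q t) ∈ S'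
    split_ifs with h
    · exact hxS t h
    · push Not at h
      rcases le_total (t : ℝ) (s' - κ') with h1 | h1
      · rw [hq0 t h1]; exact hSS' (hz t ⟨h.le, ht⟩)
      · refine hUV ⟨hκU ?_, hKV ?_⟩
        · rw [Metric.mem_ball, Subtype.dist_eq, Real.dist_eq, abs_lt]
          have : (t : ℝ) ≤ s' := ht
          constructor <;> linarith
        · rw [← p.extend_range]; exact Set.mem_range_self _

/-- Openness makes constant choices work locally, compactness leaves finitely many of them, and the
jumps between consecutive choices are bridged by the paths in the fibres. Only the bridges need the
larger set S'. -/
theorem exists_continuous_selection {X : Type*} [TopologicalSpace X] {S S' : Set (unitInterval × X)}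
    (hS : IsOpen S) (hS' : IsOpen S') (hSS' : S ⊆ S') (hne : ∀ t, ∃ z, (t, z) ∈ S)
    (hj : ∀ t y z, (t, y) ∈ S → (t, z) ∈ S → JoinedIn {w | (t, w) ∈ S'} y z)
    {x₀ x₁ : X} (h₀ : (0, x₀) ∈ S) (h₁ : (1, x₁) ∈ S) :
    ∃ x : C(unitInterval, X), x 0 = x₀ ∧ x 1 = x₁ ∧ ∀ t, (t, x t) ∈ S' := by
  choose z hz using hne
  -- Only the cover member with index 0 contains the point 0, so a subinterval starting at 0 is
  -- forced to use the prescribed value `x₀`.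
  set c : unitInterval → Set unitInterval := fun r => if r = 0 then {t | (t, x₀) ∈ S} else {t | t ≠ 0 ∧ (t, z r) ∈ S}
    with hc
  have hco : ∀ w : X, IsOpen {t : unitInterval | (t, w) ∈ S} := fun w =>
    hS.preimage (f := fun t : unitInterval => (t, w)) (by fun_prop)
  obtain ⟨t, ht0, htm, ⟨n, hn⟩, htc⟩ := exists_monotone_Icc_subset_open_cover_unitInterval (c := c)
    (fun r => by
      simp only [hc]
      split_ifs
      · exact hco _
      · exact isOpen_compl_singleton.inter (hco _))
    (fun r _ => by
      refine Set.mem_iUnion.mpr ⟨r, ?_⟩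
      simp only [hc]
      split_ifs with h
      · rw [h]; exact h₀
      · exact ⟨h, hz r⟩)
  -- The monotone sequence t may stay at 0 for a while; there the endpoint value cannot be chosen,
  -- whence the first alternative.
  have key : ∀ n, t n = 0 ∨ ∀ y, (t n, y) ∈ S →
      ∃ x : C(unitInterval, X), x 0 = x₀ ∧ x (t n) = y ∧ ∀ s ≤ t n, (s, x s) ∈ S' := by
    intro n
    induction n with
    | zero => exact .inl ht0
    | succ n ih =>
      rcases (htm n.le_succ).eq_or_lt with h | h
      · rw [← h]; exact ih
      refine .inr fun y hy => ?_
      obtain ⟨r, hr⟩ := htc n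
      have hz' : ∃ w, (∀ s ∈ Set.Icc (t n) (t (n + 1)), (s, w) ∈ S) ∧ (t n = 0 → w = x₀) := by
        by_cases h0 : r = 0
        · refine ⟨x₀, fun s hs => ?_, fun _ => rfl⟩
          have := hr hs
          simpa [hc, h0] using this
        · refine ⟨z r, fun s hs => ?_, fun h1 => ?_⟩
          · have := hr hs
            simp only [hc, if_neg h0] at this
            exact this.2
          · have := hr (Set.left_mem_Icc.mpr h.le)
            simp only [hc, if_neg h0] at this
            exact absurd h1 this.1
      obtain ⟨w, hw, hw0⟩ := hz'
      have hx : ∃ x : C(unitInterval, X), x 0 = x₀ ∧ x (t n) = w ∧ ∀ s ≤ t n, (s, x s) ∈ S' := by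
        rcases ih with h0 | ih
        · refine ⟨ContinuousMap.const unitInterval x₀, rfl, (hw0 h0).symm, fun s hs => ?_⟩
          have : s = 0 := le_antisymm (h0 ▸ hs) (unitInterval.nonneg')
          subst this
          exact hSS' h₀
        · exact ih w (hw _ (Set.left_mem_Icc.mpr h.le))
      obtain ⟨x, hx0, hx1, hx2⟩ := hx
      obtain ⟨x', h1, h2, h3⟩ := exists_glued_path hS' hSS' h hx1 hx2 hw
        (hj _ _ _ (hw _ (Set.right_mem_Icc.mpr h.le)) hy)
      exact ⟨x', h1.trans hx0, h2, h3⟩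
  have h1 := hn n le_rfl
  rcases key n with h | h
  · rw [h] at h1; exact absurd h1 zero_ne_one
  · rw [h1] at h
    obtain ⟨x, hx0, hx1, hx2⟩ := h x₁ h₁
    exact ⟨x, hx0, hx1, fun t => hx2 t unitInterval.le_one'⟩

theorem exists_continuous_approx_solution {F : Type*} [CStarAlgebra F] [PartialOrder F]
    [StarOrderedRing F] [FiniteDimensional ℂ F] {a b : C(unitInterval, F)} (ha : ∀ t, 0 ≤ a t)
    (hb : ∀ t, 0 ≤ b t) {ε : ℝ} (hε : 0 < ε) (h : ∀ t, ∃ x, ‖star x * b t * x - a t‖ < ε)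
    {x₀ x₁ : F} (h₀ : ‖star x₀ * b 0 * x₀ - a 0‖ < ε) (h₁ : ‖star x₁ * b 1 * x₁ - a 1‖ < ε) :
    ∃ x : C(unitInterval, F), x 0 = x₀ ∧ x 1 = x₁ ∧ ∀ t, ‖star (x t) * b t * x t - a t‖ < 3 * ε := by
  have hcont : Continuous fun p : unitInterval × F => ‖star p.2 * b p.1 * p.2 - a p.1‖ := by fun_prop
  refine exists_continuous_selection (S := {p | ‖star p.2 * b p.1 * p.2 - a p.1‖ < ε})
    (S' := {p | ‖star p.2 * b p.1 * p.2 - a p.1‖ < 3 * ε})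
    (isOpen_lt hcont continuous_const) (isOpen_lt hcont continuous_const) ?_ h ?_ h₀ h₁
  · intro p (hp : _ < ε)
    exact hp.trans (by linarith)
  · intro t y z hy hz
    -- The number η only has to exceed ε; the choice 3ε/2 leaves a total of 5ε/2, strictly below 3ε.
    refine (joinedIn_approx_solutions (ha t) (hb t) hε.le (η := 3 / 2 * ε) (by linarith)
      (le_of_lt hy) (le_of_lt hz)).mono fun w hw => ?_
    exact lt_of_le_of_lt (b := ε + 3 / 2 * ε) hw (by linarith)

/-! ### Algebras modelled on one-dimensional non-commutative complexes -/

/-- A presentation of `E` as a hereditary subalgebra of the mapping torus of a pair of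
homomorphisms `F₁ → F₂`. -/
structure TorusModel (E : Type*) [NonUnitalCStarAlgebra E] (F₁ F₂ : Type*) [CStarAlgebra F₁]
    [CStarAlgebra F₂] where
  /-- the boundary map at `0` -/
  φ₀ : F₁ →⋆ₙₐ[ℂ] F₂
  /-- the boundary map at `1` -/
  φ₁ : F₁ →⋆ₙₐ[ℂ] F₂
  /-- evaluation at a point of the interval -/
  π : unitInterval → E →⋆ₙₐ[ℂ] F₂
  /-- evaluation at the end -/
  ρ : E →⋆ₙₐ[ℂ] F₁
  continuous_π : ∀ d, Continuous fun t => π t d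
  π_zero : ∀ d, π 0 d = φ₀ (ρ d)
  π_one : ∀ d, π 1 d = φ₁ (ρ d)
  injective : ∀ d, (∀ t, π t d = 0) → ρ d = 0 → d = 0
  hereditary : ∀ (h k : E) (x : C(unitInterval, F₂)) (g : F₁), x 0 = φ₀ g → x 1 = φ₁ g →
    ∃ d, (∀ t, π t d = π t h * x t * π t k) ∧ ρ d = ρ h * g * ρ k

namespace TorusModel

variable {E : Type*} [NonUnitalCStarAlgebra E] {F₁ F₂ : Type*} [CStarAlgebra F₁] [CStarAlgebra F₂]

/-- The embedding into `C([0,1], F₂) ⊕ F₁`. -/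
noncomputable def toProd (M : TorusModel E F₁ F₂) : E →⋆ₙₐ[ℂ] C(unitInterval, F₂) × F₁ where
  toFun d := (⟨fun t => M.π t d, M.continuous_π d⟩, M.ρ d)
  map_smul' c d := by ext <;> simp
  map_zero' := by ext <;> simp
  map_add' c d := by ext <;> simp
  map_mul' c d := by ext <;> simp
  map_star' d := by ext <;> simp [map_star]

theorem norm_le (M : TorusModel E F₁ F₂) {d : E} {r : ℝ} (hπ : ∀ t, ‖M.π t d‖ ≤ r)
    (hρ : ‖M.ρ d‖ ≤ r) : ‖d‖ ≤ r := by
  have hinj : Function.Injective M.toProd := by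
    rw [injective_iff_map_eq_zero]
    intro d hd
    have h1 := congrArg Prod.fst hd
    refine M.injective d (fun t => ?_) (congrArg Prod.snd hd)
    exact congrArg (fun f : C(unitInterval, F₂) => f t) h1
  rw [← NonUnitalStarAlgHom.norm_map M.toProd hinj d, Prod.norm_def]
  refine max_le ?_ hρ
  exact (ContinuousMap.norm_le _ ((norm_nonneg _).trans hρ)).mpr hπ

end TorusModel

/-- Used to bring a solution x from the ambient mapping torus into the hereditary subalgebra as exe,
at little cost for a and b. -/
theorem exists_approximateUnit_conj {E : Type*} [NonUnitalCStarAlgebra E] (a b : E) {ε : ℝ}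
    (hε : 0 < ε) : ∃ e : E, ‖e‖ ≤ 1 ∧ ‖star e * a * e - a‖ < ε ∧ ‖star e * b * e - b‖ < ε := by
  let _ : PartialOrder E := CStarAlgebra.spectralOrder E
  have : StarOrderedRing E := CStarAlgebra.spectralOrderedRing E
  have hl := CStarAlgebra.increasingApproximateUnit E
  have key : ∀ a : E, ∀ᶠ e in CStarAlgebra.approximateUnit E, ‖star e * a * e - a‖ < ε := by
    intro a
    have h1 := (Metric.tendsto_nhds.mp (hl.tendsto_mul_left a)) (ε / 2) (by positivity)
    have h2 := (Metric.tendsto_nhds.mp (hl.tendsto_mul_right a)) (ε / 2) (by positivity)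
    filter_upwards [h1, h2, hl.eventually_isSelfAdjoint, hl.eventually_norm] with e h1 h2 h3 h4
    rw [dist_eq_norm] at h1 h2
    rw [h3.star_eq]
    have : e * a * e - a = (e * a - a) * e + (a * e - a) := by noncomm_ring
    rw [this]
    have h5 : ‖(e * a - a) * e‖ ≤ ‖e * a - a‖ * 1 := (norm_mul_le _ _).trans (by gcongr)
    have := norm_add_le ((e * a - a) * e) (a * e - a)
    linarith
  have := hl.neBot
  obtain ⟨e, h1, h2, h3⟩ := ((key a).and ((key b).and hl.eventually_norm)).exists
  exact ⟨e, h3, h1, h2⟩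

/-- A solution g is found in F₁ first; its images under both boundary maps are the prescribed end
values of the solution over the interval. Interpolation turns the tolerance 2ε into 6ε. -/
theorem TorusModel.exists_norm_conj_sub_lt {E : Type*} [NonUnitalCStarAlgebra E] {F₁ F₂ : Type}
    [CStarAlgebra F₁] [CStarAlgebra F₂] [FiniteDimensional ℂ F₁] [FiniteDimensional ℂ F₂]
    (M : TorusModel E F₁ F₂) {a b : E} (ha : ∃ s, a = star s * s) (hb : ∃ s, b = star s * s)
    (hb1 : ‖b‖ ≤ 1) {ε : ℝ} (hε : 0 < ε)
    (h₁ : ∀ σ : F₁ →ₗ[ℂ] ℂ, IsPosTrace σ →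
      (σ (M.ρ (cfcₙ (cutFn ε) a))).re ≤ (σ (M.ρ b)).re)
    (h₂ : ∀ t, ∀ σ : F₂ →ₗ[ℂ] ℂ, IsPosTrace σ →
      (σ (M.π t (cfcₙ (cutFn ε) a))).re ≤ (σ (M.π t b)).re) :
    ∃ x : E, ‖star x * b * x - a‖ < 7 * ε := by
  let _ : PartialOrder F₁ := CStarAlgebra.spectralOrder F₁
  have : StarOrderedRing F₁ := CStarAlgebra.spectralOrderedRing F₁
  let _ : PartialOrder F₂ := CStarAlgebra.spectralOrder F₂
  have : StarOrderedRing F₂ := CStarAlgebra.spectralOrderedRing F₂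
  have hpos : ∀ {F : Type} [CStarAlgebra F] [PartialOrder F] [StarOrderedRing F]
      (f : E →⋆ₙₐ[ℂ] F) (x : E), (∃ s, x = star s * s) → 0 ≤ f x := by
    rintro F _ _ _ f _ ⟨s, rfl⟩
    rw [map_mul, map_star]; exact star_mul_self_nonneg _
  have has : IsSelfAdjoint a := by obtain ⟨s, rfl⟩ := ha; exact .star_mul_self s
  have hcfc : ∀ {F : Type} [CStarAlgebra F] (f : E →⋆ₙₐ[ℂ] F),
      f (cfcₙ (cutFn ε) a) = cfcₙ (cutFn ε) (f a) := fun f =>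
    NonUnitalStarAlgHomClass.map_cfcₙ f (cutFn ε) a (continuous_cutFn ε).continuousOn
      (cutFn_zero hε) (map_continuous f) has (has.map f)
  obtain ⟨g, hg⟩ := exists_norm_conj_sub_le (F := F₁) (a := M.ρ a) (b := M.ρ b)
    (hpos M.ρ a ha) (hpos M.ρ b hb) ((NonUnitalStarAlgHom.norm_apply_le M.ρ b).trans hb1) hε
    (fun σ hσ => by rw [← hcfc]; exact h₁ σ hσ)
  have hx : ∀ t, ∃ x, ‖star x * M.π t b * x - M.π t a‖ ≤ ε := fun t =>
    exists_norm_conj_sub_le (F := F₂) (hpos (M.π t) a ha) (hpos (M.π t) b hb)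
      ((NonUnitalStarAlgHom.norm_apply_le (M.π t) b).trans hb1) hε
      (fun σ hσ => by rw [← hcfc]; exact h₂ t σ hσ)
  have hend : ∀ φ : F₁ →⋆ₙₐ[ℂ] F₂, ‖star (φ g) * φ (M.ρ b) * φ g - φ (M.ρ a)‖ < 2 * ε := by
    intro φ
    rw [← map_star, ← map_mul, ← map_mul, ← map_sub]
    exact (NonUnitalStarAlgHom.norm_apply_le φ _).trans_lt (by linarith)
  obtain ⟨x, hx0, hx1, hxt⟩ := exists_continuous_approx_solution (F := F₂)
    (a := ⟨fun t => M.π t a, M.continuous_π a⟩) (b := ⟨fun t => M.π t b, M.continuous_π b⟩)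
    (fun t => hpos (M.π t) a ha) (fun t => hpos (M.π t) b hb) (ε := 2 * ε) (by linarith)
    (fun t => (hx t).imp fun x hx => lt_of_le_of_lt hx (by linarith))
    (x₀ := M.φ₀ g) (x₁ := M.φ₁ g)
    (by simpa [M.π_zero] using hend M.φ₀) (by simpa [M.π_one] using hend M.φ₁)
  simp only [ContinuousMap.coe_mk] at hxt
  -- Conjugation by x or g multiplies the approximate unit error by less than K, so that error stays
  -- below ε/4. The total is ε/4 + 6ε + ε/4 = 13ε/2.
  set K := (max ‖x‖ ‖g‖) ^ 2 + 1 with hK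
  have hK1 : 0 < K := by positivity
  obtain ⟨e, he1, hea, heb⟩ := exists_approximateUnit_conj a b (ε := ε / (4 * K)) (by positivity)
  obtain ⟨d, hd1, hd2⟩ := M.hereditary e e x g hx0 hx1
  have hKε : ε / (4 * K) ≤ ε / 4 := by
    apply div_le_div_of_nonneg_left hε.le (by norm_num)
    nlinarith [sq_nonneg (max ‖x‖ ‖g‖)]
  have hKε2 : (max ‖x‖ ‖g‖) ^ 2 * (ε / (4 * K)) ≤ ε / 4 := by
    rw [mul_div_assoc', div_le_div_iff₀ (by positivity) (by norm_num)]
    nlinarith [sq_nonneg (max ‖x‖ ‖g‖)]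
  have key : ∀ {F : Type} [CStarAlgebra F] (f : E →⋆ₙₐ[ℂ] F) (y : F), ‖y‖ ≤ max ‖x‖ ‖g‖ →
      ‖star y * f b * y - f a‖ ≤ 6 * ε → f d = f e * y * f e →
      ‖f (star d * b * d - a)‖ ≤ 13 / 2 * ε := by
    intro F _ f y hy hyb hfd
    have e1 : f (star d * b * d - a) = star (f e) * (star y * f (star e * b * e - b) * y) * f e
        + star (f e) * (star y * f b * y - f a) * f e + f (star e * a * e - a) := by
      simp only [map_sub, map_mul, map_star, hfd, star_mul]
      noncomm_ring
    have hfe : ‖f e‖ ≤ 1 := (NonUnitalStarAlgHom.norm_apply_le f e).trans he1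
    have hconj : ∀ w : F, ‖star (f e) * w * f e‖ ≤ ‖w‖ := fun w => by
      calc ‖star (f e) * w * f e‖ ≤ ‖star (f e)‖ * ‖w‖ * ‖f e‖ := by
            refine (norm_mul_le _ _).trans ?_
            gcongr; exact norm_mul_le _ _
        _ ≤ 1 * ‖w‖ * 1 := by rw [norm_star]; gcongr
        _ = ‖w‖ := by ring
    have h1 : ‖star y * f (star e * b * e - b) * y‖ ≤ ε / 4 := by
      calc ‖star y * f (star e * b * e - b) * y‖
          ≤ ‖star y‖ * ‖f (star e * b * e - b)‖ * ‖y‖ := by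
            refine (norm_mul_le _ _).trans ?_
            gcongr; exact norm_mul_le _ _
        _ ≤ max ‖x‖ ‖g‖ * (ε / (4 * K)) * max ‖x‖ ‖g‖ := by
            rw [norm_star]
            gcongr
            exact (NonUnitalStarAlgHom.norm_apply_le f _).trans heb.le
        _ = (max ‖x‖ ‖g‖) ^ 2 * (ε / (4 * K)) := by ring
        _ ≤ ε / 4 := hKε2
    have h2 : ‖f (star e * a * e - a)‖ ≤ ε / 4 :=
      (NonUnitalStarAlgHom.norm_apply_le f _).trans (hea.le.trans hKε)
    rw [e1]
    refine (norm_add₃_le).trans ?_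
    have := hconj (star y * f (star e * b * e - b) * y)
    have := hconj (star y * f b * y - f a)
    linarith
  refine ⟨d, lt_of_le_of_lt (M.norm_le (r := 13 / 2 * ε) (fun t => ?_) ?_) (by linarith)⟩
  · exact key (M.π t) (x t) ((x.norm_coe_le_norm t).trans (le_max_left _ _))
      ((hxt t).le.trans (by linarith)) (hd1 t)
  · exact key M.ρ g (le_max_right _ _) (hg.trans (by linarith)) hd2

/-! ### Hereditary subalgebras and the class `𝒞₀'` -/

/-- For positive c this is h*ch ≤ ‖c‖h*h; every c is a combination of four positive elements. -/
theorem IsHereditary.conj_mem {B : Type*} [NonUnitalCStarAlgebra B]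
    {H : NonUnitalStarSubalgebra ℂ B} (hH : IsHereditary H) {h : B} (hh : h ∈ H) (c : B) :
    star h * c * h ∈ H := by
  let _ : PartialOrder B := CStarAlgebra.spectralOrder B
  have : StarOrderedRing B := CStarAlgebra.spectralOrderedRing B
  have hpos : ∀ c : B, 0 ≤ c → star h * c * h ∈ H := by
    intro c hc
    obtain ⟨z, hz⟩ := CStarAlgebra.nonneg_iff_eq_star_mul_self.mp hc
    have h1 := sub_nonneg.mpr
      (CStarAlgebra.star_left_conjugate_le_norm_smul (a := h) (b := c) (.of_nonneg hc))
    refine hH _ _ ⟨z * h, by rw [hz, star_mul]; simp only [mul_assoc]⟩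
      (CStarAlgebra.nonneg_iff_eq_star_mul_self.mp h1) ?_
    rw [← Complex.coe_smul]
    exact SMulMemClass.smul_mem _ (mul_mem (star_mem hh) hh)
  obtain ⟨y, hy, -, hc⟩ := CStarAlgebra.exists_sum_four_nonneg c
  rw [hc, Finset.mul_sum, Finset.sum_mul]
  refine sum_mem fun i _ => ?_
  rw [mul_smul_comm, smul_mul_assoc]
  exact SMulMemClass.smul_mem _ (hpos _ (hy i))

/-- Polarisation of `IsHereditary.conj_mem`, giving heredity in the two-sided form used by
`TorusModel`. -/
theorem IsHereditary.mul_mul_mem {B : Type*} [NonUnitalCStarAlgebra B]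
    {H : NonUnitalStarSubalgebra ℂ B} (hH : IsHereditary H) {h k : B} (hh : h ∈ H) (hk : k ∈ H)
    (c : B) : h * c * k ∈ H := by
  have key : ∀ h ∈ H, star h * c * k ∈ H := by
    intro h hh
    have e : star h * c * k = (2⁻¹ : ℂ) • ((star (h + k) * c * (h + k) - star h * c * h
        - star k * c * k) + (-Complex.I) • (star (h + Complex.I • k) * c * (h + Complex.I • k)
        - star h * c * h - star k * c * k)) := by
      simp only [star_add, star_smul, RCLike.star_def, Complex.conj_I, add_mul, mul_add,
        smul_mul_assoc, mul_smul_comm, smul_add, smul_sub, smul_smul]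
      simp only [neg_mul, mul_neg, Complex.I_mul_I, neg_neg]
      module
    rw [e]
    have h1 := fun x hx => hH.conj_mem (h := x) hx c
    exact SMulMemClass.smul_mem _
      (add_mem (sub_mem (sub_mem (h1 _ (add_mem hh hk)) (h1 _ hh)) (h1 _ hk))
        (SMulMemClass.smul_mem _ (sub_mem (sub_mem
          (h1 _ (add_mem hh (SMulMemClass.smul_mem _ hk))) (h1 _ hh)) (h1 _ hk))))
  simpa using key (star h) (star_mem hh)

/-- Evaluation at a point as a *-homomorphism. -/
noncomputable def evalStarHom {F₁ F₂ : Type*} [CStarAlgebra F₁] [CStarAlgebra F₂] (t : unitInterval) :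
    C(unitInterval, F₂) × F₁ →⋆ₙₐ[ℂ] F₂ where
  toFun x := x.1 t
  map_smul' _ _ := rfl
  map_zero' := rfl
  map_add' _ _ := rfl
  map_mul' _ _ := rfl
  map_star' _ := rfl

/-- A hereditary subalgebra of a mapping torus has a torus model. -/
noncomputable def TorusModel.ofHereditary {F₁ F₂ D : Type*} [CStarAlgebra F₁] [CStarAlgebra F₂]
    [NonUnitalCStarAlgebra D] {φ₀ φ₁ : F₁ →⋆ₙₐ[ℂ] F₂}
    (j : D →⋆ₙₐ[ℂ] mappingTorus φ₀ φ₁) (hj : Function.Injective j)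
    (hher : ∀ (h k : D) (c : mappingTorus φ₀ φ₁), ∃ d, j d = j h * c * j k) :
    TorusModel D F₁ F₂ where
  φ₀ := φ₀
  φ₁ := φ₁
  π t := (evalStarHom t).comp ((NonUnitalStarSubalgebraClass.subtype (mappingTorus φ₀ φ₁)).comp j)
  ρ := (NonUnitalStarAlgHom.snd ℂ _ _).comp
    ((NonUnitalStarSubalgebraClass.subtype (mappingTorus φ₀ φ₁)).comp j)
  continuous_π d := (j d).1.1.continuous
  π_zero d := (j d).2.1
  π_one d := (j d).2.2
  injective d h1 h2 := by
    refine hj ?_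
    rw [map_zero]
    exact Subtype.ext (Prod.ext (ContinuousMap.ext h1) h2)
  hereditary h k x g h0 h1 := by
    obtain ⟨d, hd⟩ := hher h k ⟨(x, g), h0, h1⟩
    have hd' := congrArg Subtype.val hd
    exact ⟨d, fun t => congrArg (fun y => y.1 t) hd', congrArg (fun y => y.2) hd'⟩

theorem exists_injective_of_equiv_hereditary {B D : Type*} [NonUnitalCStarAlgebra B]
    [NonUnitalCStarAlgebra D] {H : NonUnitalStarSubalgebra ℂ B} (hH : IsHereditary H)
    (e : D ≃⋆ₐ[ℂ] H) : ∃ j : D →⋆ₙₐ[ℂ] B, Function.Injective j ∧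
      ∀ (h k : D) (c : B), ∃ d, j d = j h * c * j k := by
  refine ⟨(NonUnitalStarSubalgebraClass.subtype H).comp (e : D →⋆ₙₐ[ℂ] H),
    fun x y hxy => e.injective (Subtype.ext hxy), fun h k c =>
    ⟨e.symm ⟨_, hH.mul_mul_mem (e h).2 (e k).2 c⟩, ?_⟩⟩
  change ((e (e.symm _) : H) : B) = (e h : B) * c * (e k : B)
  rw [e.apply_symm_apply]

theorem InC0Prime.exists_torusModel {D : Type*} [NonUnitalCStarAlgebra D] (hD : InC0Prime D) :
    ∃ (F₁ F₂ : Type) (_ : CStarAlgebra F₁) (_ : CStarAlgebra F₂) (_ : FiniteDimensional ℂ F₁)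
      (_ : FiniteDimensional ℂ F₂), Nonempty (TorusModel D F₁ F₂) := by
  obtain ⟨F₁, F₂, _, _, _, _, φ₀, φ₁, -, H, -, hH, -, ⟨e⟩⟩ := hD
  obtain ⟨j, hj, hher⟩ := exists_injective_of_equiv_hereditary hH e
  exact ⟨F₁, F₂, inferInstance, inferInstance, inferInstance, inferInstance,
    ⟨.ofHereditary j hj hher⟩⟩

/-- The matrix algebra over an algebra with a torus model. -/
noncomputable def TorusModel.matrix {E : Type*} [NonUnitalCStarAlgebra E] [PartialOrder E]
    [StarOrderedRing E] {F₁ F₂ : Type*} [CStarAlgebra F₁] [PartialOrder F₁] [StarOrderedRing F₁]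
    [CStarAlgebra F₂] [PartialOrder F₂] [StarOrderedRing F₂] (M : TorusModel E F₁ F₂) (n : ℕ) :
    TorusModel (CStarMatrix (Fin n) (Fin n) E) (CStarMatrix (Fin n) (Fin n) F₁)
      (CStarMatrix (Fin n) (Fin n) F₂) where
  φ₀ := CStarMatrix.mapₙₐ M.φ₀
  φ₁ := CStarMatrix.mapₙₐ M.φ₁
  π t := CStarMatrix.mapₙₐ (M.π t)
  ρ := CStarMatrix.mapₙₐ M.ρ
  continuous_π d := continuous_pi fun i => continuous_pi fun j => M.continuous_π (d i j)
  π_zero d := by ext i j; exact M.π_zero _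
  π_one d := by ext i j; exact M.π_one _
  injective d h1 h2 := by
    ext i j
    exact M.injective _ (fun t => congrFun (congrFun (h1 t) i) j) (congrFun (congrFun h2 i) j)
  hereditary h k x g h0 h1 := by
    have hc : ∀ p q, Continuous fun t => x t p q := fun p q =>
      (continuous_apply q).comp ((continuous_apply p).comp x.continuous)
    -- Each entry of the triple product is a sum of terms h_ip x_pq k_qj, to which heredity of the
    -- scalar model applies separately.
    have key := fun i p q j => M.hereditary (h i p) (k q j) ⟨fun t => x t p q, hc p q⟩ (g p q)
      (congrFun (congrFun h0 p) q) (congrFun (congrFun h1 p) q)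
    choose d hd1 hd2 using key
    refine ⟨CStarMatrix.ofMatrix fun i j => ∑ q, ∑ p, d i p q j, fun t => ?_, ?_⟩
    · ext i j
      simp only [CStarMatrix.mul_apply, Finset.sum_mul]
      change M.π t (∑ q, ∑ p, d i p q j) = _
      simp only [map_sum, hd1]
      rfl
    · ext i j
      simp only [CStarMatrix.mul_apply, Finset.sum_mul]
      change M.ρ (∑ q, ∑ p, d i p q j) = _
      simp only [map_sum, hd2]
      rfl

/-! ### Matrix units -/

section MatrixUnits

variable {n : ℕ} {B : Type*} [NonUnitalCStarAlgebra B]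

/-- The matrix with `x` in position `(i, j)` and zeros elsewhere. -/
def matUnit (i j : Fin n) (x : B) : CStarMatrix (Fin n) (Fin n) B :=
  CStarMatrix.ofMatrix (Matrix.single i j x)

theorem matUnit_mul (i j k l : Fin n) (x y : B) :
    matUnit i j x * matUnit k l y = if j = k then matUnit i l (x * y) else 0 := by
  split_ifs with h
  · subst h
    exact Matrix.single_mul_single_same _ _ _ _ _
  · exact Matrix.single_mul_single_of_ne _ _ _ _ h _

theorem star_matUnit (i j : Fin n) (x : B) : star (matUnit i j x) = matUnit j i (star x) :=
  Matrix.conjTranspose_single i j x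

theorem eq_sum_matUnit (X : CStarMatrix (Fin n) (Fin n) B) :
    X = ∑ i, ∑ j, matUnit i j (X i j) := Matrix.matrix_eq_sum_single X

/-- `matUnit i j` as a linear map. -/
def matUnitₗ (i j : Fin n) : B →ₗ[ℂ] CStarMatrix (Fin n) (Fin n) B where
  toFun := matUnit i j
  map_add' x y := Matrix.single_add i j x y
  map_smul' c x := (Matrix.smul_single c i j x).symm

theorem isPosTrace_matUnit {σ : CStarMatrix (Fin n) (Fin n) B →ₗ[ℂ] ℂ} (hσ : IsPosTrace σ)
    (i : Fin n) : IsPosTrace (σ.comp (matUnitₗ i i)) := by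
  constructor
  · intro x
    have := hσ.1 (matUnit i i x)
    rwa [star_matUnit, matUnit_mul, if_pos rfl] at this
  · intro x y
    have := hσ.2 (matUnit i i x) (matUnit i i y)
    rwa [matUnit_mul, matUnit_mul, if_pos rfl, if_pos rfl] at this

end MatrixUnits

/-- As F is unital, the matrix units themselves are available: they make the diagonal corners
equivalent and, by the trace property, kill the off-diagonal entries. -/
theorem posTrace_eq_sum {n : ℕ} {F : Type*} [CStarAlgebra F]
    {σ : CStarMatrix (Fin n) (Fin n) F →ₗ[ℂ] ℂ} (hσ : IsPosTrace σ) (i₀ : Fin n)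
    (X : CStarMatrix (Fin n) (Fin n) F) :
    σ X = ∑ i, σ.comp (matUnitₗ i₀ i₀) (X i i) := by
  have key : ∀ i j (y : F), σ (matUnit i j y) = if i = j then σ (matUnit i₀ i₀ y) else 0 := by
    intro i j y
    have h1 : matUnit i j y = matUnit i i₀ 1 * matUnit i₀ j y := by
      rw [matUnit_mul, if_pos rfl, one_mul]
    rw [h1, hσ.2, matUnit_mul, mul_one]
    by_cases h : i = j
    · rw [if_pos h.symm, if_pos h]
    · rw [if_neg (Ne.symm h), if_neg h, map_zero]
  calc σ X = ∑ i, ∑ j, σ (matUnit i j (X i j)) := by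
        conv_lhs => rw [eq_sum_matUnit X]
        rw [map_sum]
        exact Finset.sum_congr rfl fun i _ => map_sum _ _ _
    _ = ∑ i, σ (matUnit i₀ i₀ (X i i)) := by
        refine Finset.sum_congr rfl fun i _ => ?_
        rw [Finset.sum_eq_single i (fun j _ h => by rw [key, if_neg h.symm]) (by simp), key,
          if_pos rfl]

/-! ### Traces -/

theorem exists_tracialState_smul {B : Type*} [NonUnitalCStarAlgebra B] (t₀ : B →L[ℂ] ℂ)
    (hpos : ∀ x, 0 ≤ t₀ (star x * x)) (htr : ∀ x y, t₀ (x * y) = t₀ (y * x)) (h0 : t₀ ≠ 0) :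
    ∃ t ∈ tracialStates B, ∀ x, t₀ x = ‖t₀‖ * t x := by
  have hn : 0 < ‖t₀‖ := norm_pos_iff.mpr h0
  refine ⟨StrongDual.toWeakDual (((‖t₀‖⁻¹ : ℝ) : ℂ) • t₀), ⟨fun x => ?_, fun x y => ?_, ?_⟩,
    fun x => ?_⟩
  · change 0 ≤ ((‖t₀‖⁻¹ : ℝ) : ℂ) * t₀ (star x * x)
    refine mul_nonneg ?_ (hpos x)
    exact_mod_cast (inv_nonneg.mpr hn.le)
  · change ((‖t₀‖⁻¹ : ℝ) : ℂ) * t₀ (x * y) = ((‖t₀‖⁻¹ : ℝ) : ℂ) * t₀ (y * x)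
    rw [htr]
  · change ‖((‖t₀‖⁻¹ : ℝ) : ℂ) • t₀‖ = 1
    rw [norm_smul, Complex.norm_real, norm_inv, norm_norm, inv_mul_cancel₀ hn.ne']
  · change t₀ x = ‖t₀‖ * (((‖t₀‖⁻¹ : ℝ) : ℂ) * t₀ x)
    rw [← mul_assoc, ← Complex.ofReal_mul, mul_inv_cancel₀ hn.ne']; simp

/-- A trace on M_n(F) is the amplification of a trace on F. Pulled back to D, the latter is zero or
a positive multiple of a tracial state, so T(D) controls every fibre trace. -/
theorem re_posTrace_map_le {n : ℕ} {D F : Type*} [NonUnitalCStarAlgebra D]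
    [CStarAlgebra F] [FiniteDimensional ℂ F] {X Y : CStarMatrix (Fin n) (Fin n) D}
    (h : ∀ t ∈ tracialStates D, (matTrace t n X).re ≤ (matTrace t n Y).re) (f : D →⋆ₙₐ[ℂ] F)
    {σ : CStarMatrix (Fin n) (Fin n) F →ₗ[ℂ] ℂ} (hσ : IsPosTrace σ) :
    (σ (CStarMatrix.mapₙₐ f X)).re ≤ (σ (CStarMatrix.mapₙₐ f Y)).re := by
  rcases Nat.eq_zero_or_pos n with rfl | hn
  · rw [show X = Y by ext i; exact i.elim0]
  set i₀ : Fin n := ⟨0, hn⟩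
  set σ₁ := σ.comp (matUnitₗ i₀ i₀)
  have hσ₁ : IsPosTrace σ₁ := isPosTrace_matUnit hσ i₀
  have hf : Continuous f := map_continuous f
  let t₀ : D →L[ℂ] ℂ := ⟨σ₁.comp (f : D →ₗ[ℂ] F),
    (LinearMap.continuous_of_finiteDimensional σ₁).comp hf⟩
  have ht₀ : ∀ d, t₀ d = σ₁ (f d) := fun _ => rfl
  have e : ∀ X, σ (CStarMatrix.mapₙₐ f X) = ∑ i, t₀ (X i i) := fun X => posTrace_eq_sum hσ i₀ _
  rw [e, e]
  by_cases h0 : t₀ = 0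
  · simp [h0]
  obtain ⟨t, ht, htt⟩ := exists_tracialState_smul t₀
    (fun x => by rw [ht₀, map_mul f, map_star f]; exact hσ₁.1 _)
    (fun x y => by rw [ht₀, ht₀, map_mul f, map_mul f, hσ₁.2]) h0
  simp only [htt, ← Finset.mul_sum]
  rw [Complex.re_ofReal_mul, Complex.re_ofReal_mul]
  exact mul_le_mul_of_nonneg_left (h t ht) (norm_nonneg _)

instance {n : ℕ} {F : Type*} [CStarAlgebra F] [FiniteDimensional ℂ F] :
    FiniteDimensional ℂ (CStarMatrix (Fin n) (Fin n) F) :=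
  inferInstanceAs (Module.Finite ℂ (Matrix (Fin n) (Fin n) F))

/-- The cut-down `f_ε(a)` of an element of a C*-algebra. -/
noncomputable def cutElt {B : Type*} [NonUnitalCStarAlgebra B] (ε : ℝ) (a : B) : B :=
  cfcₙ (cutFn ε) a

theorem InC0Prime.exists_norm_conj_sub_lt {D : Type*} [NonUnitalCStarAlgebra D]
    [PartialOrder D] [StarOrderedRing D] (hD : InC0Prime D) {n : ℕ} {a b : CStarMatrix (Fin n) (Fin n) D} (ha : ∃ s, a = star s * s)
    (hb : ∃ s, b = star s * s) (hb1 : ‖b‖ ≤ 1) {ε : ℝ} (hε : 0 < ε)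
    (h : ∀ t ∈ tracialStates D,
      (matTrace t n (cutElt ε a)).re ≤ (matTrace t n b).re) :
    ∃ x, ‖star x * b * x - a‖ < 7 * ε := by
  obtain ⟨F₁, F₂, _, _, _, _, ⟨M⟩⟩ := hD.exists_torusModel
  let _ : PartialOrder F₁ := CStarAlgebra.spectralOrder F₁
  have : StarOrderedRing F₁ := CStarAlgebra.spectralOrderedRing F₁
  let _ : PartialOrder F₂ := CStarAlgebra.spectralOrder F₂
  have : StarOrderedRing F₂ := CStarAlgebra.spectralOrderedRing F₂
  exact (M.matrix n).exists_norm_conj_sub_lt ha hb hb1 hε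
    (fun σ hσ => re_posTrace_map_le h M.ρ hσ) (fun t σ hσ => re_posTrace_map_le h (M.π t) hσ)

/-- Some fibre map f has f(d) ≠ 0. The regular trace does not vanish at f(d)*f(d), because it
dominates up to a constant the trace of the polar part of f(d), which is positive. -/
theorem InC0Prime.tracialStates_nonempty {D : Type*} [NonUnitalCStarAlgebra D]
    (hD : InC0Prime D) {d : D} (hd : d ≠ 0) : (tracialStates D).Nonempty := by
  obtain ⟨F₁, F₂, _, _, _, _, ⟨M⟩⟩ := hD.exists_torusModel
  have key : ∀ {F : Type} [CStarAlgebra F] [FiniteDimensional ℂ F] (f : D →⋆ₙₐ[ℂ] F), f d ≠ 0 →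
      (tracialStates D).Nonempty := by
    intro F _ _ f hfd
    let _ : PartialOrder F := CStarAlgebra.spectralOrder F
    have : StarOrderedRing F := CStarAlgebra.spectralOrderedRing F
    have hσ : IsPosTrace (moduleTrace F F) := moduleTrace_isPosTrace
    have hf : Continuous f := map_continuous f
    let t₀ : D →L[ℂ] ℂ := ⟨(moduleTrace F F).comp (f : D →ₗ[ℂ] F),
      (LinearMap.continuous_of_finiteDimensional (moduleTrace F F)).comp hf⟩
    have ht₀ : ∀ d, t₀ d = moduleTrace F F (f d) := fun _ => rfl
    obtain ⟨w, hw0, hw1, ⟨u, hu⟩, -⟩ := exists_partialIsometry hfd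
    have hpos := moduleTrace_pos_of_isIdempotentElem (F := F) (M := F) (r := star w * w) (m := 1)
      (by rw [star_mul, star_star, mul_assoc, ← mul_assoc w, hw1])
      (by
        rw [smul_eq_mul, mul_one]
        exact fun h => hw0 ((CStarRing.star_mul_self_eq_zero_iff w).mp h))
    have h0 : t₀ ≠ 0 := by
      intro h0
      have h1 : moduleTrace F F (star (f d) * f d) = 0 := by
        rw [← map_star f, ← map_mul f, ← ht₀, h0]; rfl
      have h2 : moduleTrace F F (star w * w)
          = moduleTrace F F (star (star (f d)) * (u * star u) * star (f d)) := by
        rw [hu, star_mul, hσ.2, star_star]; simp only [mul_assoc]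
      have h3 := hσ.mono (CStarAlgebra.star_left_conjugate_le_norm_smul (a := star (f d))
        (b := u * star u) (.mul_star_self u))
      rw [← h2, ← Complex.coe_smul, map_smul, star_star,
        hσ.2 (f d) (star (f d)), h1] at h3
      simp at h3
      linarith
    obtain ⟨t, ht, -⟩ := exists_tracialState_smul t₀
      (fun x => by rw [ht₀, map_mul f, map_star f]; exact hσ.1 _)
      (fun x y => by rw [ht₀, ht₀, map_mul f, map_mul f, hσ.2]) h0
    exact ⟨t, ht⟩
  by_cases h : ∃ t, M.π t d ≠ 0
  · obtain ⟨t, ht⟩ := h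
    exact key (M.π t) ht
  · push Not at h
    exact key M.ρ fun h1 => hd (M.injective d h h1)

/-! ### Tracial states -/

section TracialStates

variable {B : Type*} [NonUnitalCStarAlgebra B]

theorem norm_apply_le_of_mem_tracialStates {τ : WeakDual ℂ B} (hτ : τ ∈ tracialStates B) (x : B) :
    ‖τ x‖ ≤ ‖x‖ := by
  have := (WeakDual.toStrongDual τ).le_opNorm x
  rwa [hτ.2.2, one_mul] at this

/-- The linear map underlying an element of the weak dual. -/
noncomputable def WeakDual.toLin (τ : WeakDual ℂ B) : B →ₗ[ℂ] ℂ := (WeakDual.toStrongDual τ).toLinearMap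

/-- These conditions are pointwise and closed, so they survive weak*-limits; norm one need not, only
the bound by one. -/
theorem isPosTrace_of_mem_closure_tracialStates {τ : WeakDual ℂ B}
    (hτ : τ ∈ closure (tracialStates B)) :
    IsPosTrace τ.toLin ∧ ∀ x, ‖τ x‖ ≤ ‖x‖ := by
  have hc : ∀ x, Continuous fun τ : WeakDual ℂ B => τ x := WeakDual.eval_continuous
  let S : Set (WeakDual ℂ B) := {τ | ((∀ x, 0 ≤ τ (star x * x)) ∧
      ∀ x y, τ (x * y) = τ (y * x)) ∧ ∀ x, ‖τ x‖ ≤ ‖x‖}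
  have hTS : tracialStates B ⊆ S := fun τ hτ =>
    ⟨⟨hτ.1, hτ.2.1⟩, norm_apply_le_of_mem_tracialStates hτ⟩
  have h : IsClosed S := by
    simp only [S, Set.ofPred_and, Set.ofPred_forall]
    refine ((isClosed_iInter fun x => ?_).inter (isClosed_iInter fun x => isClosed_iInter fun y =>
      isClosed_eq (hc _) (hc _))).inter (isClosed_iInter fun x =>
        isClosed_le (hc _).norm continuous_const)
    exact isClosed_Ici.preimage (hc (star x * x))
  exact closure_minimal hTS h hτ

end TracialStates

/-! ### Orthogonal copies in simple non-unital algebras with a tracial state. -/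

section Elementary

variable {A : Type*} [NonUnitalCStarAlgebra A]

theorem norm_le_one_of_mul_self_le [PartialOrder A] [StarOrderedRing A] {s : A}
    (hs : IsSelfAdjoint s) (h : s * s ≤ s) : ‖s‖ ≤ 1 := by
  have h1 : 0 ≤ s * s := by
    have := star_mul_self_nonneg s
    rwa [hs.star_eq] at this
  have h2 := CStarAlgebra.norm_le_norm_of_nonneg_of_le h1 h
  have h3 : ‖s * s‖ = ‖s‖ * ‖s‖ := by
    have := CStarRing.norm_star_mul_self (x := s)
    rwa [hs.star_eq] at this
  by_contra! h4
  nlinarith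

theorem isSelfAdjoint_cfcₙ (f : ℝ → ℝ) (x : A) : IsSelfAdjoint (cfcₙ f x) := cfcₙ_predicate f x

theorem cfcₙ_mul_eq_zero {x y : A} (hx : IsSelfAdjoint x) (h : x * y = 0) {g : ℝ → ℝ}
    (hg : Continuous g) (hg0 : g 0 = 0) : cfcₙ g x * y = 0 := by
  have := cfcₙ_mul_eq_mul_cfcₙ (x := (0 : A)) (y := x) (w := y) (.zero A) hx (by simp [h]) hg hg0
  rwa [cfcₙ_apply_zero, mul_zero] at this

/-- Simplicity as an induction principle: a condition defining a closed ideal holds everywhere once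
it holds at one nonzero element. -/
theorem IsSimpleCStar.mem_of_mem (hA : IsSimpleCStar A) {S : Set A} (hc : IsClosed S)
    (h0 : 0 ∈ S) (hadd : ∀ {x y}, x ∈ S → y ∈ S → x + y ∈ S) (hneg : ∀ {x}, x ∈ S → -x ∈ S)
    (hl : ∀ {x y}, y ∈ S → x * y ∈ S) (hr : ∀ {x y}, x ∈ S → x * y ∈ S) {x : A} (hx : x ∈ S)
    (hx0 : x ≠ 0) (y : A) : y ∈ S := by
  set I := TwoSidedIdeal.mk' S h0 hadd hneg hl hr with hI
  have hIS : ((I : TwoSidedIdeal A) : Set A) = S := TwoSidedIdeal.coe_mk' _ _ _ _ _ _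
  rcases hA.2 I (by rwa [hIS]) with h | h
  · have hx' : x ∈ I := by rwa [← SetLike.mem_coe, hIS]
    rw [h] at hx'
    exact absurd hx' (by simpa [TwoSidedIdeal.mem_bot] using hx0)
  · rw [← hIS, h]; trivial

theorem eq_zero_of_mul_star_mul_self {u : A} (h : u * star u * u = 0) : u = 0 := by
  rw [← CStarRing.star_mul_self_eq_zero_iff, ← CStarRing.star_mul_self_eq_zero_iff]
  rw [star_mul, star_star, mul_assoc, ← mul_assoc u, h, mul_zero]

/-- The x with uAx = 0 form a closed ideal. If it is everything it contains u*, and then uu*·u·u*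
and its relatives vanish: taking m = 1 is replaced by testing with elements of A, which forces u =
0. -/
theorem IsSimpleCStar.prime (hA : IsSimpleCStar A) {u x : A} (h : ∀ m, u * m * x = 0) :
    u = 0 ∨ x = 0 := by
  by_contra! hc
  refine hc.1 (eq_zero_of_mul_star_mul_self ?_)
  refine hA.mem_of_mem (S := {x | ∀ m, u * m * x = 0}) ?_ (by simp) ?_ ?_ ?_ ?_ h hc.2 u (star u)
  · rw [Set.ofPred_forall]
    exact isClosed_iInter fun m => isClosed_eq (by fun_prop) continuous_const
  · intro x y hx hy m
    rw [mul_add, hx, hy, add_zero]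
  · intro x hx m
    rw [mul_neg, hx, neg_zero]
  · intro x y hy m
    rw [← mul_assoc, mul_assoc u, hy]
  · intro x y hx m
    rw [← mul_assoc, hx, zero_mul]

/-- A positive element whose corner has no zero divisors is a multiple of a projection. -/
theorem exists_isStarProjection_smul [PartialOrder A] [StarOrderedRing A] {k : A} (hk : 0 ≤ k)
    (h : ∀ x y, (k * x * k) * (k * y * k) = 0 → k * x * k = 0 ∨ k * y * k = 0) :
    ∃ (r : ℝ) (q : A), 0 ≤ r ∧ IsStarProjection q ∧ k = r • q := by
  have hsa : IsSelfAdjoint k := .of_nonneg hk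
  have hpos : ∀ s ∈ quasispectrum ℝ k, 0 ≤ s := fun s hs => quasispectrum_nonneg_of_nonneg k hk s hs
  have e : ∀ f : ℝ → ℝ, Continuous f → f 0 = 0 →
      k * cfcₙ f k * k = cfcₙ (fun u => u * f u * u) k := by
    intro f hf hf0
    rw [cfcₙ_mul (fun u => u * f u) (fun u => u) k (by fun_prop) (by simp) (by fun_prop) rfl,
      cfcₙ_mul (fun u => u) f k (by fun_prop) rfl (by fun_prop) hf0, cfcₙ_id' ℝ k]
  have key : ∀ s ∈ quasispectrum ℝ k, ∀ t ∈ quasispectrum ℝ k, 0 < s → 0 < t → s = t := by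
    intro s hs t ht hs0 ht0
    by_contra hst
    -- Bumps of radius ρ around two distinct positive spectral values have disjoint supports away
    -- from 0 and would give zero divisors. So the spectrum is contained in {0, s}.
    set ρ := min (|s - t| / 2) (min s t) with hρ
    have hρ0 : 0 < ρ := lt_min (half_pos (abs_pos.mpr (sub_ne_zero.mpr hst))) (lt_min hs0 ht0)
    have hρ1 : ρ ≤ |s - t| / 2 := min_le_left _ _
    have hρ2 : ρ ≤ s := (min_le_right _ _).trans (min_le_left _ _)
    have hρ3 : ρ ≤ t := (min_le_right _ _).trans (min_le_right _ _)
    have hb : ∀ v, ρ ≤ v → Continuous (fun u => max 0 (ρ - |u - v|)) ∧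
        max 0 (ρ - |(0 : ℝ) - v|) = 0 := by
      intro v hv
      refine ⟨by fun_prop, max_eq_left ?_⟩
      rw [zero_sub, abs_neg]
      linarith [le_abs_self v]
    have hne : ∀ v ∈ quasispectrum ℝ k, ρ ≤ v →
        k * cfcₙ (fun u => max 0 (ρ - |u - v|)) k * k ≠ 0 := by
      intro v hv hρv h0
      rw [e _ (hb v hρv).1 (hb v hρv).2, ← cfcₙ_const_zero ℝ k] at h0
      have := eqOn_of_cfcₙ_eq_cfcₙ h0 hsa
        (by have := (hb v hρv).1; fun_prop) (by simp) (by fun_prop) rfl hv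
      simp only [sub_self, abs_zero, sub_zero, max_eq_right hρ0.le] at this
      have : 0 < v * ρ * v := by have := hρ0.trans_le hρv; positivity
      linarith
    rcases h (cfcₙ (fun u => max 0 (ρ - |u - s|)) k) (cfcₙ (fun u => max 0 (ρ - |u - t|)) k) (by
      have c1 := (hb s hρ2).1
      have c2 := (hb t hρ3).1
      rw [e _ c1 (hb s hρ2).2, e _ c2 (hb t hρ3).2,
        ← cfcₙ_mul _ _ k (by fun_prop) (by simp) (by fun_prop) (by simp), ← cfcₙ_const_zero ℝ k]
      refine cfcₙ_congr fun u _ => ?_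
      change u * max 0 (ρ - |u - s|) * u * (u * max 0 (ρ - |u - t|) * u) = 0
      rcases le_total ρ |u - s| with h1 | h1
      · rw [max_eq_left (by linarith)]; ring
      · have h2 := abs_sub_le s u t
        rw [abs_sub_comm s u] at h2
        rw [max_eq_left (b := ρ - |u - t|) (by linarith)]; ring) with h1 | h1
    · exact hne s hs hρ2 h1
    · exact hne t ht hρ3 h1
  by_cases hex : ∃ s ∈ quasispectrum ℝ k, 0 < s
  · obtain ⟨s, hs, hs0⟩ := hex
    refine ⟨s, s⁻¹ • k, hs0.le, ⟨?_, ?_⟩, by rw [smul_smul, mul_inv_cancel₀ hs0.ne', one_smul]⟩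
    · change s⁻¹ • k * s⁻¹ • k = s⁻¹ • k
      have e1 : s⁻¹ • k = cfcₙ (fun u : ℝ => s⁻¹ * u) k := by
        rw [cfcₙ_const_mul_id s⁻¹ k]
      rw [e1, ← cfcₙ_mul _ _ k (by fun_prop) (by simp) (by fun_prop) (by simp)]
      refine cfcₙ_congr fun u hu => ?_
      change s⁻¹ * u * (s⁻¹ * u) = s⁻¹ * u
      rcases (hpos u hu).eq_or_lt with h0 | h0
      · simp [← h0]
      · rw [key u hu s hs h0 hs0, inv_mul_cancel₀ hs0.ne', one_mul]
    · exact IsSelfAdjoint.smul (IsSelfAdjoint.all _) hsa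
  · push Not at hex
    refine ⟨0, 0, le_rfl, .zero A, ?_⟩
    rw [zero_smul]
    conv_lhs => rw [← cfcₙ_id' ℝ k]
    rw [← cfcₙ_const_zero ℝ k]
    exact cfcₙ_congr fun u hu => le_antisymm (hex u hu) (hpos u hu)

/-- The compression is a multiple of a projection q ≤ p; since q and p − q are orthogonal elements
of pAp, one of them is zero. This says that p is minimal. -/
theorem exists_smul_of_no_zero_divisors [PartialOrder A] [StarOrderedRing A] {p : A}
    (hp : IsStarProjection p)
    (h : ∀ x y, (p * x * p) * (p * y * p) = 0 → p * x * p = 0 ∨ p * y * p = 0) (m : A) :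
    ∃ r : ℝ, 0 ≤ r ∧ p * (star m * m) * p = r • p := by
  have hpp : p * p = p := hp.isIdempotentElem
  set k := p * (star m * m) * p with hk
  have hk0 : 0 ≤ k := by
    have := star_mul_self_nonneg (m * p)
    rwa [star_mul, hp.isSelfAdjoint.star_eq, mul_assoc, ← mul_assoc (star m), ← mul_assoc] at this
  have hkx : ∀ x, k * x * k = p * ((star m * m) * p * x * p * (star m * m)) * p := by
    intro x; simp only [hk, mul_assoc]
  obtain ⟨r, q, hr, hq, hkq⟩ := exists_isStarProjection_smul hk0 (fun x y hxy => by
    rw [hkx, hkx] at *; exact h _ _ hxy)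
  rcases hr.eq_or_lt with h0 | h0
  · exact ⟨0, le_rfl, by rw [hkq, ← h0, zero_smul, zero_smul]⟩
  have hq' : q = p * (r⁻¹ • (star m * m)) * p := by
    rw [mul_smul_comm, smul_mul_assoc, ← hk, hkq, smul_smul, inv_mul_cancel₀ h0.ne', one_smul]
  have hqp : q * p = q := by rw [hq', mul_assoc, hpp]
  have hpq : p * q = q := by rw [hq', ← mul_assoc, ← mul_assoc, hpp]
  have hp1 : p * (p - q) * p = p - q := by
    rw [mul_sub, sub_mul, hpp, hpp, hpq, hqp]
  have := h (r⁻¹ • (star m * m)) (p - q) (by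
    rw [← hq', hp1, mul_sub, hqp, hq.isIdempotentElem, sub_self])
  rw [← hq', hp1] at this
  rcases this with h1 | h1
  · exact ⟨0, le_rfl, by rw [hkq, h1, smul_zero, zero_smul]⟩
  · exact ⟨r, hr, by rw [hkq, ← sub_eq_zero.mp h1]⟩

/-- The sum e of the range projections found so far is not a unit, so some u = y − ey is nonzero.
Primeness gives ump ≠ 0, and minimality of p makes this a multiple of a partial isometry with range
orthogonal to e. -/
theorem exists_orthogonal_copies (hA : IsSimpleCStar A) (hn : IsNonUnital A) {p : A}
    (hp : IsStarProjection p) (hp0 : p ≠ 0)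
    (h : ∀ m, ∃ r : ℝ, 0 ≤ r ∧ p * (star m * m) * p = r • p) (N : ℕ) :
    ∃ v : Fin N → A, (∀ j, v j * p = v j) ∧
      ∀ j k, star (v j) * v k = if j = k then p else 0 := by
  have hpp : p * p = p := hp.isIdempotentElem
  have hps : star p = p := hp.isSelfAdjoint
  induction N with
  | zero => exact ⟨Fin.elim0, fun j => j.elim0, fun j => j.elim0⟩
  | succ N ih =>
    obtain ⟨v, hv, hvv⟩ := ih
    set e := ∑ i, v i * star (v i) with he
    have hes : star e = e := by simp [he, star_sum]
    have hve : ∀ i, star (v i) * e = star (v i) := by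
      intro i
      simp only [he, Finset.mul_sum, ← mul_assoc, hvv, ite_mul, zero_mul, Finset.sum_ite_eq,
        Finset.mem_univ, if_true]
      rw [← hps, ← star_mul, hv]
    obtain ⟨y, hy⟩ : ∃ y, e * y ≠ y := by
      by_contra! hc
      refine hn ⟨e, fun x => ⟨hc x, ?_⟩⟩
      have := congrArg star (hc (star x))
      rwa [star_mul, star_star, hes] at this
    set u := y - e * y with hu
    have hu0 : u ≠ 0 := sub_ne_zero.mpr hy.symm
    have hvu : ∀ i, star (v i) * u = 0 := by
      intro i
      rw [hu, mul_sub, ← mul_assoc, hve, sub_self]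
    obtain ⟨m, hm⟩ : ∃ m, u * m * p ≠ 0 := by
      by_contra! hc
      rcases hA.prime hc with h1 | h1
      exacts [hu0 h1, hp0 h1]
    obtain ⟨r, hr, hrp⟩ := h (u * m)
    have hw : star (u * m * p) * (u * m * p) = r • p := by
      rw [← hrp, star_mul, hps]; simp only [mul_assoc]
    have hr0 : r ≠ 0 := by
      rintro rfl
      rw [zero_smul, CStarRing.star_mul_self_eq_zero_iff] at hw
      exact hm hw
    have hr1 : (√r)⁻¹ * ((√r)⁻¹ * r) = 1 := by
      have h2 : √r ≠ 0 := Real.sqrt_ne_zero'.mpr (lt_of_le_of_ne hr hr0.symm)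
      have h3 := Real.mul_self_sqrt hr
      field_simp
      nlinarith
    have hvw : ∀ i, star (v i) * ((√r)⁻¹ • (u * m * p)) = 0 := by
      intro i
      rw [mul_smul_comm, ← mul_assoc, ← mul_assoc, hvu, zero_mul, zero_mul, smul_zero]
    refine ⟨Fin.cons ((√r)⁻¹ • (u * m * p)) v, fun j => ?_, fun j k => ?_⟩
    · refine Fin.cases ?_ (fun j => ?_) j
      · rw [Fin.cons_zero, smul_mul_assoc, mul_assoc, hpp]
      · rw [Fin.cons_succ, hv]
    · refine Fin.cases ?_ (fun j => ?_) j <;> refine Fin.cases ?_ (fun k => ?_) k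
      · rw [Fin.cons_zero, if_pos rfl, star_smul, smul_mul_smul_comm, hw, smul_smul, star_trivial,
          mul_assoc, hr1, one_smul]
      · rw [Fin.cons_zero, Fin.cons_succ, if_neg (Fin.succ_ne_zero k).symm]
        have := congrArg star (hvw k)
        rwa [star_mul, star_star, star_zero] at this
      · rw [Fin.cons_zero, Fin.cons_succ, if_neg (Fin.succ_ne_zero j), hvw]
      · simp only [Fin.cons_succ, hvv, Fin.succ_inj]

/-- A would behave like the compact operators on an infinite dimensional space. By simplicity τ(p) >
0, while N orthogonal copies of p add up to a projection, so Nτ(p) ≤ 1 for every N. -/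
theorem not_isNonUnital_of_elementary (hA : IsSimpleCStar A) {τ : WeakDual ℂ A}
    (hτ : τ ∈ tracialStates A) {p : A} (hp : IsStarProjection p) (hp0 : p ≠ 0)
    (h : ∀ m, ∃ r : ℝ, 0 ≤ r ∧ p * (star m * m) * p = r • p) : ¬ IsNonUnital A := by
  intro hn
  let _ : PartialOrder A := CStarAlgebra.spectralOrder A
  have : StarOrderedRing A := CStarAlgebra.spectralOrderedRing A
  have hpp : p * p = p := hp.isIdempotentElem
  have hps : star p = p := hp.isSelfAdjoint
  have hτp : 0 ≤ τ p := by
    have := hτ.1 p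
    rwa [hps, hpp] at this
  have hτp' : τ p ≠ 0 := by
    intro h0
    have h1 : ∀ m, τ (p * m) = 0 := by
      intro m
      obtain ⟨y, hy, -, hc⟩ := CStarAlgebra.exists_sum_four_nonneg m
      rw [hc, Finset.mul_sum, map_sum]
      refine Finset.sum_eq_zero fun i _ => ?_
      rw [mul_smul_comm, map_smul]
      obtain ⟨z, hz⟩ := CStarAlgebra.nonneg_iff_eq_star_mul_self.mp (hy i)
      obtain ⟨r, -, hr⟩ := h z
      rw [hz, ← hpp, mul_assoc, hτ.2.1, hr, ← Complex.coe_smul, map_smul, h0, smul_zero, smul_zero]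
    have h2 : ∀ x y, τ (x * y) = 0 := by
      intro x
      refine hA.mem_of_mem (S := {x | ∀ m, τ (x * m) = 0}) ?_ (by simp) ?_ ?_ ?_ ?_ h1 hp0 x
      · rw [Set.ofPred_forall]
        have hc : Continuous fun x => τ x := map_continuous (WeakDual.toStrongDual τ)
        exact isClosed_iInter fun m => isClosed_eq (by fun_prop) continuous_const
      · intro x y hx hy m
        rw [add_mul, map_add, hx, hy, add_zero]
      · intro x hx m
        rw [neg_mul, map_neg, hx, neg_zero]
      · intro x y hy m
        rw [mul_assoc, hτ.2.1, mul_assoc, hy]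
      · intro x y hx m
        rw [mul_assoc, hx]
    have h3 : WeakDual.toStrongDual τ = 0 := by
      ext m
      obtain ⟨y, hy, -, hc⟩ := CStarAlgebra.exists_sum_four_nonneg m
      rw [hc, map_sum]
      refine Finset.sum_eq_zero fun i _ => ?_
      obtain ⟨z, hz⟩ := CStarAlgebra.nonneg_iff_eq_star_mul_self.mp (hy i)
      rw [map_smul, hz]
      exact (congrArg _ (h2 _ _)).trans (smul_zero _)
    have := hτ.2.2
    rw [h3, norm_zero] at this
    exact zero_ne_one this
  have hre : 0 < (τ p).re := by
    have h1 := Complex.le_def.mp hτp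
    refine lt_of_le_of_ne h1.1 fun h2 => hτp' (Complex.ext h2.symm h1.2.symm)
  obtain ⟨N, hN⟩ := exists_nat_gt (1 / (τ p).re)
  rw [div_lt_iff₀ hre] at hN
  obtain ⟨v, hv, hvv⟩ := exists_orthogonal_copies hA hn hp hp0 h N
  set e := ∑ i, v i * star (v i) with he
  have hes : IsSelfAdjoint e := by
    rw [IsSelfAdjoint]; simp [he, star_sum]
  have hee : e * e = e := by
    conv_lhs => rw [he]
    rw [Finset.sum_mul]
    refine Finset.sum_congr rfl fun i _ => ?_
    rw [mul_assoc]
    congr 1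
    simp only [Finset.mul_sum, ← mul_assoc, hvv, ite_mul, zero_mul, Finset.sum_ite_eq,
      Finset.mem_univ, if_true]
    rw [← hps, ← star_mul, hv]
  have h1 : τ e = N * τ p := by
    rw [he, map_sum]
    simp only [hτ.2.1 (v _), hvv, if_true, Finset.sum_const, Finset.card_univ, Fintype.card_fin,
      nsmul_eq_mul]
  have h2 := (norm_apply_le_of_mem_tracialStates hτ e).trans
    (norm_le_one_of_mul_self_le hes hee.le)
  have h3 := (Complex.re_le_norm _).trans h2
  rw [h1] at h3
  simp at h3
  linarith

/-- Let s = d^{1/2}. If sAs contains z ≠ 0 with z² = 0, then z*z and z(z*z)^{1/2} have orthogonal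
ranges and the same square (z*z)², and both have the form sy. Without such z, d would be a multiple
of a minimal projection, which is excluded. -/
theorem exists_two_orthogonal_copies [PartialOrder A] [StarOrderedRing A] (hA : IsSimpleCStar A)
    (hn : IsNonUnital A) (hT : (tracialStates A).Nonempty) {d : A} (hd : 0 ≤ d) (hd0 : d ≠ 0) :
    ∃ y₁ y₂ c : A, 0 ≤ c ∧ c ≠ 0 ∧ star y₁ * d * y₁ = c ∧ star y₂ * d * y₂ = c ∧
      star y₁ * d * y₂ = 0 := by
  set s := CFC.sqrt d with hs
  have hsd : s * s = d := CFC.sqrt_mul_sqrt_self d hd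
  have hss : star s = s := (CFC.sqrt_nonneg d).isSelfAdjoint
  by_cases hz : ∃ m, (s * m * s) * (s * m * s) = 0 ∧ s * m * s ≠ 0
  · obtain ⟨m, hm, hm0⟩ := hz
    set z := s * m * s with hzd
    have hsz : star z = s * star m * s := by rw [hzd, star_mul, star_mul, hss, mul_assoc]
    set q := CFC.sqrt (star z * z) with hq
    have hqq : q * q = star z * z := CFC.sqrt_mul_sqrt_self _ (star_mul_self_nonneg z)
    have hqs : star q = q := (CFC.sqrt_nonneg _).isSelfAdjoint
    refine ⟨star m * s * z, m * s * q, star (star z * z) * (star z * z), star_mul_self_nonneg _,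
      ?_, ?_, ?_, ?_⟩
    · rwa [Ne, CStarRing.star_mul_self_eq_zero_iff, CStarRing.star_mul_self_eq_zero_iff]
    · calc star (star m * s * z) * d * (star m * s * z)
          = star z * (s * m * s) * (s * star m * s) * z := by
            rw [← hsd]; simp only [star_mul, star_star, hss, mul_assoc]
        _ = _ := by rw [← hzd, ← hsz]; simp only [star_mul, star_star, mul_assoc]
    · calc star (m * s * q) * d * (m * s * q)
          = q * ((s * star m * s) * (s * m * s)) * q := by
            rw [← hsd]; simp only [star_mul, hss, hqs, mul_assoc]
        _ = (q * q) * (q * q) := by rw [← hzd, ← hsz, ← hqq]; simp only [mul_assoc]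
        _ = _ := by rw [hqq]; simp only [star_mul, star_star, mul_assoc]
    · calc star (star m * s * z) * d * (m * s * q)
          = star z * ((s * m * s) * (s * m * s)) * q := by
            rw [← hsd]; simp only [star_mul, star_star, hss, mul_assoc]
        _ = 0 := by rw [hm, mul_zero, zero_mul]
  · push Not at hz
    -- If uv = 0 with u, v in sAs, then vmu has square zero for all m and hence vanishes; primeness
    -- then gives u = 0 or v = 0.
    have hK : ∀ x y, (s * x * s) * (s * y * s) = 0 → s * x * s = 0 ∨ s * y * s = 0 := by
      intro x y hxy
      refine (hA.prime fun m => ?_).symm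
      have e : s * y * s * m * (s * x * s) = s * (y * s * m * s * x) * s := by
        simp only [mul_assoc]
      rw [e]
      refine hz _ ?_
      calc s * (y * s * m * s * x) * s * (s * (y * s * m * s * x) * s)
          = s * y * s * m * ((s * x * s) * (s * y * s)) * m * (s * x * s) := by
            simp only [mul_assoc]
        _ = 0 := by rw [hxy]; simp
    have hd1 : ∀ x, d * x * d = s * (s * x * s) * s := by
      intro x; rw [← hsd]; simp only [mul_assoc]
    obtain ⟨r, p, hr, hp, hdp⟩ := exists_isStarProjection_smul hd (fun x y hxy => by
      rw [hd1, hd1] at *; exact hK _ _ hxy)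
    have hr0 : r ≠ 0 := by rintro rfl; exact hd0 (by rw [hdp, zero_smul])
    have hp0 : p ≠ 0 := by rintro rfl; exact hd0 (by rw [hdp, smul_zero])
    have hp1 : ∀ x, p * x * p = s * (s * ((r⁻¹ * r⁻¹) • x) * s) * s := by
      intro x
      rw [← hd1, hdp]
      simp only [mul_smul_comm, smul_mul_assoc, smul_smul]
      rw [show r * (r⁻¹ * r⁻¹ * r) = 1 by field_simp, one_smul]
    obtain ⟨τ, hτ⟩ := hT
    exact absurd hn (not_isNonUnital_of_elementary hA hτ hp hp0
      (exists_smul_of_no_zero_divisors hp fun x y hxy => by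
        rw [hp1, hp1] at *; exact hK _ _ hxy))

/-- Every nonzero positive element dominates arbitrarily many mutually orthogonal copies of some
nonzero positive element. -/
theorem exists_conj_eq_ite [PartialOrder A] [StarOrderedRing A] (hA : IsSimpleCStar A)
    (hn : IsNonUnital A) (hT : (tracialStates A).Nonempty) {d : A} (hd : 0 ≤ d) (hd0 : d ≠ 0)
    (N : ℕ) : ∃ (x : Fin (N + 1) → A) (c : A), 0 ≤ c ∧ c ≠ 0 ∧
      ∀ j k, star (x j) * d * x k = if j = k then c else 0 := by
  have hds : star d = d := hd.isSelfAdjoint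
  induction N with
  | zero =>
    have h3 : star d * d * d = d * d * d := by rw [hds]
    refine ⟨fun _ => d, star d * d * d, star_left_conjugate_nonneg hd d, ?_, fun j k => ?_⟩
    · rw [h3]
      intro h
      exact hd0 (eq_zero_of_mul_star_mul_self (by rwa [hds]))
    · rw [if_pos (by omega)]
  | succ N ih =>
    obtain ⟨x, c, hc, hc0, hx⟩ := ih
    obtain ⟨y₁, y₂, c', hc', hc0', h11, h22, h12⟩ := exists_two_orthogonal_copies hA hn hT hc hc0
    have h21 : star y₂ * c * y₁ = 0 := by
      have := congrArg star h12
      rwa [star_mul, star_mul, star_star, hc.isSelfAdjoint.star_eq, star_zero, ← mul_assoc] at this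
    have key : ∀ i j (y y' : A), star (x i * y) * d * (x j * y')
        = if i = j then star y * c * y' else 0 := by
      intro i j y y'
      calc star (x i * y) * d * (x j * y') = star y * (star (x i) * d * x j) * y' := by
            simp only [star_mul, mul_assoc]
        _ = _ := by rw [hx]; split_ifs <;> simp
    refine ⟨Fin.cons (x 0 * y₂) fun j => x j * y₁, c', hc', hc0', fun j k => ?_⟩
    refine Fin.cases ?_ (fun j => ?_) j <;> refine Fin.cases ?_ (fun k => ?_) k
    · rw [Fin.cons_zero, key, if_pos rfl, if_pos rfl, h22]
    · rw [Fin.cons_zero, Fin.cons_succ, key, h21, if_neg (Fin.succ_ne_zero k).symm, ite_self]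
    · rw [Fin.cons_zero, Fin.cons_succ, key, h12, if_neg (Fin.succ_ne_zero j), ite_self]
    · simp only [Fin.cons_succ, key, h11, Fin.succ_inj]

/-- Put w_j = d^{1/2}x_j. The f_r(w_j w_j*) are mutually orthogonal positive contractions, all of
trace τ(f_r(c)), so their sum is still a contraction. -/
theorem card_mul_trace_cutFn_le [PartialOrder A] [StarOrderedRing A] {N : ℕ} {x : Fin N → A}
    {d c : A} (hd : 0 ≤ d) (h : ∀ j k, star (x j) * d * x k = if j = k then c else 0)
    {τ : WeakDual ℂ A} (hτ : τ ∈ tracialStates A) {r : ℝ} (hr : 0 < r) :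
    N * (τ (cfcₙ (cutFn r) c)).re ≤ 1 := by
  set s := CFC.sqrt d with hs
  have hsd : s * s = d := CFC.sqrt_mul_sqrt_self d hd
  have hss : star s = s := (CFC.sqrt_nonneg d).isSelfAdjoint
  have hw : ∀ j k, star (s * x j) * (s * x k) = if j = k then c else 0 := by
    intro j k
    rw [← h, ← hsd, star_mul, hss]; simp only [mul_assoc]
  have hcont := continuous_cutFn r
  have h0 := cutFn_zero hr
  set f : Fin N → A := fun j => cfcₙ (cutFn r) (s * x j * star (s * x j)) with hf
  have hff : ∀ j k, j ≠ k → f j * f k = 0 := by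
    intro j k hjk
    have h1 : (s * x j * star (s * x j)) * (s * x k * star (s * x k)) = 0 := by
      rw [mul_assoc, ← mul_assoc (star _), hw, if_neg hjk, zero_mul, mul_zero]
    have h2 := congrArg star (cfcₙ_mul_eq_zero (.mul_star_self _) h1 hcont h0)
    rw [star_mul, star_zero, (IsSelfAdjoint.mul_star_self _).star_eq] at h2
    have h3 := congrArg star (cfcₙ_mul_eq_zero (.mul_star_self _) h2 hcont h0)
    rwa [star_mul, star_star, star_zero, (isSelfAdjoint_cfcₙ _ _).star_eq] at h3
  have hfs : ∀ j, f j * f j ≤ f j := by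
    intro j
    rw [hf, ← cfcₙ_mul _ _ _ hcont.continuousOn h0 hcont.continuousOn h0]
    refine cfcₙ_mono (fun t _ => ?_) (by fun_prop) (by fun_prop) (by simp [h0]) h0
    have := cutFn_nonneg r t
    have := cutFn_le_one r t
    change cutFn r t * cutFn r t ≤ cutFn r t
    nlinarith
  have hS : ‖∑ j, f j‖ ≤ 1 := by
    refine norm_le_one_of_mul_self_le ?_ ?_
    · rw [IsSelfAdjoint, star_sum]
      exact Finset.sum_congr rfl fun j _ => (isSelfAdjoint_cfcₙ _ _).star_eq
    · rw [Finset.sum_mul]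
      refine Finset.sum_le_sum fun j _ => ?_
      rw [Finset.mul_sum, Finset.sum_eq_single j (fun k _ hk => hff j k hk.symm) (by simp)]
      exact hfs j
  have h2 := (Complex.re_le_norm _).trans ((norm_apply_le_of_mem_tracialStates hτ _).trans hS)
  rw [map_sum] at h2
  have h3 : ∀ j, τ (f j) = τ (cfcₙ (cutFn r) c) := by
    intro j
    have := hw j j
    rw [if_pos rfl] at this
    rw [hf, ← this]
    exact (trace_cutFn_star_mul_self hτ.2.1 _ hr).symm
  simpa [h3] using h2

end Elementary

/-! ### Completely positive maps and functional calculus -/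

section Tools

variable {B : Type*} [NonUnitalCStarAlgebra B]

theorem tendsto_cfcₙ_of_tendsto {ι : Type*} {l : Filter ι} {x : ι → B} {y : B}
    (hx : ∀ i, IsSelfAdjoint (x i)) (hy : IsSelfAdjoint y) (h : Tendsto x l (𝓝 y)) {f : ℝ → ℝ}
    (hf : Continuous f) (hf0 : f 0 = 0) : Tendsto (fun i => cfcₙ f (x i)) l (𝓝 (cfcₙ f y)) := by
  refine h.cfcₙ (s := Set.Icc (-(‖y‖ + 1)) (‖y‖ + 1)) isCompact_Icc f ?_ (.of_forall hx)
    (quasispectrum_subset_Icc hy (by linarith)) hy hf.continuousOn hf0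
  filter_upwards [h.norm.eventually_le_const (lt_add_one ‖y‖)] with i hi
  exact quasispectrum_subset_Icc (hx i) hi

theorem coe_cfcₙ {D : NonUnitalStarSubalgebra ℂ B} [IsClosed (D : Set B)] {x : D}
    (hx : IsSelfAdjoint x) {f : ℝ → ℝ} (hf : Continuous f) (hf0 : f 0 = 0) :
    ((cfcₙ f x : D) : B) = cfcₙ f (x : B) :=
  (NonUnitalStarSubalgebraClass.subtype D).map_cfcₙ (S := ℂ) f x hf.continuousOn hf0
    continuous_subtype_val hx (hx.map (NonUnitalStarSubalgebraClass.subtype D))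

theorem norm_cutFn_mul_sub_le [PartialOrder B] [StarOrderedRing B] {a : B} (ha : 0 ≤ a) {ε : ℝ}
    (hε : 0 < ε) : ‖cfcₙ (cutFn ε) a * a - a‖ ≤ ε := by
  have hc := continuous_cutFn ε
  have h0 := cutFn_zero hε
  have e : cfcₙ (cutFn ε) a * a - a = cfcₙ (fun t => cutFn ε t * t - t) a := by
    rw [cfcₙ_sub (fun t => cutFn ε t * t) (fun t => t) a (by fun_prop) (by simp) (by fun_prop) rfl,
      cfcₙ_mul (cutFn ε) (fun t => t) a (by fun_prop) h0 (by fun_prop) rfl, cfcₙ_id' ℝ a]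
  rw [e]
  refine norm_cfcₙ_le fun t ht => ?_
  have ht0 : 0 ≤ t := quasispectrum_nonneg_of_nonneg a ha t ht
  have h1 := cutFn_nonneg ε t
  have h2 := cutFn_le_one ε t
  rw [Real.norm_eq_abs, abs_le]
  rcases le_total ε t with h | h
  · rw [cutFn_of_ge hε h]; constructor <;> linarith
  · constructor <;> nlinarith

theorem isSelfAdjoint_map_of_completelyPositive [PartialOrder B] [StarOrderedRing B] {B' : Type*}
    [NonUnitalCStarAlgebra B'] [PartialOrder B'] [StarOrderedRing B'] (φ : B →CP B') {x : B}
    (hx : IsSelfAdjoint x) : IsSelfAdjoint (φ x) := by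
  rw [← CFC.posPart_sub_negPart x hx, map_sub]
  exact (IsSelfAdjoint.of_nonneg (map_nonneg φ (CFC.posPart_nonneg x))).sub
    (.of_nonneg (map_nonneg φ (CFC.negPart_nonneg x)))

theorem map_star_of_completelyPositive [PartialOrder B] [StarOrderedRing B] {B' : Type*}
    [NonUnitalCStarAlgebra B'] [PartialOrder B'] [StarOrderedRing B'] (φ : B →CP B') (x : B) :
    φ (star x) = star (φ x) := by
  have h1 := isSelfAdjoint_map_of_completelyPositive φ (realPart x).2
  have h2 := isSelfAdjoint_map_of_completelyPositive φ (imaginaryPart x).2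
  conv_lhs => rw [← realPart_add_I_smul_imaginaryPart x]
  conv_rhs => rw [← realPart_add_I_smul_imaginaryPart x]
  rw [star_add, star_smul, (realPart x).2.star_eq, (imaginaryPart x).2.star_eq, map_add, map_add,
    map_smul, map_smul, star_add, star_smul, h1.star_eq, h2.star_eq]

end Tools

/-! ### Systems of approximations -/

theorem tendsto_zero_of_norm_lt_inv {α G : Type*} [SeminormedAddCommGroup G]
    {u : ℕ × Finset α → G} (i₀ : ℕ × Finset α) (h : ∀ i, i₀ ≤ i → ‖u i‖ < 1 / ((i.1 : ℝ) + 1)) :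
    Tendsto u atTop (𝓝 0) := by
  refine squeeze_zero_norm' ((eventually_ge_atTop i₀).mono fun i hi => (h i hi).le) ?_
  exact tendsto_one_div_add_atTop_nhds_zero_nat.comp
    (tendsto_fst.mono_left (by rw [← prod_atTop_atTop_eq]))

section ApproxSystem

variable {A : Type*} [NonUnitalCStarAlgebra A] [PartialOrder A] [StarOrderedRing A]

/-- The approximations `x ≈ φ(x) + ψ(x)` of a C*-algebra in the class `𝒟`, organised as a net, for
which `φ(a₀)` is Cuntz dominated by `c`. -/
structure ApproxSystem (a₀ : A) (f₀ : ℝ) (c : A) where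
  /-- the small part -/
  φ : ℕ × Finset A → A →CP A
  /-- the part in a subalgebra in `𝒞₀'` -/
  ψ : ℕ × Finset A → A →CP A
  /-- the subalgebra -/
  D : ℕ × Finset A → NonUnitalStarSubalgebra ℂ A
  isClosed : ∀ i, IsClosed (D i : Set A)
  mem : ∀ i x, ψ i x ∈ D i
  norm_φ : ∀ i x, ‖φ i x‖ ≤ ‖x‖
  norm_ψ : ∀ i x, ‖ψ i x‖ ≤ ‖x‖
  mul_φ : ∀ x y, Tendsto (fun i => φ i (x * y) - φ i x * φ i y) atTop (𝓝 0)
  mul_ψ : ∀ x y, Tendsto (fun i => ψ i (x * y) - ψ i x * ψ i y) atTop (𝓝 0)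
  add : ∀ x, Tendsto (fun i => x - (φ i x + ψ i x)) atTop (𝓝 0)
  orth : ∀ i x, ∀ d ∈ D i, φ i x * d = 0 ∧ d * φ i x = 0
  ne_bot : ∀ i, D i ≠ ⊥
  inC0Prime : ∀ i, InC0Prime (D i)
  cuntzLE : ∀ i, CuntzLE (φ i a₀) c
  trace : ∀ i, ∀ t ∈ tracialStates (D i),
    f₀ ≤ (t (cfcₙ (cutFn (1 / 4)) (⟨ψ i a₀, mem i a₀⟩ : D i))).re

theorem exists_approxSystem {a₀ : A} {f₀ : ℝ}
    (h : ∀ ε : ℝ, 0 < ε → ∀ F : Finset A, ∀ b : A, 0 ≤ b → b ≠ 0 →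
      ∃ (φ ψ : A →CP A) (D : NonUnitalStarSubalgebra ℂ A) (_ : IsClosed (D : Set A))
      (hψD : ∀ x, ψ x ∈ D),
      (∀ x, ‖φ x‖ ≤ ‖x‖) ∧ (∀ x, ‖ψ x‖ ≤ ‖x‖) ∧
      (∀ x ∈ F, ∀ y ∈ F, ‖φ (x * y) - φ x * φ y‖ < ε) ∧
      (∀ x ∈ F, ∀ y ∈ F, ‖ψ (x * y) - ψ x * ψ y‖ < ε) ∧
      (∀ x, ∀ d ∈ D, φ x * d = 0 ∧ d * φ x = 0) ∧
      (∀ x ∈ (F : Set A) ∪ {a₀}, ‖x - (φ x + ψ x)‖ < ε) ∧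
      D ≠ ⊥ ∧ InC0Prime D ∧
      CuntzLE (φ a₀) b ∧
      ∀ t ∈ tracialStates D, f₀ ≤ (t (cfcₙ (cutFn (1 / 4)) (⟨ψ a₀, hψD a₀⟩ : D))).re)
    {c : A} (hc : 0 ≤ c) (hc0 : c ≠ 0) : Nonempty (ApproxSystem a₀ f₀ c) := by
  classical
  -- The index (k, F) stands for tolerance 1/(k + 1) on F, so every statement about fixed elements
  -- holds in the limit of the net.
  have key := fun i : ℕ × Finset A => h (1 / ((i.1 : ℝ) + 1)) (by positivity) i.2 c hc hc0
  choose φ ψ D hD mem h1 h2 h3 h4 h5 h6 h7 h8 h9 h10 using key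
  have hle : ∀ (s : Finset A) (i : ℕ × Finset A), (0, s) ≤ i → s ⊆ i.2 := fun s i hi => hi.2
  exact ⟨
  { φ := φ, ψ := ψ, D := D, isClosed := hD, mem := mem, norm_φ := h1, norm_ψ := h2
    mul_φ := fun x y => tendsto_zero_of_norm_lt_inv (0, {x, y}) fun i hi =>
      h3 i x (hle _ _ hi (by simp)) y (hle _ _ hi (by simp))
    mul_ψ := fun x y => tendsto_zero_of_norm_lt_inv (0, {x, y}) fun i hi =>
      h4 i x (hle _ _ hi (by simp)) y (hle _ _ hi (by simp))
    add := fun x => tendsto_zero_of_norm_lt_inv (0, {x}) fun i hi =>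
      h6 i x (Or.inl (hle _ _ hi (by simp)))
    orth := h5, ne_bot := h7, inC0Prime := h8, cuntzLE := h9, trace := h10 }⟩

namespace ApproxSystem

variable {a₀ : A} {f₀ : ℝ} {c : A} (S : ApproxSystem a₀ f₀ c)

instance (i : ℕ × Finset A) : IsClosed (S.D i : Set A) := S.isClosed i

/-- `ψ` as a map into the subalgebra. -/
def ψD (i : ℕ × Finset A) (x : A) : S.D i := ⟨S.ψ i x, S.mem i x⟩

theorem tendsto_cfcₙ_φ {x : A} (hx : IsSelfAdjoint x) {g : ℝ → ℝ} (hg : Continuous g)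
    (hg0 : g 0 = 0) : Tendsto (fun i => cfcₙ g (S.φ i x) - S.φ i (cfcₙ g x)) atTop (𝓝 0) :=
  tendsto_cfcₙ_sub_map_cfcₙ (θ := fun i => (S.φ i : A →ₗ[ℂ] A)) (K := 1)
    (fun i x => by rw [one_mul]; exact S.norm_φ i x) (fun i _ hx => isSelfAdjoint_map_of_completelyPositive (S.φ i) hx)
    S.mul_φ hx hg hg0

theorem tendsto_cfcₙ_ψ {x : A} (hx : IsSelfAdjoint x) {g : ℝ → ℝ} (hg : Continuous g)
    (hg0 : g 0 = 0) : Tendsto (fun i => cfcₙ g (S.ψ i x) - S.ψ i (cfcₙ g x)) atTop (𝓝 0) :=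
  tendsto_cfcₙ_sub_map_cfcₙ (θ := fun i => (S.ψ i : A →ₗ[ℂ] A)) (K := 1)
    (fun i x => by rw [one_mul]; exact S.norm_ψ i x) (fun i _ hx => isSelfAdjoint_map_of_completelyPositive (S.ψ i) hx)
    S.mul_ψ hx hg hg0

theorem isSelfAdjoint_ψD {x : A} (hx : IsSelfAdjoint x) (i : ℕ × Finset A) :
    IsSelfAdjoint (S.ψD i x) := Subtype.ext (isSelfAdjoint_map_of_completelyPositive (S.ψ i) hx)

theorem tendsto_trace_sub {l : Filter (ℕ × Finset A)} {t : ∀ i, WeakDual ℂ (S.D i)}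
    (ht : ∀ i, t i ∈ tracialStates (S.D i)) {u v : ∀ i, S.D i}
    (h : Tendsto (fun i => (u i : A) - v i) l (𝓝 0)) :
    Tendsto (fun i => t i (u i) - t i (v i)) l (𝓝 0) := by
  refine squeeze_zero_norm (fun i => ?_) (tendsto_zero_iff_norm_tendsto_zero.mp h)
  rw [← map_sub]
  exact norm_apply_le_of_mem_tracialStates (ht i) _

theorem tracialStates_nonempty (i : ℕ × Finset A) : (tracialStates (S.D i)).Nonempty := by
  obtain ⟨x, hx, hx0⟩ : ∃ x ∈ S.D i, x ≠ 0 := by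
    by_contra! hc
    refine S.ne_bot i (le_antisymm (fun x hx => ?_) bot_le)
    rw [hc x hx]; exact zero_mem _
  exact (S.inC0Prime i).tracialStates_nonempty (d := ⟨x, hx⟩)
    fun h => hx0 (congrArg Subtype.val h)

/-- Traces on the subalgebras of an approximation system converge to a multiple of a trace. -/
theorem exists_limit_trace (ha : IsSelfAdjoint a₀) (hf : 0 < f₀) (U : Ultrafilter (ℕ × Finset A))
    (hU : ↑U ≤ (atTop : Filter (ℕ × Finset A))) {t : ∀ i, WeakDual ℂ (S.D i)}
    (ht : ∀ i, t i ∈ tracialStates (S.D i)) :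
    ∃ τ ∈ tracialStates A, ∃ r : ℝ, 0 < r ∧
      ∀ x, Tendsto (fun i => t i (S.ψD i x)) U (𝓝 (r * τ x)) := by
  have hbound : ∀ x i, ‖t i (S.ψD i x)‖ ≤ ‖x‖ := fun x i =>
    (norm_apply_le_of_mem_tracialStates (ht i) _).trans (S.norm_ψ i x)
  have hlim : ∀ x, ∃ z : ℂ, ‖z‖ ≤ ‖x‖ ∧ Tendsto (fun i => t i (S.ψD i x)) U (𝓝 z) := by
    intro x
    obtain ⟨z, hz, hle⟩ := (isCompact_closedBall (0 : ℂ) ‖x‖).ultrafilter_le_nhds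
      (U.map fun i => t i (S.ψD i x)) (by
        rw [le_principal_iff]
        exact Filter.mem_map.mpr (Filter.univ_mem' fun i => by simpa using hbound x i))
    exact ⟨z, by simpa using hz, hle⟩
  choose τ₀ hτn hτ using hlim
  have hτ' : ∀ {x z}, Tendsto (fun i => t i (S.ψD i x)) U (𝓝 z) → τ₀ x = z := fun h =>
    tendsto_nhds_unique (hτ _) h
  have hsub : ∀ {x : A} {z : ℂ} {u : ∀ i, S.D i},
      Tendsto (fun i => (u i : A) - S.ψ i x) atTop (𝓝 0) →
      Tendsto (fun i => t i (u i)) U (𝓝 z) → τ₀ x = z := by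
    intro x z u hu hz
    refine hτ' ?_
    have h1 := hz.sub ((S.tendsto_trace_sub ht (v := fun i => S.ψD i x) hu).mono_left hU)
    simpa using h1
  have hsub' : ∀ {x : A} {u : ∀ i, S.D i},
      Tendsto (fun i => (u i : A) - S.ψ i x) atTop (𝓝 0) →
      Tendsto (fun i => t i (u i)) U (𝓝 (τ₀ x)) := by
    intro x u hu
    have h1 := (hτ x).add ((S.tendsto_trace_sub ht (v := fun i => S.ψD i x) hu).mono_left hU)
    simpa using h1
  let L : A →ₗ[ℂ] ℂ :=
    { toFun := τ₀
      map_add' := fun x y => hτ' (((hτ x).add (hτ y)).congr fun i => by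
        rw [← map_add]; congr 1; exact Subtype.ext (map_add (S.ψ i) x y).symm)
      map_smul' := fun a x => hτ' (((hτ x).const_smul a).congr fun i => by
        rw [← map_smul]; congr 1; exact Subtype.ext (map_smul (S.ψ i) a x).symm) }
  let t₀ : A →L[ℂ] ℂ := L.mkContinuous 1 fun x => by rw [one_mul]; exact hτn x
  have ht₀ : ∀ x, t₀ x = τ₀ x := fun _ => rfl
  have hmul : ∀ x y, Tendsto (fun i => t i (S.ψD i x * S.ψD i y)) U (𝓝 (τ₀ (x * y))) :=
    fun x y => hsub' (by simpa using! (S.mul_ψ x y).neg)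
  -- The bound by f₀ persists in the limit, where it reads Re τ₀(f_{1/4}(a₀)) ≥ f₀ > 0.
  have hne : t₀ ≠ 0 := by
    intro h0
    have hc := continuous_cutFn (1 / 4)
    have hc0 := cutFn_zero (ε := 1 / 4) (by norm_num)
    have h1 := hsub' (x := cfcₙ (cutFn (1 / 4)) a₀) (u := fun i => cfcₙ (cutFn (1 / 4)) (S.ψD i a₀))
      (by
        refine (S.tendsto_cfcₙ_ψ ha hc hc0).congr fun i => ?_
        rw [coe_cfcₙ (S.isSelfAdjoint_ψD ha i) hc hc0]; rfl)
    have h2 := ge_of_tendsto (Complex.continuous_re.tendsto _ |>.comp h1)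
      (Filter.Eventually.of_forall fun i => S.trace i (t i) (ht i))
    rw [← ht₀, h0] at h2
    simp at h2
    linarith
  obtain ⟨τ, hτT, hτe⟩ := exists_tracialState_smul t₀ (fun x => by
      rw [ht₀]
      refine ge_of_tendsto (hmul (star x) x) (.of_forall fun i => ?_)
      have : S.ψD i (star x) = star (S.ψD i x) :=
        Subtype.ext (map_star_of_completelyPositive (S.ψ i) x)
      rw [this]
      exact (ht i).1 _)
    (fun x y => by
      rw [ht₀, ht₀]
      exact tendsto_nhds_unique (hmul x y) ((hmul y x).congr fun i => (ht i).2.1 _ _)) hne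
  exact ⟨τ, hτT, ‖t₀‖, norm_pos_iff.mpr hne, fun x => by rw [← hτe, ht₀]; exact hτ x⟩

theorem nonempty_tracialStates (S : ApproxSystem a₀ f₀ c) (ha : IsSelfAdjoint a₀) (hf : 0 < f₀) :
    (tracialStates A).Nonempty := by
  classical
  have ht := fun i => S.tracialStates_nonempty i
  choose t ht using ht
  obtain ⟨τ, hτ, -⟩ := S.exists_limit_trace ha hf (Ultrafilter.of atTop) (Ultrafilter.of_le _) ht
  exact ⟨τ, hτ⟩

end ApproxSystem

end ApproxSystem

/-! ### The trace of the cut-down of a strictly positive element -/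

section

variable {A : Type*} [NonUnitalCStarAlgebra A]

theorem norm_cfcₙ_cutFn_le (ε : ℝ) (a : A) : ‖cfcₙ (cutFn ε) a‖ ≤ 1 :=
  norm_cfcₙ_le fun t _ => by
    rw [Real.norm_eq_abs, abs_of_nonneg (cutFn_nonneg _ _)]
    exact cutFn_le_one _ _

theorem zero_notMem_closure_tracialStates {a : A} {r : ℝ} (hr : 0 < r)
    (h : ∀ τ ∈ tracialStates A, r ≤ (τ a).re) : (0 : WeakDual ℂ A) ∉ closure (tracialStates A) := by
  intro h0
  have hc : IsClosed {τ : WeakDual ℂ A | r ≤ (τ a).re} :=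
    isClosed_le continuous_const (Complex.continuous_re.comp (WeakDual.eval_continuous a))
  have h1 : r ≤ ((0 : WeakDual ℂ A) a).re := closure_minimal h hc h0
  have h2 : ((0 : WeakDual ℂ A) a).re = 0 := rfl
  linarith

variable [PartialOrder A] [StarOrderedRing A]

theorem cfcₙ_cutFn_nonneg (ε : ℝ) (a : A) : 0 ≤ cfcₙ (cutFn ε) a :=
  cfcₙ_nonneg fun t _ => cutFn_nonneg ε t

theorem cfcₙ_cutFn_mul_self_le {ε : ℝ} (hε : 0 < ε) (a : A) :
    cfcₙ (cutFn ε) a * cfcₙ (cutFn ε) a ≤ cfcₙ (cutFn ε) a := by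
  have hc := continuous_cutFn ε
  have h0 := cutFn_zero hε
  by_cases ha : IsSelfAdjoint a
  · rw [← cfcₙ_mul _ _ _ hc.continuousOn h0 hc.continuousOn h0]
    refine cfcₙ_mono (fun t _ => ?_) (by fun_prop) (by fun_prop) (by simp [h0]) h0
    have := cutFn_nonneg ε t
    have := cutFn_le_one ε t
    change cutFn ε t * cutFn ε t ≤ cutFn ε t
    nlinarith
  · rw [cfcₙ_apply_of_not_predicate a ha, mul_zero]

/-- The factor 4 counts the positive elements, each of norm at most ‖z‖, into which z decomposes. -/
theorem norm_posTrace_conj_le {σ : A →ₗ[ℂ] ℂ} (hσ : IsPosTrace σ) {g : A} (hg : IsSelfAdjoint g)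
    (z : A) : ‖σ (g * z * g)‖ ≤ 4 * ‖z‖ * (σ (g * g)).re := by
  obtain ⟨y, hy, hyn, hc⟩ := CStarAlgebra.exists_sum_four_nonneg z
  have h0 : 0 ≤ σ (g * g) := by
    have := hσ.1 g
    rwa [hg.star_eq] at this
  have key : ∀ i, ‖σ (g * y i * g)‖ ≤ ‖z‖ * (σ (g * g)).re := by
    intro i
    have h1 : 0 ≤ star g * y i * g := star_left_conjugate_nonneg (hy i) g
    rw [hg.star_eq] at h1
    have h2 := Complex.le_def.mp (hσ.nonneg h1)
    have h3 : ‖σ (g * y i * g)‖ = (σ (g * y i * g)).re := by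
      rw [← Complex.re_eq_norm.mpr (hσ.nonneg h1)]
    rw [h3]
    have h4 := hσ.mono (CStarAlgebra.star_left_conjugate_le_norm_smul (a := g) (b := y i)
      (.of_nonneg (hy i)))
    rw [hg.star_eq, ← Complex.coe_smul, map_smul, smul_eq_mul, Complex.re_ofReal_mul] at h4
    exact h4.trans (mul_le_mul_of_nonneg_right (hyn i) (Complex.le_def.mp h0).1)
  conv_lhs => rw [hc]
  rw [Finset.mul_sum, Finset.sum_mul, map_sum]
  refine (norm_sum_le _ _).trans ((Finset.sum_le_sum (g := fun _ => ‖z‖ * (σ (g * g)).re)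
    fun i _ => ?_).trans ?_)
  · rw [mul_smul_comm, smul_mul_assoc, map_smul, norm_smul, norm_pow, Complex.norm_I, one_pow,
      one_mul]
    exact key i
  · simp; linarith

/-- As ‖τ‖ = 1, some contraction x has |τ(x)| > 9/10, and x is close to z = a₀ya₀, hence to gzg with
g = f_s(a₀). Then 8/10 ≤ |τ(gzg)| ≤ 4‖z‖τ(g²) bounds τ(g) from below. -/
theorem exists_le_trace_cutFn {a₀ : A} (ha : IsStrictlyPosElt a₀) (ha1 : ‖a₀‖ = 1)
    {τ : WeakDual ℂ A} (hτ : τ ∈ tracialStates A) :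
    ∃ s : ℝ, 0 < s ∧ 1 / 8 ≤ (τ (cfcₙ (cutFn s) a₀)).re := by
  obtain ⟨x, hx1, hx⟩ := (WeakDual.toStrongDual τ).exists_lt_apply_of_lt_opNorm (r := 9 / 10)
    (by rw [hτ.2.2]; norm_num)
  obtain ⟨_, hy, ⟨y, rfl⟩⟩ := Metric.dense_iff.mp ha.2 x (1 / 20) (by norm_num)
  rw [mem_ball_iff_norm] at hy
  set z := a₀ * y * a₀ with hz
  -- This choice gives s‖y‖ ≤ 1/40, so replacing z by gzg costs at most 1/20.
  refine ⟨1 / (40 * (‖y‖ + 1)), by positivity, ?_⟩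
  set s := 1 / (40 * (‖y‖ + 1)) with hs
  have hs0 : 0 < s := by positivity
  set g := cfcₙ (cutFn s) a₀ with hg
  have hgs : IsSelfAdjoint g := isSelfAdjoint_cfcₙ _ _
  have hg1 : ‖g‖ ≤ 1 := norm_cfcₙ_cutFn_le _ _
  have hga : ‖g * a₀ - a₀‖ ≤ s := norm_cutFn_mul_sub_le ha.1 hs0
  have hag : ‖a₀ * g - a₀‖ ≤ s := by
    rw [← norm_star, star_sub, star_mul, hgs.star_eq, ha.1.isSelfAdjoint.star_eq]; exact hga
  have hsy : s * ‖y‖ ≤ 1 / 40 := by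
    rw [hs, one_div_mul_eq_div, div_le_div_iff₀ (by positivity) (by norm_num)]
    nlinarith [norm_nonneg y]
  have h1 : ‖g * z * g - z‖ ≤ 1 / 20 := by
    have e : g * z * g - z = (g * a₀ - a₀) * y * a₀ * g + a₀ * y * (a₀ * g - a₀) := by
      rw [hz]; noncomm_ring
    rw [e]
    have h2 : ‖(g * a₀ - a₀) * y * a₀ * g‖ ≤ s * ‖y‖ * 1 * 1 :=
      norm_mul_le_of_le (norm_mul_le_of_le (norm_mul_le_of_le hga le_rfl) ha1.le) hg1
    have h3 : ‖a₀ * y * (a₀ * g - a₀)‖ ≤ 1 * ‖y‖ * s :=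
      norm_mul_le_of_le (norm_mul_le_of_le ha1.le le_rfl) hag
    refine (norm_add_le _ _).trans ?_
    linarith
  have h2 : ‖τ x - τ (g * z * g)‖ ≤ 1 / 20 + 1 / 20 := by
    rw [← map_sub]
    refine (norm_apply_le_of_mem_tracialStates hτ _).trans ?_
    have e : x - g * z * g = -(z - x) - (g * z * g - z) := by abel
    rw [e]
    exact (norm_sub_le _ _).trans (add_le_add (by rw [norm_neg]; exact hy.le) h1)
  have h3 : 8 / 10 ≤ ‖τ (g * z * g)‖ := by
    have := norm_sub_norm_le (τ x) (τ (g * z * g))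
    have hx' : 9 / 10 < ‖τ x‖ := hx
    linarith
  have hz1 : ‖z‖ ≤ 21 / 20 := by
    have := norm_sub_norm_le z x
    linarith
  have hP := (isPosTrace_of_mem_closure_tracialStates (subset_closure hτ)).1
  have h4 := norm_posTrace_conj_le hP hgs z
  have h5 := hP.mono (cfcₙ_cutFn_mul_self_le hs0 a₀)
  change ‖τ (g * z * g)‖ ≤ 4 * ‖z‖ * (τ (g * g)).re at h4
  change (τ (g * g)).re ≤ (τ g).re at h5
  have h6 : 0 ≤ (τ (g * g)).re := by
    have := (Complex.le_def.mp (hτ.1 g)).1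
    rwa [hgs.star_eq] at this
  nlinarith

/-- When φ(a₀) is small in trace, ψ carries a definite part of τ, so τ restricted to D has norm at
least 1/32. The bound by f₀ on T(D) then applies to the normalised restriction. -/
theorem le_trace_cutFn (hA : IsSimpleCStar A) (hn : IsNonUnital A) {a₀ : A} {f₀ : ℝ}
    (ha : IsStrictlyPosElt a₀) (ha1 : ‖a₀‖ = 1) (hf : 0 < f₀)
    (hS : ∀ c : A, 0 ≤ c → c ≠ 0 → Nonempty (ApproxSystem a₀ f₀ c))
    {τ : WeakDual ℂ A} (hτ : τ ∈ tracialStates A) :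
    f₀ / 32 ≤ (τ (cfcₙ (cutFn (1 / 4)) a₀)).re := by
  classical
  have ha0 : a₀ ≠ 0 := by rintro rfl; simp at ha1
  have hsa : IsSelfAdjoint a₀ := ha.1.isSelfAdjoint
  -- The argument 15 yields 16 orthogonal copies of c below a₀; everything Cuntz below c then has
  -- cut-downs of trace at most 1/16.
  obtain ⟨x, c, hc, hc0, hx⟩ := exists_conj_eq_ite hA hn ⟨τ, hτ⟩ ha.1 ha0 15
  obtain ⟨S⟩ := hS c hc hc0
  have hP := (isPosTrace_of_mem_closure_tracialStates (subset_closure hτ)).1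
  have hτc : Continuous τ := map_continuous (WeakDual.toStrongDual τ)
  have hre : ∀ {u : ℕ × Finset A → A} {y : A}, Tendsto u atTop (𝓝 y) →
      Tendsto (fun i => (τ (u i)).re) atTop (𝓝 (τ y).re) := fun h =>
    (Complex.continuous_re.tendsto _).comp ((hτc.tendsto _).comp h)
  have hre0 : ∀ {u : ℕ × Finset A → A}, Tendsto u atTop (𝓝 0) →
      Tendsto (fun i => (τ (u i)).re) atTop (𝓝 0) := fun h => by simpa using hre h
  have hsmall : ∀ s : ℝ, 0 < s → ∀ i, (τ (cfcₙ (cutFn s) (S.φ i a₀))).re ≤ 1 / 16 := by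
    intro s hs i
    obtain ⟨z, hz⟩ := S.cuntzLE i
    have h1 : ∀ n, (τ (cfcₙ (cutFn s) (star (z n) * c * z n))).re ≤ 1 / 16 := by
      intro n
      have := card_mul_trace_cutFn_le (x := fun j => x j * z n) ha.1
        (c := star (z n) * c * z n) (fun j k => by
          calc star (x j * z n) * a₀ * (x k * z n) = star (z n) * (star (x j) * a₀ * x k) * z n := by
                simp only [star_mul, mul_assoc]
            _ = _ := by rw [hx]; split_ifs <;> simp) hτ hs
      push_cast at this
      linarith
    refine le_of_tendsto ((Complex.continuous_re.tendsto _).comp ((hτc.tendsto _).comp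
      (tendsto_cfcₙ_of_tendsto (fun n => ?_) (isSelfAdjoint_map_of_completelyPositive (S.φ i) hsa) hz
        (continuous_cutFn s) (cutFn_zero hs)))) (.of_forall h1)
    exact (star_left_conjugate_nonneg hc (z n)).isSelfAdjoint
  obtain ⟨s, hs, hs8⟩ := exists_le_trace_cutFn ha ha1 hτ
  have hsc := continuous_cutFn s
  have hs0 := cutFn_zero hs
  have hfc := continuous_cutFn (1 / 4)
  have hf0 := cutFn_zero (ε := 1 / 4) (by norm_num)
  -- The count is 1/8 − 1/16 − 1/64 − 1/64 = 1/32.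
  have h1 : ∀ᶠ i in atTop, 1 / 32 ≤ (τ (S.ψ i (cfcₙ (cutFn s) a₀))).re := by
    have e1 := (hre0 (S.add (cfcₙ (cutFn s) a₀))).eventually_le_const (u := 1 / 64) (by norm_num)
    have e2 := (hre0 (S.tendsto_cfcₙ_φ hsa hsc hs0)).eventually_const_le (u := -(1 / 64))
      (by norm_num)
    filter_upwards [e1, e2] with i h1 h2
    have h3 := hsmall s hs i
    simp only [map_sub, map_add, Complex.sub_re, Complex.add_re] at h1 h2
    linarith
  have h2 : ∀ᶠ i in atTop, f₀ / 32 ≤ (τ (cfcₙ (cutFn (1 / 4)) (S.ψ i a₀))).re := by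
    filter_upwards [h1] with i hi
    let t₀ : S.D i →L[ℂ] ℂ := (WeakDual.toStrongDual τ).comp
      ⟨(NonUnitalStarSubalgebraClass.subtype (S.D i) : S.D i →ₗ[ℂ] A), continuous_subtype_val⟩
    have ht₀ : ∀ d : S.D i, t₀ d = τ (d : A) := fun _ => rfl
    have hnorm : 1 / 32 ≤ ‖t₀‖ := by
      have h3 := t₀.le_opNorm (S.ψD i (cfcₙ (cutFn s) a₀))
      have h4 : ‖S.ψD i (cfcₙ (cutFn s) a₀)‖ ≤ 1 :=
        (S.norm_ψ i _).trans (norm_cfcₙ_cutFn_le s a₀)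
      have h5 := hi.trans (Complex.re_le_norm _)
      have h6 : ‖t₀‖ * ‖S.ψD i (cfcₙ (cutFn s) a₀)‖ ≤ ‖t₀‖ * 1 :=
        mul_le_mul_of_nonneg_left h4 (norm_nonneg _)
      rw [mul_one] at h6
      exact h5.trans (h3.trans h6)
    obtain ⟨t, ht, hte⟩ := exists_tracialState_smul t₀ (fun x => hτ.1 _) (fun x y => hτ.2.1 _ _)
      (by rintro h; rw [h, norm_zero] at hnorm; norm_num at hnorm)
    have h3 := hte (cfcₙ (cutFn (1 / 4)) (S.ψD i a₀))
    rw [ht₀, coe_cfcₙ (S.isSelfAdjoint_ψD hsa i) hfc hf0] at h3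
    change τ (cfcₙ (cutFn (1 / 4)) (S.ψ i a₀)) = _ at h3
    rw [h3, Complex.re_ofReal_mul]
    have h4 := S.trace i t ht
    change f₀ ≤ (t (cfcₙ (cutFn (1 / 4)) (S.ψD i a₀))).re at h4
    nlinarith
  have h3 : Tendsto (fun i => (τ (S.φ i (cfcₙ (cutFn (1 / 4)) a₀))).re
      + (τ (cfcₙ (cutFn (1 / 4)) (S.ψ i a₀))).re) atTop
      (𝓝 (τ (cfcₙ (cutFn (1 / 4)) a₀)).re) := by
    have e1 := hre0 (S.add (cfcₙ (cutFn (1 / 4)) a₀))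
    have e2 := hre0 (S.tendsto_cfcₙ_ψ hsa hfc hf0)
    have e3 := (e2.sub e1).add_const (τ (cfcₙ (cutFn (1 / 4)) a₀)).re
    simp only [sub_zero, zero_add] at e3
    refine e3.congr fun i => ?_
    simp only [map_sub, map_add, Complex.sub_re, Complex.add_re]
    ring
  refine ge_of_tendsto h3 (h2.mono fun i hi => ?_)
  have h4 : 0 ≤ (τ (S.φ i (cfcₙ (cutFn (1 / 4)) a₀))).re :=
    (Complex.le_def.mp (hP.nonneg (map_nonneg (S.φ i) (cfcₙ_cutFn_nonneg _ _)))).1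
  linarith

end

/-! ### Truncations and corners -/

/-- The function which is `0` on `(-∞, κ]`, has slope `1` on `[κ, κ + 1]`, and is `1` beyond. -/
noncomputable def truncFn (κ t : ℝ) : ℝ := min 1 (max 0 (t - κ))

theorem continuous_truncFn (κ : ℝ) : Continuous (truncFn κ) := by
  unfold truncFn; fun_prop

theorem truncFn_nonneg (κ t : ℝ) : 0 ≤ truncFn κ t := le_min zero_le_one (le_max_left _ _)

theorem truncFn_le_one (κ t : ℝ) : truncFn κ t ≤ 1 := min_le_left _ _

theorem truncFn_of_le {κ t : ℝ} (h : t ≤ κ) : truncFn κ t = 0 := by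
  rw [truncFn, max_eq_left (by linarith), min_eq_right zero_le_one]

theorem truncFn_zero {κ : ℝ} (hκ : 0 ≤ κ) : truncFn κ 0 = 0 := truncFn_of_le hκ

theorem abs_sub_truncFn_le {κ t : ℝ} (hκ : 0 ≤ κ) (h0 : 0 ≤ t) (h1 : t ≤ 1) :
    |t - truncFn κ t| ≤ κ := by
  rw [truncFn, min_eq_right (max_le zero_le_one (by linarith)), abs_le]
  rcases le_total (t - κ) 0 with h | h
  · rw [max_eq_left h]; constructor <;> linarith
  · rw [max_eq_right h]; constructor <;> linarith

section Generic

variable {B : Type*} [NonUnitalCStarAlgebra B]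

/-- The truncation of an element of a C*-algebra. -/
noncomputable def truncElt (κ : ℝ) (a : B) : B := cfcₙ (truncFn κ) a

theorem truncElt_nonneg [PartialOrder B] [StarOrderedRing B] (κ : ℝ) (a : B) :
    0 ≤ truncElt κ a := cfcₙ_nonneg fun t _ => truncFn_nonneg κ t

theorem norm_truncElt_le (κ : ℝ) (a : B) : ‖truncElt κ a‖ ≤ 1 :=
  norm_cfcₙ_le fun t _ => by
    rw [Real.norm_eq_abs, abs_of_nonneg (truncFn_nonneg _ _)]
    exact truncFn_le_one _ _

theorem norm_sub_truncElt_le [PartialOrder B] [StarOrderedRing B] {κ : ℝ} (hκ : 0 ≤ κ) {a : B}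
    (ha : 0 ≤ a) (ha1 : ‖a‖ ≤ 1) : ‖a - truncElt κ a‖ ≤ κ := by
  have hsa : IsSelfAdjoint a := .of_nonneg ha
  have hc := continuous_truncFn κ
  have e : a - truncElt κ a = cfcₙ (fun t => t - truncFn κ t) a := by
    rw [cfcₙ_sub (fun t => t) (truncFn κ) a (by fun_prop) rfl (by fun_prop) (truncFn_zero hκ),
      cfcₙ_id' ℝ a]
    rfl
  rw [e]
  exact norm_cfcₙ_le fun t ht => abs_sub_truncFn_le hκ (quasispectrum_nonneg_of_nonneg a ha t ht)
    (quasispectrum_subset_Icc hsa ha1 ht).2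

theorem mul_sqrt_eq [PartialOrder B] [StarOrderedRing B] {e b : B} (hb : 0 ≤ b) (h : e * b = b) :
    e * CFC.sqrt b = CFC.sqrt b := by
  set s := CFC.sqrt b with hs
  have hsb : s * s = b := CFC.sqrt_mul_sqrt_self b hb
  have hss : star s = s := (CFC.sqrt_nonneg b).isSelfAdjoint
  have h' : b * star e = b := by
    have := congrArg star h
    rwa [star_mul, hb.isSelfAdjoint.star_eq] at this
  rw [← sub_eq_zero, ← CStarRing.mul_star_self_eq_zero_iff]
  calc (e * s - s) * star (e * s - s)
      = e * (s * s) * star e - e * (s * s) - s * s * star e + s * s := by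
        rw [star_sub, star_mul, hss]; noncomm_ring
    _ = 0 := by rw [hsb, h, h']; abel

theorem mul_sqrt_eq_zero [PartialOrder B] [StarOrderedRing B] {c b : B} (hb : 0 ≤ b)
    (h : c * b = 0) : c * CFC.sqrt b = 0 := by
  set s := CFC.sqrt b with hs
  have hsb : s * s = b := CFC.sqrt_mul_sqrt_self b hb
  have hss : star s = s := (CFC.sqrt_nonneg b).isSelfAdjoint
  rw [← CStarRing.mul_star_self_eq_zero_iff]
  calc c * s * star (c * s) = c * (s * s) * star c := by
        rw [star_mul, hss]; simp only [mul_assoc]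
    _ = 0 := by rw [hsb, h, zero_mul]

theorem mul_cutElt_eq {e y : B} (hy : IsSelfAdjoint y) (h : e * y = y) {r : ℝ} (hr : 0 < r) :
    e * cutElt r y = cutElt r y := by
  have hc := continuous_cutFn r
  have hg : Continuous fun t => cutFn r t / max t (r / 2) :=
    hc.div₀ (by fun_prop) fun t => ne_of_gt (lt_max_of_lt_right (by linarith))
  have key : cutElt r y = y * cfcₙ (fun t => cutFn r t / max t (r / 2)) y := by
    conv_rhs => arg 1; rw [← cfcₙ_id' ℝ y]
    rw [← cfcₙ_mul (fun t => t) _ y (by fun_prop) rfl hg.continuousOn (by simp [cutFn_zero hr])]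
    refine cfcₙ_congr fun t _ => ?_
    rw [mul_comm]; exact cutFn_eq_mul_self hr t
  rw [key, ← mul_assoc, h]

theorem cutElt_mul_cutElt {a : B} {δ ε : ℝ} (hδ : 0 < δ) (h : δ ≤ ε / 2) :
    cutElt δ a * cutElt ε a = cutElt ε a :=
  cfcₙ_mul_cfcₙ_eq (continuous_cutFn δ) (cutFn_zero hδ) (continuous_cutFn ε)
    (cutFn_zero (by linarith)) fun t _ => cutFn_mul_cutFn hδ h t

theorem cutElt_mul_cutElt' {a : B} {δ ε : ℝ} (hδ : 0 < δ) (h : δ ≤ ε / 2) :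
    cutElt ε a * cutElt δ a = cutElt ε a :=
  cfcₙ_mul_cfcₙ_eq (continuous_cutFn ε) (cutFn_zero (by linarith)) (continuous_cutFn δ)
    (cutFn_zero hδ) fun t _ => by rw [mul_comm]; exact cutFn_mul_cutFn hδ h t

theorem isSelfAdjoint_cutElt (ε : ℝ) (a : B) : IsSelfAdjoint (cutElt ε a) := isSelfAdjoint_cfcₙ _ _

theorem star_mul_cutElt_mul_cutElt_mul (T : B) {r : ℝ} (hr : 0 < r) :
    star T * (cutElt r (T * star T) * cutElt r (T * star T)) * T
      = cutElt r (star T * T) * (star T * T) * cutElt r (star T * T) := by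
  have h1 : cutElt r (T * star T) * T = T * cutElt r (star T * T) :=
    cfcₙ_mul_star_self_mul (continuous_cutFn r) (cutFn_zero hr)
  have h2 : star T * cutElt r (T * star T) = cutElt r (star T * T) * star T := by
    have := congrArg star h1
    rwa [star_mul, star_mul, (isSelfAdjoint_cutElt _ _).star_eq,
      (isSelfAdjoint_cutElt _ _).star_eq] at this
  rw [← mul_assoc, h2, mul_assoc, h1]
  simp only [mul_assoc]

/-- The compression `(1 - e) h (1 - e)`. -/
def cornerCompl (e h : B) : B := h - e * h - h * e + e * h * e

section Order

variable [PartialOrder B] [StarOrderedRing B]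

theorem cutElt_nonneg (ε : ℝ) (a : B) : 0 ≤ cutElt ε a := cfcₙ_cutFn_nonneg ε a

theorem cornerCompl_eq {e h : B} (he : IsSelfAdjoint e) (hh : 0 ≤ h) :
    cornerCompl e h = star (CFC.sqrt h - CFC.sqrt h * e) * (CFC.sqrt h - CFC.sqrt h * e) := by
  set s := CFC.sqrt h with hs
  have hsb : s * s = h := CFC.sqrt_mul_sqrt_self h hh
  have hss : star s = s := (CFC.sqrt_nonneg h).isSelfAdjoint
  rw [cornerCompl, ← hsb, star_sub, star_mul, hss, he.star_eq]
  noncomm_ring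

theorem cornerCompl_nonneg {e h : B} (he : IsSelfAdjoint e) (hh : 0 ≤ h) : 0 ≤ cornerCompl e h := by
  rw [cornerCompl_eq he hh]; exact star_mul_self_nonneg _

/-- With s = h^{1/2} the norm equals that of s(1 − e)²s, and (1 − e)² ≤ 1 because e² ≤ e and e ≥ 0.
-/
theorem norm_cornerCompl_le {e h : B} (he : 0 ≤ e) (hee : e * e ≤ e) (hh : 0 ≤ h) :
    ‖cornerCompl e h‖ ≤ ‖h‖ := by
  have hes : IsSelfAdjoint e := .of_nonneg he
  rw [cornerCompl_eq hes hh]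
  set s := CFC.sqrt h with hs
  have hsb : s * s = h := CFC.sqrt_mul_sqrt_self h hh
  have hss : star s = s := (CFC.sqrt_nonneg h).isSelfAdjoint
  rw [CStarRing.norm_star_mul_self, ← CStarRing.norm_self_mul_star]
  refine CStarAlgebra.norm_le_norm_of_nonneg_of_le (mul_star_self_nonneg _) ?_
  have h1 : 0 ≤ star s * (e + (e - e * e)) * s :=
    star_left_conjugate_nonneg (add_nonneg he (sub_nonneg.mpr hee)) s
  have h2 : h - (s - s * e) * star (s - s * e) = star s * (e + (e - e * e)) * s := by
    rw [← hsb, star_sub, star_mul, hss, hes.star_eq]; noncomm_ring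
  rw [← sub_nonneg, h2]
  exact h1

/-- Each of the terms eh and he costs at most σ(e), and ehe contributes a nonnegative amount. -/
theorem IsPosTrace.le_re_cornerCompl {σ : B →ₗ[ℂ] ℂ} (hσ : IsPosTrace σ) {e h : B} (he : 0 ≤ e)
    (hh : 0 ≤ h) (hh1 : ‖h‖ ≤ 1) : (σ h).re - 2 * (σ e).re ≤ (σ (cornerCompl e h)).re := by
  have hes : star e = e := he.isSelfAdjoint
  set s := CFC.sqrt e with hs
  have hse : s * s = e := CFC.sqrt_mul_sqrt_self e he
  have hss : star s = s := (CFC.sqrt_nonneg e).isSelfAdjoint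
  have h1 : (σ (h * e)).re ≤ (σ e).re := by
    have h2 := hσ.mono (CStarAlgebra.star_left_conjugate_le_norm_smul (a := s) (b := h)
      (.of_nonneg hh))
    rw [hss, hσ.2, ← mul_assoc, hse, hσ.2, ← Complex.coe_smul, map_smul, smul_eq_mul,
      Complex.re_ofReal_mul] at h2
    have h3 := (Complex.le_def.mp (hσ.nonneg he)).1
    simp only [Complex.zero_re] at h3
    nlinarith [norm_nonneg h]
  have h2 : 0 ≤ (σ (e * h * e)).re := by
    have := star_left_conjugate_nonneg hh e
    rw [hes] at this
    exact (Complex.le_def.mp (hσ.nonneg this)).1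
  rw [cornerCompl, map_add, map_sub, map_sub, hσ.2 e h]
  simp only [Complex.add_re, Complex.sub_re]
  linarith

/-- Two orthogonal pieces below `b` can be put together. -/
theorem exists_conj_eq_add {b T : B} {δ r : ℝ} (hδ : 0 < δ) (hr : 0 < r)
    (hT : cutElt (δ / 2) b * T = T) (hb : IsSelfAdjoint b) (x y : B) :
    ∃ X, star X * b * X = star x * cornerCompl (cutElt r (T * star T)) (cutElt δ b) * x
      + star y * (star T * (cutElt (2 * r) (T * star T) * cutElt (2 * r) (T * star T)) * T)
        * y := by
  set e := cutElt (δ / 2) b with he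
  set h := cutElt δ b with hh
  set E := cutElt r (T * star T) with hE
  set C := cutElt (2 * r) (T * star T) with hC
  -- The element m is made so that mbm = f_{δ/2}(b), which acts as a unit on everything under
  -- f_δ(b). Conjugation of b by mv is therefore v*v for such v.
  set m := cfcₙ (fun t => √(cutFn (δ / 2) t / max t (δ / 2 / 2))) b with hm
  have hδ2 : 0 < δ / 2 := half_pos hδ
  have hmc : Continuous fun t => √(cutFn (δ / 2) t / max t (δ / 2 / 2)) := by
    have hc := continuous_cutFn (δ / 2)
    exact (hc.div₀ (by fun_prop) fun t => ne_of_gt (lt_max_of_lt_right (by linarith))).sqrt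
  have hm0 : √(cutFn (δ / 2) 0 / max 0 (δ / 2 / 2)) = 0 := by simp [cutFn_zero hδ2]
  have hms : star m = m := isSelfAdjoint_cfcₙ _ _
  have hmbm : m * b * m = e := by
    have e1 : m * b = cfcₙ (fun t => √(cutFn (δ / 2) t / max t (δ / 2 / 2)) * t) b := by
      rw [cfcₙ_mul _ (fun t => t) b hmc.continuousOn hm0 (by fun_prop) rfl, cfcₙ_id' ℝ b]
    rw [e1, hm, ← cfcₙ_mul _ _ b (by fun_prop) (by simp) hmc.continuousOn hm0]
    refine cfcₙ_congr fun t _ => ?_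
    have h1 : 0 ≤ cutFn (δ / 2) t / max t (δ / 2 / 2) :=
      div_nonneg (cutFn_nonneg _ _) (le_max_of_le_right (by linarith))
    change √(cutFn (δ / 2) t / max t (δ / 2 / 2)) * t * √(cutFn (δ / 2) t / max t (δ / 2 / 2)) = _
    rw [mul_right_comm, Real.mul_self_sqrt h1]
    exact (cutFn_eq_mul_self hδ2 t).symm
  have heh : e * h = h := cutElt_mul_cutElt hδ2 le_rfl
  have hTT : IsSelfAdjoint (T * star T) := .mul_star_self T
  have heT : e * (T * star T) = T * star T := by rw [← mul_assoc, hT]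
  have heE : e * E = E := mul_cutElt_eq hTT heT hr
  have heC : e * C = C := mul_cutElt_eq hTT heT (by linarith)
  -- The doubling from r to 2r makes E a unit for C, so C is orthogonal to the corner of 1 − E and
  -- the two summands have no cross terms.
  have hCE : C * E = C := cutElt_mul_cutElt' hr (by linarith)
  have hCs : star C = C := isSelfAdjoint_cutElt _ _
  have hh0 : 0 ≤ h := cutElt_nonneg _ _
  have hb0 : 0 ≤ cornerCompl E h := cornerCompl_nonneg (isSelfAdjoint_cutElt _ _) hh0
  have heb : e * cornerCompl E h = cornerCompl E h := by
    simp only [cornerCompl, mul_add, mul_sub, ← mul_assoc, heh, heE]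
  have hCb : C * cornerCompl E h = 0 := by
    simp only [cornerCompl, mul_add, mul_sub, ← mul_assoc, hCE]
    abel
  have hes := mul_sqrt_eq hb0 heb
  have hCs0 := mul_sqrt_eq_zero hb0 hCb
  set s := CFC.sqrt (cornerCompl E h) with hs
  have hsb : s * s = cornerCompl E h := CFC.sqrt_mul_sqrt_self _ hb0
  have hss : star s = s := (CFC.sqrt_nonneg _).isSelfAdjoint
  have hsC : s * C = 0 := by
    have := congrArg star hCs0
    rwa [star_mul, hss, hCs, star_zero] at this
  set u := s * x with hu
  set w := C * (T * y) with hw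
  have heu : e * (u + w) = u + w := by
    rw [mul_add, hu, hw, ← mul_assoc, hes, ← mul_assoc, heC]
  have huw : star u * w = 0 := by
    rw [hu, hw, star_mul, hss, mul_assoc, ← mul_assoc s, hsC, zero_mul, mul_zero]
  have hwu : star w * u = 0 := by
    have := congrArg star huw
    rwa [star_mul, star_star, star_zero] at this
  refine ⟨m * (u + w), ?_⟩
  calc star (m * (u + w)) * b * (m * (u + w)) = star (u + w) * (m * b * m * (u + w)) := by
        rw [star_mul, hms]; simp only [mul_assoc]
    _ = star u * u + star w * w := by
        rw [hmbm, heu, star_add, add_mul, mul_add, mul_add, huw, hwu]; abel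
    _ = _ := by
        rw [hu, hw, ← hsb]; simp only [star_mul, hss, hCs, mul_assoc]

/-- A norm-controlled change of the conjugating element. -/
theorem exists_norm_conj_sub_le_of_orthogonal {b α β a x : B} (hβ : 0 ≤ β)
    (hβα : β * α = 0) {κ η : ℝ} (hκ : 0 < κ) (hx : ‖star x * truncElt κ β * x - a‖ ≤ η) :
    ∃ y, ‖star y * b * y - a‖ ≤ η + κ⁻¹ * (‖a‖ + η) * ‖b - (α + β)‖ := by
  have hβs : IsSelfAdjoint β := .of_nonneg hβ
  have hc := continuous_truncFn κ
  have hmax : ∀ t : ℝ, 0 < max t κ := fun t => lt_max_of_lt_right hκ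
  set k : ℝ → ℝ := fun t => √(truncFn κ t / max t κ) with hk
  have hkc : Continuous k :=
    (hc.div₀ (by fun_prop) fun t => (hmax t).ne').sqrt
  have hk0 : k 0 = 0 := by simp [hk, truncFn_zero hκ.le]
  have hkk : ∀ t, k t * k t = truncFn κ t / max t κ := fun t =>
    Real.mul_self_sqrt (div_nonneg (truncFn_nonneg _ _) (hmax t).le)
  have hks : star (cfcₙ k β) = cfcₙ k β := isSelfAdjoint_cfcₙ _ _
  have hkα : cfcₙ k β * α = 0 := cfcₙ_mul_eq_zero hβs hβα hkc hk0
  have hkβ : cfcₙ k β * β * cfcₙ k β = truncElt κ β := by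
    have e1 : cfcₙ k β * β = cfcₙ (fun t => k t * t) β := by
      rw [cfcₙ_mul k (fun t => t) β hkc.continuousOn hk0 (by fun_prop) rfl, cfcₙ_id' ℝ β]
    rw [e1, ← cfcₙ_mul _ _ β (by fun_prop) (by simp) hkc.continuousOn hk0]
    refine cfcₙ_congr fun t _ => ?_
    change k t * t * k t = truncFn κ t
    rw [mul_right_comm, hkk]
    rcases le_total t κ with h | h
    · rw [truncFn_of_le h]; simp
    · rw [max_eq_left h, div_mul_cancel₀]; linarith
  have hkle : cfcₙ k β * cfcₙ k β ≤ κ⁻¹ • truncElt κ β := by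
    rw [← cfcₙ_mul _ _ β hkc.continuousOn hk0 hkc.continuousOn hk0, truncElt,
      ← cfcₙ_smul κ⁻¹ (truncFn κ) β hc.continuousOn (truncFn_zero hκ.le)]
    refine cfcₙ_mono (fun t _ => ?_) (by fun_prop) (by fun_prop) (by simp [hk0])
      (by simp [truncFn_zero hκ.le])
    change k t * k t ≤ κ⁻¹ * truncFn κ t
    rw [hkk, div_eq_inv_mul]
    exact mul_le_mul_of_nonneg_right (inv_anti₀ hκ (le_max_right _ _)) (truncFn_nonneg _ _)
  set y := cfcₙ k β * x with hy
  have hxn : ‖star x * truncElt κ β * x‖ ≤ ‖a‖ + η := by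
    have := norm_sub_norm_le (star x * truncElt κ β * x) a
    linarith
  -- Since k² ≤ κ⁻¹ · `truncFn κ`, the bound on y does not depend on x. This matters because x
  -- varies along the net, while the error ‖b − (α + β)‖ must still be made negligible.
  have hyn : ‖star y‖ * ‖y‖ ≤ κ⁻¹ * (‖a‖ + η) := by
    rw [norm_star, ← CStarRing.norm_star_mul_self]
    have e1 : star y * y = star x * (cfcₙ k β * cfcₙ k β) * x := by
      rw [hy, star_mul, hks]; simp only [mul_assoc]
    have h1 := star_left_conjugate_le_conjugate hkle x
    rw [mul_smul_comm, smul_mul_assoc, ← e1] at h1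
    refine (CStarAlgebra.norm_le_norm_of_nonneg_of_le (star_mul_self_nonneg y) h1).trans ?_
    rw [norm_smul, Real.norm_of_nonneg (inv_nonneg.mpr hκ.le)]
    exact mul_le_mul_of_nonneg_left hxn (inv_nonneg.mpr hκ.le)
  refine ⟨y, ?_⟩
  have e1 : star y * (α + β) * y = star x * truncElt κ β * x := by
    calc star y * (α + β) * y
        = star x * ((cfcₙ k β * α) * cfcₙ k β + cfcₙ k β * β * cfcₙ k β) * x := by
          rw [hy, star_mul, hks]; noncomm_ring
      _ = _ := by rw [hkα, hkβ, zero_mul, zero_add]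
  have e2 : star y * b * y - a
      = (star x * truncElt κ β * x - a) + star y * (b - (α + β)) * y := by
    rw [mul_sub, sub_mul, e1]; abel
  rw [e2]
  refine (norm_add_le _ _).trans (add_le_add hx ?_)
  calc ‖star y * (b - (α + β)) * y‖ ≤ ‖star y‖ * ‖b - (α + β)‖ * ‖y‖ := norm_mul₃_le
    _ = ‖star y‖ * ‖y‖ * ‖b - (α + β)‖ := by ring
    _ ≤ _ := mul_le_mul_of_nonneg_right hyn (norm_nonneg _)

end Order

end Generic

/-! ### Homomorphisms and functional calculus -/

section Hom

variable {B B' : Type*} [NonUnitalCStarAlgebra B] [NonUnitalCStarAlgebra B']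

theorem map_cfcₙ_starHom (f : B →⋆ₙₐ[ℂ] B') {x : B} (hx : IsSelfAdjoint x) {g : ℝ → ℝ}
    (hg : Continuous g) (hg0 : g 0 = 0) : f (cfcₙ g x) = cfcₙ g (f x) := by
  have hf : Continuous f := map_continuous f
  exact f.map_cfcₙ (S := ℂ) g x hg.continuousOn hg0 hf hx (hx.map f)

theorem map_cutElt (f : B →⋆ₙₐ[ℂ] B') {x : B} (hx : IsSelfAdjoint x) {ε : ℝ} (hε : 0 < ε) :
    f (cutElt ε x) = cutElt ε (f x) :=
  map_cfcₙ_starHom f hx (continuous_cutFn ε) (cutFn_zero hε)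

theorem map_truncElt (f : B →⋆ₙₐ[ℂ] B') {x : B} (hx : IsSelfAdjoint x) {κ : ℝ} (hκ : 0 ≤ κ) :
    f (truncElt κ x) = truncElt κ (f x) :=
  map_cfcₙ_starHom f hx (continuous_truncFn κ) (truncFn_zero hκ)

theorem exists_eq_star_mul_self_of_map_nonneg [PartialOrder B'] [StarOrderedRing B']
    {f : B →⋆ₙₐ[ℂ] B'} (hf : Function.Injective f) {x : B} (hx : 0 ≤ f x) :
    ∃ s, x = star s * s := by
  have hsa : IsSelfAdjoint x := hf (by rw [map_star]; exact hx.isSelfAdjoint)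
  refine ⟨cfcₙ Real.sqrt x, hf ?_⟩
  rw [map_mul, map_star, map_cfcₙ_starHom f hsa Real.continuous_sqrt Real.sqrt_zero,
    (isSelfAdjoint_cfcₙ _ _).star_eq,
    cfcₙ_mul_cfcₙ_eq (k := fun t => t) Real.continuous_sqrt Real.sqrt_zero Real.continuous_sqrt
      Real.sqrt_zero fun t ht => Real.mul_self_sqrt (quasispectrum_nonneg_of_nonneg _ hx t ht),
    cfcₙ_id' ℝ (f x) hx.isSelfAdjoint]

end Hom

/-! ### Matrices over a C*-algebra -/

section Matrices

variable {A : Type*} [NonUnitalCStarAlgebra A] {n : ℕ}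

/-- The trace `τ ⊗ Tr` as a linear map. -/
noncomputable def matTraceₗ (τ : WeakDual ℂ A) (n : ℕ) : CStarMatrix (Fin n) (Fin n) A →ₗ[ℂ] ℂ where
  toFun := matTrace τ n
  map_add' X Y := by simp [matTrace, Finset.sum_add_distrib]
  map_smul' c X := by simp [matTrace, Finset.mul_sum]

theorem isPosTrace_matTraceₗ {τ : WeakDual ℂ A} (hτ : IsPosTrace τ.toLin) :
    IsPosTrace (matTraceₗ τ n) := by
  constructor
  · intro X
    change 0 ≤ ∑ i, τ ((star X * X) i i)
    refine Finset.sum_nonneg fun i _ => ?_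
    rw [CStarMatrix.mul_apply, map_sum]
    exact Finset.sum_nonneg fun k _ => hτ.1 (X k i)
  · intro X Y
    change ∑ i, τ ((X * Y) i i) = ∑ i, τ ((Y * X) i i)
    simp only [CStarMatrix.mul_apply, map_sum]
    rw [Finset.sum_comm]
    exact Finset.sum_congr rfl fun i _ => Finset.sum_congr rfl fun j _ => hτ.2 _ _

/-- The constant diagonal matrices. -/
def diagHom (n : ℕ) : A →⋆ₙₐ[ℂ] CStarMatrix (Fin n) (Fin n) A where
  toFun x := CStarMatrix.ofMatrix (Matrix.diagonal fun _ => x)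
  map_smul' c x := by
    ext i j
    simp only [CStarMatrix.ofMatrix_apply, CStarMatrix.smul_apply, Matrix.diagonal_apply]
    split_ifs <;> simp
  map_zero' := by ext i j; simp
  map_add' x y := by
    ext i j
    simp only [CStarMatrix.ofMatrix_apply, CStarMatrix.add_apply, Matrix.diagonal_apply]
    split_ifs <;> simp
  map_mul' x y := (Matrix.diagonal_mul_diagonal (fun _ => x) (fun _ => y)).symm
  map_star' x := (Matrix.diagonal_conjTranspose fun _ => x).symm

theorem diagHom_apply (x : A) (i j : Fin n) : diagHom n x i j = if i = j then x else 0 := rfl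

theorem matTrace_diagHom (τ : WeakDual ℂ A) (x : A) : matTrace τ n (diagHom n x) = n * τ x := by
  simp [matTrace, diagHom_apply]

theorem tendsto_cstarMatrix {ι : Type*} {l : Filter ι} {u : ι → CStarMatrix (Fin n) (Fin n) A}
    {y : CStarMatrix (Fin n) (Fin n) A}
    (h : ∀ i j, Tendsto (fun k => u k i j) l (𝓝 (y i j))) : Tendsto u l (𝓝 y) :=
  tendsto_pi_nhds.mpr fun i => tendsto_pi_nhds.mpr fun j => h i j

theorem tendsto_cstarMatrix_apply {ι : Type*} {l : Filter ι}
    {u : ι → CStarMatrix (Fin n) (Fin n) A} {y : CStarMatrix (Fin n) (Fin n) A}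
    (h : Tendsto u l (𝓝 y)) (i j : Fin n) : Tendsto (fun k => u k i j) l (𝓝 (y i j)) :=
  tendsto_pi_nhds.mp (tendsto_pi_nhds.mp h i) j

variable [PartialOrder A] [StarOrderedRing A]

theorem norm_matUnit_le (i j : Fin n) (x : A) : ‖matUnit i j x‖ ≤ ‖x‖ := by
  let f : A →⋆ₙₐ[ℂ] CStarMatrix (Fin n) (Fin n) A :=
    { matUnitₗ j j with
      map_zero' := map_zero (matUnitₗ (B := A) j j)
      map_mul' := fun x y => by
        change matUnit j j (x * y) = matUnit j j x * matUnit j j y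
        rw [matUnit_mul, if_pos rfl]
      map_star' := fun x => (star_matUnit j j x).symm }
  have h1 : ‖f (star x * x)‖ ≤ ‖star x * x‖ := NonUnitalStarAlgHom.norm_apply_le f _
  have h2 : f (star x * x) = star (matUnit i j x) * matUnit i j x := by
    rw [star_matUnit, matUnit_mul, if_pos rfl]; rfl
  rw [h2, CStarRing.norm_star_mul_self, CStarRing.norm_star_mul_self] at h1
  exact abs_le_of_sq_le_sq' (by nlinarith) (norm_nonneg _) |>.2

theorem norm_cstarMatrix_le (X : CStarMatrix (Fin n) (Fin n) A) : ‖X‖ ≤ ∑ i, ∑ j, ‖X i j‖ := by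
  conv_lhs => rw [eq_sum_matUnit X]
  exact (norm_sum_le _ _).trans (Finset.sum_le_sum fun i _ => (norm_sum_le _ _).trans
    (Finset.sum_le_sum fun j _ => norm_matUnit_le i j _))

/-- The entrywise application of a completely positive map. -/
def matMap (n : ℕ) (θ : A →CP A) :
    CStarMatrix (Fin n) (Fin n) A →ₗ[ℂ] CStarMatrix (Fin n) (Fin n) A :=
  CStarMatrix.mapₗ (θ : A →ₗ[ℂ] A)

theorem matMap_apply (θ : A →CP A) (X : CStarMatrix (Fin n) (Fin n) A) (i j : Fin n) :
    matMap n θ X i j = θ (X i j) := rfl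

theorem matMap_nonneg (θ : A →CP A) {X : CStarMatrix (Fin n) (Fin n) A} (hX : 0 ≤ X) :
    0 ≤ matMap n θ X := θ.map_cstarMatrix_nonneg X hX

theorem star_matMap (θ : A →CP A) (X : CStarMatrix (Fin n) (Fin n) A) :
    matMap n θ (star X) = star (matMap n θ X) := by
  ext i j
  exact map_star_of_completelyPositive θ (X j i)

theorem matMap_diagHom (θ : A →CP A) (x : A) : matMap n θ (diagHom n x) = diagHom n (θ x) := by
  ext i j
  rw [matMap_apply, diagHom_apply, diagHom_apply]
  split_ifs
  · rfl
  · exact map_zero θ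

/-- The crude factor n² suffices: only boundedness uniform along the net is needed. -/
theorem norm_matMap_le {θ : A →CP A} (h : ∀ x, ‖θ x‖ ≤ ‖x‖) (X : CStarMatrix (Fin n) (Fin n) A) :
    ‖matMap n θ X‖ ≤ (n * n : ℝ) * ‖X‖ := by
  refine (norm_cstarMatrix_le _).trans ((Finset.sum_le_sum fun i _ => Finset.sum_le_sum
    (g := fun _ => ‖X‖) fun j _ => ?_).trans ?_)
  · exact (h _).trans CStarMatrix.norm_entry_le_norm
  · simp; linarith

theorem norm_matTraceₗ_le {τ : WeakDual ℂ A} (hτ : ∀ x, ‖τ x‖ ≤ ‖x‖)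
    (X : CStarMatrix (Fin n) (Fin n) A) : ‖matTraceₗ τ n X‖ ≤ n * ‖X‖ := by
  refine (norm_sum_le _ _).trans ((Finset.sum_le_sum (g := fun _ => ‖X‖) fun i _ =>
    (hτ _).trans CStarMatrix.norm_entry_le_norm).trans ?_)
  simp

end Matrices

/-! ### Comparison in matrices over a subalgebra -/

section Subalgebra

variable {A : Type*} [NonUnitalCStarAlgebra A] (D : NonUnitalStarSubalgebra ℂ A) {n : ℕ}

theorem exists_map_eq_of_forall_mem {X : CStarMatrix (Fin n) (Fin n) A} (hX : ∀ i j, X i j ∈ D) :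
    ∃ Y : CStarMatrix (Fin n) (Fin n) D,
      CStarMatrix.mapₙₐ (NonUnitalStarSubalgebraClass.subtype D) Y = X :=
  ⟨CStarMatrix.ofMatrix fun i j => ⟨X i j, hX i j⟩, rfl⟩

theorem mapₙₐ_subtype_injective : Function.Injective
    (CStarMatrix.mapₙₐ (n := Fin n) (NonUnitalStarSubalgebraClass.subtype D)) := by
  intro X Y h
  ext i j
  exact congrFun (congrFun h i) j

variable [PartialOrder A] [StarOrderedRing A] [IsClosed (D : Set A)]

theorem cutElt_truncElt_apply_mem {X : CStarMatrix (Fin n) (Fin n) A} (hX : ∀ i j, X i j ∈ D)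
    (hs : IsSelfAdjoint X) {ε κ : ℝ} (hε : 0 < ε) (hκ : 0 ≤ κ) (i j : Fin n) :
    cutElt ε X i j ∈ D ∧ truncElt κ X i j ∈ D := by
  let _ : PartialOrder D := CStarAlgebra.spectralOrder D
  have : StarOrderedRing D := CStarAlgebra.spectralOrderedRing D
  obtain ⟨Y, rfl⟩ := exists_map_eq_of_forall_mem D hX
  have hY : IsSelfAdjoint Y := mapₙₐ_subtype_injective D (by rw [map_star]; exact hs)
  rw [← map_cutElt _ hY hε, ← map_truncElt _ hY hκ]
  exact ⟨(cutElt ε Y i j).2, (truncElt κ Y i j).2⟩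

variable {D} in
theorem exists_norm_conj_truncElt_sub_lt (hD : InC0Prime D) {a b : CStarMatrix (Fin n) (Fin n) A}
    (ha : 0 ≤ a) (hb : 0 ≤ b) (haD : ∀ i j, a i j ∈ D) (hbD : ∀ i j, b i j ∈ D) {ε κ : ℝ}
    (hε : 0 < ε) (hκ : 0 ≤ κ)
    (h : ∀ t ∈ tracialStates D,
      (∑ i, t ⟨cutElt ε a i i,
        (cutElt_truncElt_apply_mem D haD ha.isSelfAdjoint hε hκ i i).1⟩).re ≤
      (∑ i, t ⟨truncElt κ b i i,
        (cutElt_truncElt_apply_mem D hbD hb.isSelfAdjoint hε hκ i i).2⟩).re) :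
    ∃ x, ‖star x * truncElt κ b * x - a‖ < 7 * ε := by
  let _ : PartialOrder D := CStarAlgebra.spectralOrder D
  have : StarOrderedRing D := CStarAlgebra.spectralOrderedRing D
  have hinj := mapₙₐ_subtype_injective D (n := n)
  obtain ⟨a', rfl⟩ := exists_map_eq_of_forall_mem D haD
  obtain ⟨b', rfl⟩ := exists_map_eq_of_forall_mem D hbD
  have ha' : IsSelfAdjoint a' := hinj (by rw [map_star]; exact ha.isSelfAdjoint)
  have hb' : IsSelfAdjoint b' := hinj (by rw [map_star]; exact hb.isSelfAdjoint)
  set f := CStarMatrix.mapₙₐ (n := Fin n) (NonUnitalStarSubalgebraClass.subtype D) with hf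
  have ea := map_cutElt f ha' hε
  have eb := map_truncElt f hb' hκ
  obtain ⟨x, hx⟩ := hD.exists_norm_conj_sub_lt (a := a') (b := truncElt κ b')
    (exists_eq_star_mul_self_of_map_nonneg hinj ha)
    (exists_eq_star_mul_self_of_map_nonneg hinj (by rw [eb]; exact truncElt_nonneg _ _))
    (norm_truncElt_le _ _) hε (fun t ht => by
      have h1 := h t ht
      have e1 : ∀ i, (⟨cutElt ε (f a') i i, (cutElt_truncElt_apply_mem D haD ha.isSelfAdjoint hε
          hκ i i).1⟩ : D) = cutElt ε a' i i := fun i => Subtype.ext (congrFun (congrFun ea.symm i) i)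
      have e2 : ∀ i, (⟨truncElt κ (f b') i i, (cutElt_truncElt_apply_mem D hbD hb.isSelfAdjoint hε
          hκ i i).2⟩ : D) = truncElt κ b' i i := fun i => Subtype.ext (congrFun (congrFun eb.symm i) i)
      rw [Finset.sum_congr rfl fun i _ => congrArg t (e1 i),
        Finset.sum_congr rfl fun i _ => congrArg t (e2 i)] at h1
      exact h1)
  refine ⟨f x, ?_⟩
  rw [← eb, ← map_star, ← map_mul, ← map_mul, ← map_sub]
  exact (NonUnitalStarAlgHom.norm_apply_le f _).trans_lt hx

end Subalgebra

/-! ### Approximation systems and matrices -/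

theorem tendsto_cutElt_sub_map {B B' ι : Type*} [NonUnitalCStarAlgebra B] [NonUnitalCStarAlgebra B']
    {l : Filter ι} {θ : ι → B →ₗ[ℂ] B'} {K : ℝ} (hK : ∀ i x, ‖θ i x‖ ≤ K * ‖x‖)
    (hstar : ∀ i x, IsSelfAdjoint x → IsSelfAdjoint (θ i x))
    (hmul : ∀ x y, Tendsto (fun i => θ i (x * y) - θ i x * θ i y) l (𝓝 0))
    {x : B} (hx : IsSelfAdjoint x) {ε κ : ℝ} (hε : 0 < ε) (hκ : 0 ≤ κ) :
    Tendsto (fun i => cutElt ε (θ i x) - θ i (cutElt ε x)) l (𝓝 0) ∧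
      Tendsto (fun i => truncElt κ (θ i x) - θ i (truncElt κ x)) l (𝓝 0) :=
  ⟨tendsto_cfcₙ_sub_map_cfcₙ hK hstar hmul hx (continuous_cutFn ε) (cutFn_zero hε),
    tendsto_cfcₙ_sub_map_cfcₙ hK hstar hmul hx (continuous_truncFn κ) (truncFn_zero hκ)⟩

section Main

variable {A : Type*} [NonUnitalCStarAlgebra A] [PartialOrder A] [StarOrderedRing A] {n : ℕ}

theorem tendsto_matMap_mul {ι : Type*} {l : Filter ι} {θ : ι → A →CP A}
    (h : ∀ x y, Tendsto (fun i => θ i (x * y) - θ i x * θ i y) l (𝓝 0))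
    (X Y : CStarMatrix (Fin n) (Fin n) A) :
    Tendsto (fun i => matMap n (θ i) (X * Y) - matMap n (θ i) X * matMap n (θ i) Y) l (𝓝 0) := by
  refine tendsto_cstarMatrix fun p q => ?_
  have h1 := tendsto_finsetSum (Finset.univ : Finset (Fin n)) fun k _ => h (X p k) (Y k q)
  rw [Finset.sum_const_zero] at h1
  refine h1.congr fun i => ?_
  rw [CStarMatrix.sub_apply, matMap_apply, CStarMatrix.mul_apply, CStarMatrix.mul_apply, map_sum,
    Finset.sum_sub_distrib]
  rfl

namespace ApproxSystem

variable {a₀ : A} {f₀ : ℝ} {c : A} (S : ApproxSystem a₀ f₀ c)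

theorem tendsto_matMap_add (X : CStarMatrix (Fin n) (Fin n) A) :
    Tendsto (fun i => X - (matMap n (S.φ i) X + matMap n (S.ψ i) X)) atTop (𝓝 0) :=
  tendsto_cstarMatrix fun p q => S.add (X p q)

theorem matMap_mul_matMap (i : ℕ × Finset A) (X Y : CStarMatrix (Fin n) (Fin n) A) :
    matMap n (S.ψ i) Y * matMap n (S.φ i) X = 0 := by
  ext p q
  rw [CStarMatrix.mul_apply]
  exact Finset.sum_eq_zero fun k _ => (S.orth i (X k q) _ (S.mem i (Y p k))).2

theorem tendsto_cutElt_matMap {X : CStarMatrix (Fin n) (Fin n) A} (hX : IsSelfAdjoint X)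
    {ε κ : ℝ} (hε : 0 < ε) (hκ : 0 ≤ κ) :
    Tendsto (fun i => cutElt ε (matMap n (S.ψ i) X) - matMap n (S.ψ i) (cutElt ε X)) atTop (𝓝 0) ∧
    Tendsto (fun i => truncElt κ (matMap n (S.ψ i) X) - matMap n (S.ψ i) (truncElt κ X))
      atTop (𝓝 0) :=
  tendsto_cutElt_sub_map (θ := fun i => matMap n (S.ψ i)) (fun i x => norm_matMap_le (S.norm_ψ i) x)
    (fun i x hx => by rw [IsSelfAdjoint, ← star_matMap, hx.star_eq]) (tendsto_matMap_mul S.mul_ψ)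
    hX hε hκ

/-- If it failed cofinally, choose violating tracial states. Their limit along an ultrafilter of bad
indices is a positive multiple of a tracial state of A that contradicts the strict inequality. -/
theorem eventually_trace_le (h₀ : IsSelfAdjoint a₀) (hf : 0 < f₀)
    {a b : CStarMatrix (Fin n) (Fin n) A} (ha : 0 ≤ a) (hb : 0 ≤ b) {ε κ : ℝ} (hε : 0 < ε)
    (hκ : 0 ≤ κ) (h : ∀ τ ∈ tracialStates A,
      (matTrace τ n (cutElt ε a)).re < (matTrace τ n (truncElt κ b)).re) :
    ∀ᶠ i in atTop, ∀ t ∈ tracialStates (S.D i),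
      (∑ j, t ⟨cutElt ε (matMap n (S.ψ i) a) j j, (cutElt_truncElt_apply_mem (S.D i)
        (fun p q => S.mem i (a p q)) (matMap_nonneg _ ha).isSelfAdjoint hε hκ j j).1⟩).re ≤
      (∑ j, t ⟨truncElt κ (matMap n (S.ψ i) b) j j, (cutElt_truncElt_apply_mem (S.D i)
        (fun p q => S.mem i (b p q)) (matMap_nonneg _ hb).isSelfAdjoint hε hκ j j).2⟩).re := by
  set u : ∀ i, Fin n → S.D i := fun i j => ⟨cutElt ε (matMap n (S.ψ i) a) j j,
    (cutElt_truncElt_apply_mem (S.D i) (fun p q => S.mem i (a p q))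
      (matMap_nonneg _ ha).isSelfAdjoint hε hκ j j).1⟩ with hu
  set v : ∀ i, Fin n → S.D i := fun i j => ⟨truncElt κ (matMap n (S.ψ i) b) j j,
    (cutElt_truncElt_apply_mem (S.D i) (fun p q => S.mem i (b p q))
      (matMap_nonneg _ hb).isSelfAdjoint hε hκ j j).2⟩ with hv
  change ∀ᶠ i in atTop, ∀ t ∈ tracialStates (S.D i), (∑ j, t (u i j)).re ≤ (∑ j, t (v i j)).re
  by_contra hcon
  set P : ℕ × Finset A → Prop := fun i =>
    ∀ t ∈ tracialStates (S.D i), (∑ j, t (u i j)).re ≤ (∑ j, t (v i j)).re with hP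
  have hex : ∀ i, ∃ t ∈ tracialStates (S.D i), ¬ P i → (∑ j, t (v i j)).re < (∑ j, t (u i j)).re := by
    intro i
    by_cases hi : P i
    · obtain ⟨t, ht⟩ := S.tracialStates_nonempty i
      exact ⟨t, ht, fun h => absurd hi h⟩
    · have hi' := hi
      simp only [hP] at hi'
      push Not at hi'
      obtain ⟨t, ht, hlt⟩ := hi'
      exact ⟨t, ht, fun _ => hlt⟩
  choose t ht htP using hex
  have hne : (atTop ⊓ 𝓟 {i | ¬ P i} : Filter (ℕ × Finset A)).NeBot :=
    frequently_mem_iff_neBot.mp (not_eventually.mp hcon)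
  set U := Ultrafilter.of (atTop ⊓ 𝓟 {i | ¬ P i} : Filter (ℕ × Finset A)) with hU
  have hU1 : ↑U ≤ (atTop : Filter (ℕ × Finset A)) := (Ultrafilter.of_le _).trans inf_le_left
  have hU2 : ∀ᶠ i in (U : Filter (ℕ × Finset A)), ¬ P i :=
    (Ultrafilter.of_le _).trans inf_le_right (mem_principal_self _)
  obtain ⟨τ, hτ, r, hr, hlim⟩ := S.exists_limit_trace h₀ hf U hU1 ht
  have key : ∀ (X : CStarMatrix (Fin n) (Fin n) A) (w : ∀ i, Fin n → S.D i),
      (∀ j, Tendsto (fun i => (w i j : A) - S.ψD i (X j j)) atTop (𝓝 0)) →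
      Tendsto (fun i => (∑ j, t i (w i j)).re) U (𝓝 (r * (matTrace τ n X).re)) := by
    intro X w hw
    have h1 : Tendsto (fun i => ∑ j, t i (w i j)) U (𝓝 (∑ j, r * τ (X j j))) := by
      refine tendsto_finsetSum _ fun j _ => ?_
      have h2 := (hlim (X j j)).add ((S.tendsto_trace_sub ht (hw j)).mono_left hU1)
      simpa using h2
    have h2 := (Complex.continuous_re.tendsto _).comp h1
    rwa [← Finset.mul_sum, Complex.re_ofReal_mul] at h2
  have h1 := key (cutElt ε a) u fun j => tendsto_cstarMatrix_apply
    (S.tendsto_cutElt_matMap ha.isSelfAdjoint hε hκ).1 j j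
  have h2 := key (truncElt κ b) v fun j => tendsto_cstarMatrix_apply
    (S.tendsto_cutElt_matMap hb.isSelfAdjoint hε hκ).2 j j
  have h3 := le_of_tendsto_of_tendsto h2 h1 (hU2.mono fun i hi => (htP i hi).le)
  exact absurd (h τ hτ) (not_lt.mpr (le_of_mul_le_mul_left h3 hr))

theorem eventually_exists_norm_conj_sub_lt (h₀ : IsSelfAdjoint a₀) (hf : 0 < f₀)
    {a b : CStarMatrix (Fin n) (Fin n) A} (ha : 0 ≤ a) (hb : 0 ≤ b) {ε κ : ℝ} (hε : 0 < ε)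
    (hκ : 0 ≤ κ) (h : ∀ τ ∈ tracialStates A,
      (matTrace τ n (cutElt ε a)).re < (matTrace τ n (truncElt κ b)).re) :
    ∀ᶠ i in atTop, ∃ x, ‖star x * truncElt κ (matMap n (S.ψ i) b) * x - matMap n (S.ψ i) a‖
      < 7 * ε := by
  filter_upwards [S.eventually_trace_le h₀ hf ha hb hε hκ h] with i hi
  exact exists_norm_conj_truncElt_sub_lt (S.inC0Prime i) (matMap_nonneg _ ha) (matMap_nonneg _ hb)
    (fun p q => S.mem i (a p q)) (fun p q => S.mem i (b p q)) hε hκ hi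

/-- The part of an approximation given by the small map is dominated by `c`. -/
theorem eventually_exists_norm_conj_diagHom_sub_lt (X : CStarMatrix (Fin n) (Fin n) A) {ε : ℝ}
    (hε : 0 < ε) : ∀ᶠ i in atTop, ∃ y, ‖star y * diagHom n c * y
      - matMap n (S.φ i) (star X * diagHom n a₀ * X)‖ < ε := by
  -- By asymptotic multiplicativity φ(X*a₀X) is close to φ(X)*φ(a₀)φ(X), and φ(a₀) is approximated
  -- by conjugates of c.
  have h1 : Tendsto (fun i => matMap n (S.φ i) (star X * (diagHom n a₀ * X))
      - star (matMap n (S.φ i) X) * (diagHom n (S.φ i a₀) * matMap n (S.φ i) X)) atTop (𝓝 0) := by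
    have e1 := tendsto_matMap_mul S.mul_φ (star X) (diagHom n a₀ * X)
    have e2 := tendsto_matMap_mul S.mul_φ (diagHom n a₀) X
    have e3 : Tendsto (fun i => star (matMap n (S.φ i) X) * (matMap n (S.φ i) (diagHom n a₀ * X)
        - matMap n (S.φ i) (diagHom n a₀) * matMap n (S.φ i) X)) atTop (𝓝 0) := by
      refine squeeze_zero_norm (a := fun i => ((n * n : ℝ) * ‖X‖) *
        ‖matMap n (S.φ i) (diagHom n a₀ * X)
        - matMap n (S.φ i) (diagHom n a₀) * matMap n (S.φ i) X‖) (fun i => ?_) ?_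
      · refine (norm_mul_le _ _).trans (mul_le_mul_of_nonneg_right ?_ (norm_nonneg _))
        rw [norm_star]; exact norm_matMap_le (S.norm_φ i) X
      · simpa using (tendsto_zero_iff_norm_tendsto_zero.mp e2).const_mul ((n * n : ℝ) * ‖X‖)
    have e4 := e1.add e3
    rw [add_zero] at e4
    refine e4.congr fun i => ?_
    rw [star_matMap, matMap_diagHom, mul_sub]
    abel
  filter_upwards [(tendsto_zero_iff_norm_tendsto_zero.mp h1).eventually_lt_const (half_pos hε)]
    with i hi
  obtain ⟨z, hz⟩ := S.cuntzLE i
  set Y := matMap n (S.φ i) X with hY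
  have hd : Continuous (diagHom (A := A) n) := map_continuous (diagHom (A := A) n)
  have h2 : Tendsto (fun k => star Y * (diagHom n (star (z k) * c * z k) * Y)) atTop
      (𝓝 (star Y * (diagHom n (S.φ i a₀) * Y))) :=
    (((hd.tendsto _).comp hz).mul_const Y).const_mul (star Y)
  obtain ⟨k, hk⟩ := ((tendsto_iff_norm_sub_tendsto_zero.mp h2).eventually_lt_const
    (half_pos hε)).exists
  refine ⟨diagHom n (z k) * Y, ?_⟩
  have e : star (diagHom n (z k) * Y) * diagHom n c * (diagHom n (z k) * Y)
      = star Y * (diagHom n (star (z k) * c * z k) * Y) := by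
    rw [map_mul, map_mul, map_star, star_mul]; simp only [mul_assoc]
  rw [e, mul_assoc (star X)]
  have h3 := norm_sub_le_norm_sub_add_norm_sub (star Y * (diagHom n (star (z k) * c * z k) * Y))
    (star Y * (diagHom n (S.φ i a₀) * Y)) (matMap n (S.φ i) (star X * (diagHom n a₀ * X)))
  rw [norm_sub_rev (star Y * (diagHom n (S.φ i a₀) * Y))] at h3
  linarith

end ApproxSystem

end Main

/-! ### Strict comparison -/

section Roots

variable {B : Type*} [NonUnitalCStarAlgebra B] [PartialOrder B] [StarOrderedRing B]

theorem exists_eq_star_mul_self {a : B} (h : 0 ≤ a) : ∃ s, a = star s * s :=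
  CStarAlgebra.nonneg_iff_eq_star_mul_self.mp h

theorem exists_sqrt {b : B} (hb : 0 ≤ b) :
    ∃ s, star s = s ∧ s * s = b ∧ ∀ e, e * b = b → e * s = s :=
  ⟨CFC.sqrt b, (CFC.sqrt_nonneg b).isSelfAdjoint, CFC.sqrt_mul_sqrt_self b hb,
    fun _ he => mul_sqrt_eq hb he⟩

end Roots

section Main

variable {A : Type*} [NonUnitalCStarAlgebra A]

/-- The matrix X is supported in row i, so conjugation sees only the entry h i i, and the orthogonal
copies below it are spread along the diagonal. -/
theorem exists_conj_eq_diagHom {n N : ℕ} {h : CStarMatrix (Fin n) (Fin n) A} {i : Fin n}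
    {x : Fin N → A} {c : A} (hx : ∀ j k, star (x j) * h i i * x k = if j = k then c else 0)
    (hn : n ≤ N) : ∃ X, star X * h * X = diagHom n c := by
  obtain ⟨X, hX⟩ : ∃ X : CStarMatrix (Fin n) (Fin n) A,
      ∀ p q, X p q = if p = i then x (Fin.castLE hn q) else 0 :=
    ⟨CStarMatrix.ofMatrix fun p q => if p = i then x (Fin.castLE hn q) else 0, fun _ _ => rfl⟩
  refine ⟨X, ?_⟩
  ext j k
  simp only [CStarMatrix.mul_apply, CStarMatrix.star_apply, hX, diagHom_apply, mul_ite, mul_zero, Finset.sum_ite_eq', Finset.mem_univ, if_true, apply_ite star,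
    star_zero, ite_mul, zero_mul, hx, (Fin.castLE_injective hn).eq_iff]

theorem isCompact_closure_tracialStates : IsCompact (closure (tracialStates A)) := by
  refine (WeakDual.isCompact_closedBall (0 : StrongDual ℂ A) 1).of_isClosed_subset isClosed_closure
    (closure_minimal (fun τ hτ => ?_) (WeakDual.isClosed_closedBall _ _))
  rw [Set.mem_preimage, mem_closedBall_zero_iff, hτ.2.2]

variable [PartialOrder A] [StarOrderedRing A] {n : ℕ}

theorem apply_self_nonneg {h : CStarMatrix (Fin n) (Fin n) A} (hh : 0 ≤ h) (i : Fin n) :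
    0 ≤ h i i := by
  obtain ⟨s, rfl⟩ := exists_eq_star_mul_self hh
  rw [CStarMatrix.mul_apply]
  exact Finset.sum_nonneg fun k _ => star_mul_self_nonneg (s k i)

/-- Approximate the entries of a^{1/2} by elements a₀ya₀, so that a^{1/2} ≈ a₀V. Conjugating a₀ by
a₀^{1/2}V then gives (a₀V)*(a₀V) ≈ a. -/
theorem IsStrictlyPosElt.exists_norm_conj_diagHom_sub_lt {a₀ : A} (h₀ : IsStrictlyPosElt a₀)
    {a : CStarMatrix (Fin n) (Fin n) A} (ha : 0 ≤ a) {η : ℝ} (hη : 0 < η) :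
    ∃ Y, ‖star Y * diagHom n a₀ * Y - a‖ < η := by
  obtain ⟨s, hss, hsa, -⟩ := exists_sqrt ha
  have hex : ∀ (k : ℕ) (p q : Fin n), ∃ y, ‖a₀ * y * a₀ - s p q‖ < 1 / ((k : ℝ) + 1) := by
    intro k p q
    obtain ⟨_, hy, ⟨y, rfl⟩⟩ := Metric.dense_iff.mp h₀.2 (s p q) (1 / ((k : ℝ) + 1))
      (by positivity)
    exact ⟨y, mem_ball_iff_norm.mp hy⟩
  choose y hy using hex
  set V : ℕ → CStarMatrix (Fin n) (Fin n) A := fun k =>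
    CStarMatrix.ofMatrix fun p q => y k p q * a₀ with hV
  have h1 : Tendsto (fun k => diagHom n a₀ * V k) atTop (𝓝 s) := by
    refine tendsto_cstarMatrix fun p q => ?_
    rw [tendsto_iff_norm_sub_tendsto_zero]
    refine squeeze_zero (fun _ => norm_nonneg _) (fun k => ?_) tendsto_one_div_add_atTop_nhds_zero_nat
    have e : (diagHom n a₀ * V k) p q = a₀ * y k p q * a₀ := by
      simp only [CStarMatrix.mul_apply, diagHom_apply, ite_mul, zero_mul, Finset.sum_ite_eq,
        Finset.mem_univ, if_true, hV, mul_assoc]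
      rfl
    rw [e]
    exact (hy k p q).le
  have h2 : Tendsto (fun k => star (diagHom n a₀ * V k) * (diagHom n a₀ * V k)) atTop (𝓝 a) := by
    have := h1.star.mul h1
    rwa [hss, hsa] at this
  obtain ⟨k, hk⟩ := ((tendsto_iff_norm_sub_tendsto_zero.mp h2).eventually_lt_const hη).exists
  have hq : CFC.sqrt a₀ * CFC.sqrt a₀ = a₀ := CFC.sqrt_mul_sqrt_self a₀ h₀.1
  have hqs : star (CFC.sqrt a₀) = CFC.sqrt a₀ := (CFC.sqrt_nonneg a₀).isSelfAdjoint
  refine ⟨diagHom n (CFC.sqrt a₀) * V k, ?_⟩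
  have e : star (diagHom n (CFC.sqrt a₀) * V k) * diagHom n a₀ * (diagHom n (CFC.sqrt a₀) * V k)
      = star (diagHom n a₀ * V k) * (diagHom n a₀ * V k) := by
    calc _ = star (V k) * diagHom n (CFC.sqrt a₀ * a₀ * CFC.sqrt a₀) * V k := by
          rw [star_mul, ← map_star, hqs, map_mul, map_mul]; simp only [mul_assoc]
      _ = star (V k) * diagHom n (a₀ * a₀) * V k := by
          congr 3
          conv_lhs => arg 1; arg 2; rw [← hq]
          conv_rhs => rw [← hq]
          simp only [mul_assoc]
      _ = _ := by
          rw [star_mul, ← map_star, h₀.1.isSelfAdjoint.star_eq, map_mul]; simp only [mul_assoc]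
  rw [e]
  exact hk

/-- Multiplication by the cut-down moves c by at most ‖c‖/4 on either side, so the product is within
‖c‖/2 of c. -/
theorem cutElt_mul_mul_cutElt_ne_zero {c : A} (hc : 0 ≤ c) (hc0 : c ≠ 0) :
    cutElt (2 * (‖c‖ / 8)) c * c * cutElt (2 * (‖c‖ / 8)) c ≠ 0 := by
  have hn : 0 < ‖c‖ := norm_pos_iff.mpr hc0
  set f := cutElt (2 * (‖c‖ / 8)) c with hf
  have h1 : ‖f * c - c‖ ≤ 2 * (‖c‖ / 8) := norm_cutFn_mul_sub_le hc (by positivity)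
  have hfs : star f = f := isSelfAdjoint_cutElt _ _
  have h2 : ‖c * f - c‖ ≤ 2 * (‖c‖ / 8) := by
    rw [← norm_star, star_sub, star_mul, hfs, hc.isSelfAdjoint.star_eq]; exact h1
  have hf1 : ‖f‖ ≤ 1 := norm_cfcₙ_cutFn_le _ _
  intro h0
  have h3 : -c = (f * c - c) * f + (c * f - c) := by
    rw [sub_mul, h0]; abel
  have h4 := norm_add_le ((f * c - c) * f) (c * f - c)
  rw [← h3, norm_neg] at h4
  have h5 := norm_mul_le_of_le h1 hf1
  linarith

/-- The corner b' of f_δ(b) takes care of ψ(a) by comparison in D. The reserved orthogonal piece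
contains a copy of diag(c'), and choosing the approximation with φ(a₀) below c' lets that piece
absorb φ(a). -/
theorem exists_norm_conj_sub_lt_of_trace_add_le (hA : IsSimpleCStar A) (hn : IsNonUnital A) {a₀ : A}
    {f₀ : ℝ} (h₀ : IsStrictlyPosElt a₀) (hf : 0 < f₀)
    (hS : ∀ c : A, 0 ≤ c → c ≠ 0 → Nonempty (ApproxSystem a₀ f₀ c))
    (hT : (tracialStates A).Nonempty) {a b : CStarMatrix (Fin n) (Fin n) A} (ha : 0 ≤ a)
    (hb : 0 ≤ b) {ε δ : ℝ} (hε : 0 < ε) (hδ : 0 < δ)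
    (h : ∀ τ ∈ tracialStates A,
      (matTrace τ n (cutElt ε a)).re + δ ≤ (matTrace τ n (cutElt δ b)).re) :
    ∃ X, ‖star X * b * X - a‖ < 10 * ε := by
  have hsa₀ : IsSelfAdjoint a₀ := h₀.1.isSelfAdjoint
  have hP : ∀ τ ∈ tracialStates A, IsPosTrace (matTraceₗ τ n) ∧ ∀ x, ‖τ x‖ ≤ ‖x‖ := fun τ hτ =>
    ⟨isPosTrace_matTraceₗ (isPosTrace_of_mem_closure_tracialStates (subset_closure hτ)).1,
      norm_apply_le_of_mem_tracialStates hτ⟩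
  set H := cutElt δ b with hH
  have hH0 : 0 ≤ H := cutElt_nonneg _ _
  have hH1 : ‖H‖ ≤ 1 := norm_cfcₙ_cutFn_le _ _
  obtain ⟨i, hi⟩ : ∃ i, H i i ≠ 0 := by
    by_contra! hc
    obtain ⟨τ, hτ⟩ := hT
    have h1 := h τ hτ
    have h2 : matTrace τ n H = 0 := Finset.sum_eq_zero fun i _ => by rw [hc i, map_zero]
    have h3 : 0 ≤ (matTraceₗ τ n (cutElt ε a)).re :=
      (Complex.le_def.mp ((hP τ hτ).1.nonneg (cutElt_nonneg ε a))).1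
    rw [h2, Complex.zero_re] at h1
    change 0 ≤ (matTrace τ n (cutElt ε a)).re at h3
    linarith
  have hn0 : (1 : ℝ) ≤ n := by
    have := i.pos
    exact_mod_cast this
  obtain ⟨M, hM⟩ := exists_nat_gt (8 / δ)
  have hM0 : (0 : ℝ) < M := lt_trans (by positivity) hM
  rw [div_lt_iff₀ hδ] at hM
  -- There are nM + 1 copies: at least n to fill the diagonal, and enough to give nτ(f_r(c)) ≤ 1/M <
  -- δ/8.
  obtain ⟨x, c, hc, hc0, hx⟩ := exists_conj_eq_ite hA hn hT (apply_self_nonneg hH0 i) hi (n * M)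
  have hM1 : 1 ≤ M := by exact_mod_cast hM0
  obtain ⟨X, hX⟩ := exists_conj_eq_diagHom hx (by nlinarith)
  obtain ⟨s, hss, hsH, hes⟩ := exists_sqrt hH0
  set T := s * X with hTd
  have hTT : star T * T = diagHom n c := by
    rw [← hX, ← hsH, hTd, star_mul, hss]; simp only [mul_assoc]
  set r := ‖c‖ / 8 with hr
  have hr0 : 0 < r := div_pos (norm_pos_iff.mpr hc0) (by norm_num)
  set c' := cutElt (2 * r) c * c * cutElt (2 * r) c with hc'
  have hc'0 : c' ≠ 0 := cutElt_mul_mul_cutElt_ne_zero hc hc0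
  have hc'1 : 0 ≤ c' := by
    have := star_left_conjugate_nonneg hc (cutElt (2 * r) c)
    rwa [(isSelfAdjoint_cutElt _ _).star_eq] at this
  have hTCT : star T * (cutElt (2 * r) (T * star T) * cutElt (2 * r) (T * star T)) * T
      = diagHom n c' := by
    rw [star_mul_cutElt_mul_cutElt_mul T (by linarith), hTT,
      ← map_cutElt _ hc.isSelfAdjoint (by linarith), ← map_mul, ← map_mul]
  set E := cutElt r (T * star T) with hE
  have hE0 : 0 ≤ E := cutElt_nonneg _ _
  have hEE : E * E ≤ E := cfcₙ_cutFn_mul_self_le hr0 _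
  set b' := cornerCompl E H with hb'
  have hb'0 : 0 ≤ b' := cornerCompl_nonneg hE0.isSelfAdjoint hH0
  have hb'1 : ‖b'‖ ≤ 1 := (norm_cornerCompl_le hE0 hEE hH0).trans hH1
  -- Passing to the corner costs at most 2 · δ/8 in trace and truncating at δ/(4n) at most δ/4, so
  -- half of the gap δ survives.
  have htr : ∀ τ ∈ tracialStates A,
      (matTrace τ n (cutElt ε a)).re < (matTrace τ n (truncElt (δ / (4 * n)) b')).re := by
    intro τ hτ
    obtain ⟨h1, h2⟩ := hP τ hτ
    have h3 := h1.le_re_cornerCompl hE0 hH0 hH1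
    have h4 : matTraceₗ τ n E = n * τ (cutElt r c) := by
      have h5 : matTraceₗ τ n (cutElt r (star T * T)) = matTraceₗ τ n E :=
        trace_cutFn_star_mul_self h1.2 T hr0
      rw [← h5, hTT, ← map_cutElt _ hc.isSelfAdjoint hr0]
      exact matTrace_diagHom τ _
    have h5 : ((n * M + 1 : ℕ) : ℝ) * (τ (cutElt r c)).re ≤ 1 :=
      card_mul_trace_cutFn_le (apply_self_nonneg hH0 i) hx hτ hr0
    have h6 : (matTraceₗ τ n E).re ≤ δ / 8 := by
      have h7 : (matTraceₗ τ n E).re = n * (τ (cutElt r c)).re := by rw [h4]; simp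
      have h8 : 0 ≤ (τ (cutElt r c)).re :=
        (Complex.le_def.mp ((isPosTrace_of_mem_closure_tracialStates
          (subset_closure hτ)).1.nonneg (cutElt_nonneg r c))).1
      push_cast at h5
      have h9 : M * (n * (τ (cutElt r c)).re) ≤ 1 := by nlinarith
      rw [h7]
      by_contra! h10
      nlinarith
    have h7 := (Complex.re_le_norm _).trans (norm_matTraceₗ_le h2 (b' - truncElt (δ / (4 * n)) b'))
    have h8 := mul_le_mul_of_nonneg_left (norm_sub_truncElt_le (κ := δ / (4 * n)) (by positivity)
      hb'0 hb'1) (by linarith : (0 : ℝ) ≤ n)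
    have h9 : (n : ℝ) * (δ / (4 * n)) = δ / 4 := by field_simp
    rw [map_sub, Complex.sub_re] at h7
    have h10 := h τ hτ
    change (matTraceₗ τ n (cutElt ε a)).re + δ ≤ (matTraceₗ τ n H).re at h10
    change (matTraceₗ τ n (cutElt ε a)).re < (matTraceₗ τ n (truncElt (δ / (4 * n)) b')).re
    linarith
  obtain ⟨S⟩ := hS c' hc'1 hc'0
  have hκ : 0 < δ / (4 * n) := by positivity
  -- The denominator compensates the factor n² by which `matMap` may enlarge the error.
  obtain ⟨Y, hY⟩ := h₀.exists_norm_conj_diagHom_sub_lt ha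
    (η := ε / (2 * (n * n + 1))) (by positivity)
  have e1 := S.eventually_exists_norm_conj_sub_lt hsa₀ hf ha hb'0 hε hκ.le htr
  have e2 := S.eventually_exists_norm_conj_diagHom_sub_lt Y (half_pos hε)
  have e3 : ∀ᶠ j in atTop, (δ / (4 * n))⁻¹ * (n * n * ‖a‖ + 7 * ε) *
      ‖b' - (matMap n (S.φ j) b' + matMap n (S.ψ j) b')‖ < ε / 2 := by
    have := (tendsto_zero_iff_norm_tendsto_zero.mp (S.tendsto_matMap_add b')).const_mul
      ((δ / (4 * n))⁻¹ * (n * n * ‖a‖ + 7 * ε))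
    rw [mul_zero] at this
    exact this.eventually_lt_const (half_pos hε)
  have e4 := (tendsto_zero_iff_norm_tendsto_zero.mp (S.tendsto_matMap_add a)).eventually_lt_const
    (half_pos hε)
  classical
  obtain ⟨j, ⟨x₁, hx₁⟩, ⟨y, hy⟩, h3, h4⟩ := (e1.and (e2.and (e3.and e4))).exists
  obtain ⟨x₂, hx₂⟩ := exists_norm_conj_sub_le_of_orthogonal (b := b') (matMap_nonneg (S.ψ j) hb'0)
    (S.matMap_mul_matMap j b' b') hκ hx₁.le
  have heT : cutElt (δ / 2) b * T = T := by
    rw [hTd, ← mul_assoc, hes _ (cutElt_mul_cutElt (half_pos hδ) le_rfl)]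
  obtain ⟨Z, hZ⟩ := exists_conj_eq_add hδ hr0 heT hb.isSelfAdjoint x₂ y
  refine ⟨Z, ?_⟩
  rw [hTCT] at hZ
  have h5 : ‖star x₂ * b' * x₂ - matMap n (S.ψ j) a‖ ≤ 7 * ε + ε / 2 := by
    refine hx₂.trans (add_le_add le_rfl (le_trans ?_ h3.le))
    refine mul_le_mul_of_nonneg_right (mul_le_mul_of_nonneg_left ?_ (by positivity)) (norm_nonneg _)
    have := norm_matMap_le (S.norm_ψ j) a
    linarith
  have h6 : ‖matMap n (S.φ j) (star Y * diagHom n a₀ * Y) - matMap n (S.φ j) a‖ ≤ ε / 2 := by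
    rw [← map_sub]
    refine (norm_matMap_le (S.norm_φ j) _).trans
      ((mul_le_mul_of_nonneg_left hY.le (by positivity)).trans ?_)
    rw [mul_div_assoc', div_le_div_iff₀ (by positivity) (by norm_num)]
    nlinarith
  -- The four differences are bounded by 15ε/2, ε/2, ε/2 and ε/2, which makes 9ε.
  have h7 : star Z * b * Z - a = (star x₂ * b' * x₂ - matMap n (S.ψ j) a)
      + (star y * diagHom n c' * y - matMap n (S.φ j) (star Y * diagHom n a₀ * Y))
      + (matMap n (S.φ j) (star Y * diagHom n a₀ * Y) - matMap n (S.φ j) a)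
      - (a - (matMap n (S.φ j) a + matMap n (S.ψ j) a)) := by
    rw [hZ]; abel
  rw [h7]
  refine (norm_sub_le _ _).trans_lt ?_
  have h8 := norm_add₃_le (a := star x₂ * b' * x₂ - matMap n (S.ψ j) a)
    (b := star y * diagHom n c' * y - matMap n (S.φ j) (star Y * diagHom n a₀ * Y))
    (c := matMap n (S.φ j) (star Y * diagHom n a₀ * Y) - matMap n (S.φ j) a)
  linarith

theorem IsPosTrace.re_cutElt_mono {B : Type*} [NonUnitalCStarAlgebra B] [PartialOrder B]
    [StarOrderedRing B] {σ : B →ₗ[ℂ] ℂ} (hσ : IsPosTrace σ) (b : B) {δ ε : ℝ} (hδ : 0 < δ)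
    (h : δ ≤ ε) : (σ (cutElt ε b)).re ≤ (σ (cutElt δ b)).re :=
  hσ.mono (cfcₙ_mono (fun _ _ => cutFn_mono_left hδ h) (continuous_cutFn _).continuousOn
    (continuous_cutFn _).continuousOn (cutFn_zero (hδ.trans_le h)) (cutFn_zero hδ))

/-- At each τ some f_δ(b) already exceeds f_ε(a) in trace, and the strict inequality persists near
τ. Cut-downs grow as δ shrinks, so finitely many δ can be replaced by their minimum, which serves
both as cut-off and as gap. -/
theorem exists_trace_add_le {a b : CStarMatrix (Fin n) (Fin n) A}
    (h : ∀ τ ∈ closure (tracialStates A), dimFn (matTrace τ n) a < dimFn (matTrace τ n) b) {ε : ℝ}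
    (hε : 0 < ε) (hε1 : ε < 1) : ∃ δ : ℝ, 0 < δ ∧ ∀ τ ∈ closure (tracialStates A),
      (matTrace τ n (cutElt ε a)).re + δ ≤ (matTrace τ n (cutElt δ b)).re := by
  have hmono : ∀ τ ∈ closure (tracialStates A), ∀ δ δ' : ℝ, 0 < δ → δ ≤ δ' →
      (matTrace τ n (cutElt δ' b)).re ≤ (matTrace τ n (cutElt δ b)).re := fun τ hτ δ δ' hδ hle =>
    (isPosTrace_matTraceₗ (isPosTrace_of_mem_closure_tracialStates hτ).1).re_cutElt_mono b hδ hle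
  have hcont : ∀ X : CStarMatrix (Fin n) (Fin n) A,
      Continuous fun τ : WeakDual ℂ A => (matTrace τ n X).re := fun X =>
    Complex.continuous_re.comp (continuous_finsetSum _ fun i _ => WeakDual.eval_continuous (X i i))
  have key : ∃ δ : ℝ, 0 < δ ∧ ∀ τ ∈ closure (tracialStates A), τ ∈ closure (tracialStates A) →
      (matTrace τ n (cutElt ε a)).re + δ ≤ (matTrace τ n (cutElt δ b)).re := by
    refine isCompact_closure_tracialStates.induction_on
      (p := fun K => ∃ δ : ℝ, 0 < δ ∧ ∀ τ ∈ K, τ ∈ closure (tracialStates A) →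
        (matTrace τ n (cutElt ε a)).re + δ ≤ (matTrace τ n (cutElt δ b)).re) ?_ ?_ ?_ ?_
    · exact ⟨1, one_pos, by simp⟩
    · rintro K L hKL ⟨δ, hδ, hL⟩
      exact ⟨δ, hδ, fun τ hτ => hL τ (hKL hτ)⟩
    · rintro K L ⟨δ, hδ, hK⟩ ⟨δ', hδ', hL⟩
      refine ⟨min δ δ', lt_min hδ hδ', fun τ hτ hτT => ?_⟩
      rcases hτ with hτ | hτ
      · have h1 := hmono τ hτT _ _ (lt_min hδ hδ') (min_le_left δ δ')
        have h2 := hK τ hτ hτT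
        linarith [min_le_left δ δ']
      · have h1 := hmono τ hτT _ _ (lt_min hδ hδ') (min_le_right δ δ')
        have h2 := hL τ hτ hτT
        linarith [min_le_right δ δ']
    · intro τ hτ
      have h1 : ENNReal.ofReal (matTrace τ n (cutElt ε a)).re ≤ dimFn (matTrace τ n) a :=
        le_iSup₂ (f := fun ε (_ : ε ∈ Set.Ioo (0 : ℝ) 1) =>
          ENNReal.ofReal (matTrace τ n (cutElt ε a)).re) ε ⟨hε, hε1⟩
      have h2 := h1.trans_lt (h τ hτ)
      obtain ⟨δ, h3⟩ := lt_iSup_iff.mp h2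
      obtain ⟨hδ, h4⟩ := lt_iSup_iff.mp h3
      have h5 : (matTrace τ n (cutElt ε a)).re < (matTrace τ n (cutElt δ b)).re :=
        (ENNReal.ofReal_lt_ofReal_iff').mp h4 |>.1
      set γ := ((matTrace τ n (cutElt δ b)).re - (matTrace τ n (cutElt ε a)).re) / 2 with hγ
      have hγ0 : 0 < γ := by rw [hγ]; linarith
      refine ⟨{τ' | (matTrace τ' n (cutElt ε a)).re + γ < (matTrace τ' n (cutElt δ b)).re},
        mem_nhdsWithin_of_mem_nhds ((isOpen_lt ((hcont _).add continuous_const)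
          (hcont _)).mem_nhds ?_), min δ γ, lt_min hδ.1 hγ0, fun τ' hτ' hτT => ?_⟩
      · change (matTrace τ n (cutElt ε a)).re + γ < (matTrace τ n (cutElt δ b)).re
        linarith
      · have h6 := hmono τ' hτT _ _ (lt_min hδ.1 hγ0) (min_le_left δ γ)
        have h7 : (matTrace τ' n (cutElt ε a)).re + γ < (matTrace τ' n (cutElt δ b)).re := hτ'
        linarith [min_le_right δ γ]
  obtain ⟨δ, hδ, hk⟩ := key
  exact ⟨δ, hδ, fun τ hτ => hk τ hτ hτ⟩

theorem cuntzLE_of_forall_exists {B : Type*} [NonUnitalCStarAlgebra B] {a b : B}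
    (h : ∀ ε : ℝ, 0 < ε → ε < 1 → ∃ X, ‖star X * b * X - a‖ < 10 * ε) : CuntzLE a b := by
  -- The shift by 2 keeps the tolerance strictly below 1 already at k = 0.
  have h1 := fun k : ℕ => h (1 / ((k : ℝ) + 2)) (by positivity)
    (by rw [div_lt_one (by positivity)]; linarith [(Nat.cast_nonneg k : (0 : ℝ) ≤ k)])
  choose X hX using h1
  refine ⟨X, tendsto_iff_norm_sub_tendsto_zero.mpr (squeeze_zero (fun _ => norm_nonneg _)
    (fun k => (hX k).le) ?_)⟩
  have h2 : Tendsto (fun k : ℕ => (k : ℝ) + 2) atTop atTop :=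
    tendsto_atTop_add_const_right _ _ tendsto_natCast_atTop_atTop
  simpa using (h2.const_div_atTop 1).const_mul 10

theorem hasStrongStrictComparison (hA : InClassD A) : HasStrongStrictComparison A := by
  obtain ⟨hn, hs, a₀, h₀, h1, f₀, hf, -, h⟩ := hA
  have hS : ∀ c : A, 0 ≤ c → c ≠ 0 → Nonempty (ApproxSystem a₀ f₀ c) := fun c hc hc0 =>
    exists_approxSystem h hc hc0
  have hT : (tracialStates A).Nonempty := by
    obtain ⟨S⟩ := hS a₀ h₀.1 (by rintro rfl; simp at h1)
    exact S.nonempty_tracialStates h₀.1.isSelfAdjoint hf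
  refine ⟨hT, zero_notMem_closure_tracialStates (r := f₀ / 32) (by positivity)
    fun τ hτ => le_trace_cutFn hs hn h₀ h1 hf hS hτ, fun n a b ha hb hab =>
    cuntzLE_of_forall_exists fun ε hε hε1 => ?_⟩
  obtain ⟨δ, hδ, hle⟩ := exists_trace_add_le hab hε hε1
  exact exists_norm_conj_sub_lt_of_trace_add_le hs hn h₀ hf hS hT ha hb hε hδ
    fun τ hτ => hle τ (subset_closure hτ)

theorem dimFn_matTrace_diagHom (τ : WeakDual ℂ A) {a : A} (ha : IsSelfAdjoint a) :
    dimFn (matTrace τ 1) (diagHom 1 a) = dimFn τ a := by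
  refine iSup_congr fun ε => iSup_congr fun hε => ?_
  have h1 : matTrace τ 1 (cutElt ε (diagHom 1 a)) = τ (cutElt ε a) := by
    rw [← map_cutElt _ ha hε.1, matTrace_diagHom, Nat.cast_one, one_mul]
  exact congrArg (fun z : ℂ => ENNReal.ofReal z.re) h1

theorem cuntzLE_of_diagHom {a b : A} (h : CuntzLE (diagHom 1 a) (diagHom 1 b)) : CuntzLE a b := by
  obtain ⟨X, hX⟩ := h
  refine ⟨fun k => X k 0 0, (tendsto_cstarMatrix_apply hX 0 0).congr fun k => ?_⟩
  simp [CStarMatrix.mul_apply, CStarMatrix.star_apply, diagHom_apply]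

end Main

theorem mainTheorem11 (A : Type*) [NonUnitalCStarAlgebra A] [PartialOrder A] [StarOrderedRing A]
    [TopologicalSpace.SeparableSpace A] (hA : InClassD A) :
    (∀ a b : A, 0 ≤ a → ‖a‖ ≤ 1 → 0 ≤ b → ‖b‖ ≤ 1 →
      (∀ τ ∈ closure (tracialStates A), dimFn τ a < dimFn τ b) → CuntzLE a b) ∧
    HasStrongStrictComparison A := by
  have h := hasStrongStrictComparison hA
  have hpos : ∀ a : A, 0 ≤ a → 0 ≤ diagHom 1 a := fun a ha => by
    obtain ⟨s, rfl⟩ := exists_eq_star_mul_self ha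
    rw [map_mul, map_star]
    exact star_mul_self_nonneg _
  refine ⟨fun a b ha _ hb _ hab => cuntzLE_of_diagHom
    (h.2.2 1 _ _ (hpos a ha) (hpos b hb) fun τ hτ => ?_), h⟩
  rw [dimFn_matTrace_diagHom τ ha.isSelfAdjoint, dimFn_matTrace_diagHom τ hb.isSelfAdjoint]
  exact hab τ hτ
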